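/- Let $k$ be an algebraically closed field of arbitrary characteristic, $R=k[X_0,X_1,X_2,X_3]$ with the standard grading, and let $\mathcal F$ be a reflexive coherent sheaf of rank $2$ on $\mathbb P^3=\operatorname{Proj} R$. Let $F=\bigoplus_{v\in\mathbb Z}H^0(\mathbb P^3,\mathcal F(v))$ and $E=\bigoplus_{v\in\mathbb Z}H^2(\mathbb P^3,\mathcal F(v))$, considered as graded $R$-modules, and put $h^j(\mathcal F(i))=\dim_k H^j(\mathbb P^3,\mathcal F(i))$. For graded $R$-modules $N,N'$ let ${}_v\mathrm{Hom}_R(N,N')$ denote the $k$-vector space of $R$-linear maps $N\to N'$ that are homogeneous of degree $v$. Let $$\cdots\to P_2\to P_1\to P_0\to F\to 0,\qquad P_{j-1}=\bigoplus_i R(-i)^{\beta_{j,i}},$$ be the minimal graded free resolution of $F$, so that the $\beta_{j,i}$ are the graded Betti numbers of $F$. If ${}_{-4}\mathrm{Hom}_R(F,F)=0$, then ${}_0\mathrm{Hom}_R(F,E)$ is finite-dimensional over $k$ and $$\dim_k\,{}_0\mathrm{Hom}_R(F,E)=\sum_{i\in\mathbb Z}\bigl(\beta_{1,i}-\beta_{2,i}+\beta_{3,i}\bigr)\cdot\bigl(h^2(\mathcal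 F(i))-h^3(\mathcal F(i))\bigr).$$ -/

import Mathlib

noncomputable section

universe u

open AlgebraicGeometry CategoryTheory TopologicalSpace

namespace P3

attribute [local instance] MvPolynomial.gradedAlgebra

/-- The standard grading of `k[X₀, X₁, X₂, X₃]`. -/
abbrev gr (k : Type u) [Field k] : ℕ → Submodule k (MvPolynomial (Fin 4) k) :=
  MvPolynomial.homogeneousSubmodule (Fin 4) k

/-- Projective three-space `ℙ³ = Proj k[X₀, X₁, X₂, X₃]`. -/
abbrev space (k : Type u) [Field k] : Scheme.{u} := Proj (gr k)

theorem X_mem (k : Type u) [Field k] (i : Fin 4) : MvPolynomial.X i ∈ gr k 1 :=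
  MvPolynomial.isHomogeneous_X k i

theorem X_mem' (k : Type u) [Field k] (i : Fin 4) : MvPolynomial.X i ∈ gr k (1 • 1) :=
  MvPolynomial.isHomogeneous_X k i

/-- The standard affine chart `D₊(X_i)`. -/
abbrev chart (k : Type u) [Field k] (i : Fin 4) : (space k).Opens :=
  Proj.basicOpen (gr k) (MvPolynomial.X i)

variable {k : Type u} [Field k]

/-- Constants, as global regular functions. -/
def const₀ : k →+* Γ(space k, Proj.basicOpen (gr k) 1) :=
  ((Proj.awayToSection (gr k) 1).hom.comp
    (HomogeneousLocalization.fromZeroRingHom _ _)).comp (algebraMap k (gr k 0))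

theorem le_one (U : (space k).Opens) : U ≤ Proj.basicOpen (gr k) 1 := by
  rw [Proj.basicOpen_one]; exact le_top

/-- Constants as regular functions on the open set `U`. -/
def const (U : (space k).Opens) : k →+* Γ(space k, U) :=
  ((space k).presheaf.map (homOfLE (le_one U)).op).hom.comp const₀

theorem const_res {U V : (space k).Opens} (h : U ≤ V) (c : k) :
    (space k).presheaf.map (homOfLE h).op (const V c) = const U c := by
  simp only [const, RingHom.comp_apply]
  rw [← CommRingCat.comp_apply, ← Functor.map_comp]; rfl

/-- The regular function `X_j / X_i` on the chart `D₊(X_i)`. -/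
def ratioOnChart (i j : Fin 4) : Γ(space k, chart k i) :=
  Proj.awayToSection (gr k) (MvPolynomial.X i)
    (HomogeneousLocalization.Away.mk (gr k) (X_mem k i) 1 (MvPolynomial.X j) (X_mem' k j))

/-- The regular function `X_j / X_i` on an open set `U` contained in `D₊(X_i)`. -/
def ratio (i j : Fin 4) (U : (space k).Opens) (h : U ≤ chart k i) : Γ(space k, U) :=
  (space k).presheaf.map (homOfLE h).op (ratioOnChart i j)

theorem ratio_res (i j : Fin 4) {U V : (space k).Opens} (h : U ≤ V) (hV : V ≤ chart k i) :
    (space k).presheaf.map (homOfLE h).op (ratio i j V hV) = ratio i j U (h.trans hV) := by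
  rw [ratio, ratio, ← CommRingCat.comp_apply, ← Functor.map_comp]; rfl

theorem le_basicOpen_mul {i j : Fin 4} {U : (space k).Opens} (hi : U ≤ chart k i)
    (hj : U ≤ chart k j) :
    U ≤ Proj.basicOpen (gr k) (MvPolynomial.X i * MvPolynomial.X j) := by
  rw [Proj.basicOpen_mul]; exact le_inf hi hj

theorem ratio_eq {f : MvPolynomial (Fin 4) k} (i l : Fin 4) (U : (space k).Opens)
    (hi : U ≤ chart k i) (g : MvPolynomial (Fin 4) k) (hg : g ∈ gr k 1)
    (hf : f = MvPolynomial.X i * g) (hU : U ≤ Proj.basicOpen (gr k) f) :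
    ratio i l U hi = (space k).presheaf.map (homOfLE hU).op
      (Proj.awayToSection (gr k) f (HomogeneousLocalization.awayMap (gr k) hg hf
        (HomogeneousLocalization.Away.mk _ (X_mem k i) 1 (MvPolynomial.X l) (X_mem' k l)))) := by
  have h := congr($(Proj.awayMap_awayToSection (gr k) hg hf)
    (HomogeneousLocalization.Away.mk _ (X_mem k i) 1 (MvPolynomial.X l) (X_mem' k l)))
  refine Eq.trans ?_ (congrArg ((space k).presheaf.map (homOfLE hU).op) h.symm)
  have hle : Proj.basicOpen (gr k) f ≤ chart k i := Proj.basicOpen_mono _ _ _ ⟨_, hf⟩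
  change _ = (space k).presheaf.map (homOfLE hU).op ((space k).presheaf.map (homOfLE hle).op
    (ratioOnChart i l))
  rw [ratio, ← CommRingCat.comp_apply, ← Functor.map_comp]; rfl

theorem ratio_mul_ratio (i j l : Fin 4) (U : (space k).Opens) (hi : U ≤ chart k i)
    (hj : U ≤ chart k j) : ratio i j U hi * ratio j l U hj = ratio i l U hi := by
  rw [ratio_eq i j U hi (MvPolynomial.X j) (X_mem k j) rfl (le_basicOpen_mul hi hj),
    ratio_eq j l U hj (MvPolynomial.X i) (X_mem k i) (mul_comm _ _) (le_basicOpen_mul hi hj),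
    ratio_eq i l U hi (MvPolynomial.X j) (X_mem k j) rfl (le_basicOpen_mul hi hj),
    ← map_mul, ← map_mul]
  congr 2
  rw [HomogeneousLocalization.ext_iff_val, HomogeneousLocalization.val_mul]
  simp only [HomogeneousLocalization.Away.mk, HomogeneousLocalization.val_awayMap_mk,
    Localization.mk_mul]
  rw [Localization.mk_eq_mk_iff, Localization.r_iff_exists]
  refine ⟨1, ?_⟩
  simp
  ring

theorem ratio_self (i : Fin 4) (U : (space k).Opens) (hi : U ≤ chart k i) :
    ratio i i U hi = 1 := by
  have h : ratioOnChart (k := k) i i = 1 := by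
    rw [ratioOnChart, ← map_one (Proj.awayToSection (gr k) (MvPolynomial.X i)).hom]
    congr 1
    rw [HomogeneousLocalization.ext_iff_val]
    simp [HomogeneousLocalization.Away.mk, HomogeneousLocalization.val_one]
  rw [ratio, h, map_one]


/-- `X_j / X_i` as a unit. -/
def ratioUnit (i j : Fin 4) (U : (space k).Opens) (hi : U ≤ chart k i) (hj : U ≤ chart k j) :
    Γ(space k, U)ˣ where
  val := ratio i j U hi
  inv := ratio j i U hj
  val_inv := by rw [ratio_mul_ratio i j i U hi hj, ratio_self]
  inv_val := by rw [ratio_mul_ratio j i j U hj hi, ratio_self]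

/-- `(X_j / X_i) ^ v` for an integer `v`, on an open set `U` contained in
`D₊(X_i) ∩ D₊(X_j)`: the transition functions of `𝒪(v)`. -/
def transition (v : ℤ) (i j : Fin 4) (U : (space k).Opens) (hi : U ≤ chart k i)
    (hj : U ≤ chart k j) : Γ(space k, U) :=
  ((ratioUnit i j U hi hj ^ v : Γ(space k, U)ˣ) : Γ(space k, U))

theorem transition_res (v : ℤ) (i j : Fin 4) {U V : (space k).Opens} (h : U ≤ V)
    (hi : V ≤ chart k i) (hj : V ≤ chart k j) :
    (space k).presheaf.map (homOfLE h).op (transition v i j V hi hj) =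
      transition v i j U (h.trans hi) (h.trans hj) := by
  have : Units.map ((space k).presheaf.map (homOfLE h).op).hom.toMonoidHom (ratioUnit i j V hi hj)
      = ratioUnit i j U (h.trans hi) (h.trans hj) := Units.ext (ratio_res i j h hi)
  rw [transition, transition, ← this, ← map_zpow]; rfl

theorem ratio_mul_transition (v : ℤ) (i j l : Fin 4) (U : (space k).Opens) (hi : U ≤ chart k i)
    (hj : U ≤ chart k j) :
    ratio i l U hi * transition v i j U hi hj = transition (v + 1) i j U hi hj * ratio j l U hj := by
  rw [transition, transition, zpow_add_one, Units.val_mul, mul_assoc,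
    show ((ratioUnit i j U hi hj : Γ(space k, U)ˣ) : Γ(space k, U)) = ratio i j U hi from rfl,
    ratio_mul_ratio, mul_comm]

instance (U : (space k).Opens) : Algebra k Γ(space k, U) := (const U).toAlgebra

instance (F : (space k).Modules) (U : (space k).Opens) : Module k Γ(F, U) :=
  Module.compHom _ (const U)

instance (F : (space k).Modules) (U : (space k).Opens) :
    IsScalarTower k Γ(space k, U) Γ(F, U) :=
  ⟨fun c r s => by
    change (const U c * r) • s = const U c • r • s
    rw [mul_smul]⟩

instance (F : (space k).Modules) (U : (space k).Opens) :
    SMulCommClass k Γ(space k, U) Γ(F, U) := 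
  ⟨fun c r s => by
    change const U c • r • s = r • const U c • s
    rw [smul_comm]⟩

/-- Restriction of sections. -/
def res (F : (space k).Modules) {U V : (space k).Opens} (h : U ≤ V) : Γ(F, V) →ₗ[k] Γ(F, U) where
  toFun := F.presheaf.map (homOfLE h).op
  map_add' := map_add _
  map_smul' c s := by
    refine (Scheme.Modules.map_smul F (homOfLE h) (const V c) s).trans ?_
    rw [const_res]; rfl

theorem res_smul (F : (space k).Modules) {U V : (space k).Opens} (h : U ≤ V) (r : Γ(space k, V))
    (s : Γ(F, V)) :
    res F h (r • s : Γ(F, V)) =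
      ((space k).presheaf.map (homOfLE h).op r : Γ(space k, U)) • (res F h s : Γ(F, U)) :=
  Scheme.Modules.map_smul F (homOfLE h) r s

theorem res_res (F : (space k).Modules) {U V W : (space k).Opens} (h : U ≤ V) (h' : V ≤ W)
    (s : Γ(F, W)) : res F h (res F h' s) = res F (h.trans h') s := by
  change F.presheaf.map _ (F.presheaf.map _ s) = F.presheaf.map _ s
  rw [← ConcreteCategory.comp_apply, ← Functor.map_comp]; rfl

/-- Sections over `U` of the twist `F(v)`: a section is given by its coordinates `s_i` over
`U ∩ D₊(X_i)` with respect to the local generators `X_i ^ v` of `𝒪(v)`, that is, locally it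
is `s_i ⊗ X_i ^ v`; hence `s_i = (X_j / X_i) ^ v • s_j` on overlaps. -/
def twist (F : (space k).Modules) (v : ℤ) (U : (space k).Opens) :
    Submodule k (∀ i : Fin 4, Γ(F, U ⊓ chart k i)) where
  carrier := {s | ∀ i j : Fin 4,
    res F (inf_le_left : (U ⊓ chart k i) ⊓ (U ⊓ chart k j) ≤ _) (s i) =
      transition v i j ((U ⊓ chart k i) ⊓ (U ⊓ chart k j)) (inf_le_left.trans inf_le_right)
        (inf_le_right.trans inf_le_right) • res F inf_le_right (s j)}
  zero_mem' i j := by simp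
  add_mem' {s t} hs ht i j := by
    rw [Pi.add_apply, Pi.add_apply, map_add, map_add, smul_add, hs i j, ht i j]
  smul_mem' c s hs i j := by
    rw [Pi.smul_apply, Pi.smul_apply, map_smul, map_smul, hs i j, smul_comm]

/-- The `k`-vector space `Γ(U, F(v))`. -/
def Tw (F : (space k).Modules) (v : ℤ) (U : (space k).Opens) : Type u := twist F v U

instance (F : (space k).Modules) (v : ℤ) (U : (space k).Opens) : AddCommGroup (Tw F v U) :=
  inferInstanceAs (AddCommGroup (twist F v U))

instance (F : (space k).Modules) (v : ℤ) (U : (space k).Opens) : Module k (Tw F v U) :=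
  inferInstanceAs (Module k (twist F v U))

/-- Restriction of sections of `F(v)`. -/
def twistRes (F : (space k).Modules) (v : ℤ) {U V : (space k).Opens} (h : U ≤ V) :
    Tw F v V →ₗ[k] Tw F v U where
  toFun s := ⟨fun i => res F (inf_le_inf_right (chart k i) h) (s.1 i), fun i j => by
    have hij := congrArg (res F (inf_le_inf (inf_le_inf_right (chart k i) h)
      (inf_le_inf_right (chart k j) h))) (s.2 i j)
    rw [res_smul, transition_res, res_res, res_res] at hij
    rw [res_res, res_res, hij]⟩
  map_add' s t := Subtype.ext (funext fun i => map_add _ _ _)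
  map_smul' c s := Subtype.ext (funext fun i => (res F _).map_smul c (s.1 i))

/-- Multiplication by the coordinate `X_l`, as a map `F(v) → F(w)` with `w = v + 1`:
`s_i ⊗ X_i ^ v` is mapped to `(X_l / X_i) s_i ⊗ X_i ^ (v + 1)`. -/
def mulX (F : (space k).Modules) (l : Fin 4) (v w : ℤ) (hw : v + 1 = w) (U : (space k).Opens) :
    Tw F v U →ₗ[k] Tw F w U where
  toFun s := ⟨fun i => ratio i l (U ⊓ chart k i) inf_le_right • s.1 i, fun i j => by
    subst hw
    rw [res_smul, res_smul, ratio_res, ratio_res, s.2 i j, smul_smul, smul_smul,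
      ratio_mul_transition]⟩
  map_add' s t := Subtype.ext (funext fun i => smul_add _ _ _)
  map_smul' c s := Subtype.ext (funext fun i => smul_comm _ _ _)

theorem mulX_comm (F : (space k).Modules) (l m : Fin 4) (v w y : ℤ) (hw : v + 1 = w)
    (hy : w + 1 = y) (U : (space k).Opens) (s : Tw F v U) :
    mulX F l w y hy U (mulX F m v w hw U s) = mulX F m w y hy U (mulX F l v w hw U s) :=
  Subtype.ext (funext fun _ => smul_comm _ _ _)

theorem twistRes_mulX (F : (space k).Modules) (l : Fin 4) (v w : ℤ) (hw : v + 1 = w)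
    {U V : (space k).Opens} (h : U ≤ V) (s : Tw F v V) :
    twistRes F w h (mulX F l v w hw V s) = mulX F l v w hw U (twistRes F v h s) :=
  Subtype.ext (funext fun i => by
    refine (res_smul F _ (ratio i l (V ⊓ chart k i) inf_le_right) (s.1 i)).trans ?_
    rw [ratio_res]; rfl)


/-! ### Coherent, reflexive, rank -/

/-- Coherent sheaves on the noetherian scheme `ℙ³`: quasi-coherent, with finitely generated
modules of sections over affine open sets. -/
structure IsCoherent (F : (space k).Modules) : Prop where
  isQuasicoherent : F.IsQuasicoherent
  finite : ∀ U : (space k).Opens, IsAffineOpen U → Module.Finite Γ(space k, U) Γ(F, U)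

/-- `F` has rank `r`: its stalk at the generic point is an `r`-dimensional vector space over
the function field. -/
def HasRank (F : (space k).Modules) (r : ℕ) : Prop :=
  letI G : PresheafOfModules ((space k).presheaf ⋙ forget₂ CommRingCat RingCat) := F.val
  ∃ η : space k, IsGenericPoint η Set.univ ∧
    Module.finrank ((space k).presheaf.stalk η) ↑(TopCat.Presheaf.stalk G.presheaf η) = r

section Reflexive

variable {X : Scheme.{u}} (M : X.Modules)

/-- Restriction of sections of a sheaf of modules on any scheme. -/
def resOf {U V : X.Opens} (h : U ≤ V) (s : Γ(M, V)) : Γ(M, U) := M.presheaf.map (homOfLE h).op s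

/-- Restriction of regular functions. -/
def resFun {U V : X.Opens} (h : U ≤ V) : Γ(X, V) →+* Γ(X, U) := (X.presheaf.map (homOfLE h).op).hom

/-- Sections over `U` of the dual sheaf `M^* = ℋom(M, 𝒪)`: the morphisms `M|_U → 𝒪|_U`. -/
def dual (U : X.Opens) :
    AddSubgroup (∀ V : {V : X.Opens // V ≤ U}, Γ(M, V) →ₗ[Γ(X, V)] Γ(X, V)) where
  carrier := {φ | ∀ (V W : {V : X.Opens // V ≤ U}) (h : V.1 ≤ W.1) (s : Γ(M, W)),
    resFun h (φ W s) = φ V (resOf M h s)}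
  zero_mem' V W h s := by simp
  add_mem' hφ hψ V W h s := by simp [hφ V W h s, hψ V W h s]
  neg_mem' hφ V W h s := by simp [hφ V W h s]

/-- Restriction of sections of the dual sheaf. -/
def dualRes {U V : X.Opens} (h : U ≤ V) (φ : dual M V) : dual M U :=
  ⟨fun W => φ.1 ⟨W.1, W.2.trans h⟩, fun W W' hW s => φ.2 ⟨W.1, _⟩ ⟨W'.1, _⟩ hW s⟩

/-- Multiplication of a section of the dual sheaf by a regular function. -/
def dualSMul {U : X.Opens} (r : Γ(X, U)) (φ : dual M U) : dual M U :=
  ⟨fun W => resFun W.2 r • φ.1 W, fun V W h s => by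
    have hr : resFun h (resFun W.2 r) = resFun V.2 r := by
      simp only [resFun]
      rw [← CommRingCat.comp_apply, ← Functor.map_comp]; rfl
    rw [LinearMap.smul_apply, LinearMap.smul_apply, smul_eq_mul, smul_eq_mul, map_mul,
      φ.2 V W h s, hr]⟩

/-- Sections over `U` of the bidual `M^** = ℋom(M^*, 𝒪)`: the morphisms `M^*|_U → 𝒪|_U`. -/
structure BidualSection (U : X.Opens) where
  app : ∀ V : {V : X.Opens // V ≤ U}, dual M V →+ Γ(X, V)
  app_smul : ∀ (V : {V : X.Opens // V ≤ U}) (r : Γ(X, V)) (φ : dual M V),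
    app V (dualSMul M r φ) = r * app V φ
  app_res : ∀ (V W : {V : X.Opens // V ≤ U}) (h : V.1 ≤ W.1) (φ : dual M W),
    resFun h (app W φ) = app V (dualRes M h φ)

/-- `M` is reflexive: the evaluation map `M → M^**`, which sends a section `s` of `M` to
`φ ↦ φ(s)`, is an isomorphism, that is, bijective on sections over every open set. -/
def IsReflexive : Prop :=
  ∀ (U : X.Opens) (ψ : BidualSection M U), ∃! s : Γ(M, U),
    ∀ (V : {V : X.Opens // V ≤ U}) (φ : dual M V), ψ.app V φ = φ.1 ⟨V, le_rfl⟩ (resOf M V.2 s)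

end Reflexive

/-! ### Graded modules over `k[X₀, X₁, X₂, X₃]` -/

/-- A `ℤ`-graded module `N = ⨁ N_v` over `k[X₀, X₁, X₂, X₃]`: a family of `k`-vector spaces
`N_v` with commuting `k`-linear maps "multiplication by `X_l`" from `N_v` to `N_(v+1)`. -/
structure GrMod (k : Type u) [Field k] where
  obj : ℤ → Type u
  [addCommGroup : ∀ v, AddCommGroup (obj v)]
  [module : ∀ v, Module k (obj v)]
  X : Fin 4 → ∀ v w : ℤ, v + 1 = w → obj v →ₗ[k] obj w
  X_comm : ∀ (l m : Fin 4) (v w y : ℤ) (hw : v + 1 = w) (hy : w + 1 = y) (s : obj v),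
    X l w y hy (X m v w hw s) = X m w y hy (X l v w hw s)

attribute [instance] GrMod.addCommGroup GrMod.module

namespace GrMod

/-- The shifted module `N(n)`, with `N(n)_v = N_(v+n)`. -/
def shift (N : GrMod k) (n : ℤ) : GrMod k where
  obj v := N.obj (v + n)
  X l v w hw := N.X l (v + n) (w + n) (by omega)
  X_comm l m v w y hw hy s := N.X_comm l m _ _ _ _ _ s

/-- `₀Hom_R(N, N')`: the `R`-linear maps of degree `0`, i.e. the families of `k`-linear maps
`N_v → N'_v` that commute with multiplication by the coordinates. -/
def hom (N N' : GrMod k) : Submodule k (∀ v : ℤ, N.obj v →ₗ[k] N'.obj v) where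
  carrier := {φ | ∀ (l : Fin 4) (v w : ℤ) (hw : v + 1 = w) (s : N.obj v),
    φ w (N.X l v w hw s) = N'.X l v w hw (φ v s)}
  zero_mem' l v w hw s := by simp
  add_mem' hφ hψ l v w hw s := by simp [hφ l v w hw s, hψ l v w hw s]
  smul_mem' c φ hφ l v w hw s := by simp [hφ l v w hw s]

/-- `ₙHom_R(N, N')`: the `R`-linear maps of degree `n`. -/
abbrev homDeg (n : ℤ) (N N' : GrMod k) : Submodule k (∀ v : ℤ, N.obj v →ₗ[k] N'.obj (v + n)) :=
  hom N (N'.shift n)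

/-- The polynomials that are homogeneous of degree `n`; only `0` for `n < 0`. -/
def poly (k : Type u) [Field k] (n : ℤ) : Submodule k (MvPolynomial (Fin 4) k) where
  carrier := {p | ∀ m ∈ p.support, (m.degree : ℤ) = n}
  zero_mem' := by simp
  add_mem' {p q} hp hq m hm := by
    rcases Finset.mem_union.1 (MvPolynomial.support_add hm) with h | h
    exacts [hp m h, hq m h]
  smul_mem' c p hp m hm := hp m (MvPolynomial.support_smul hm)

theorem X_mul_mem_poly (l : Fin 4) {v w : ℤ} (hw : v + 1 = w) {p : MvPolynomial (Fin 4) k}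
    (hp : p ∈ poly k v) : MvPolynomial.X l * p ∈ poly k w := by
  intro m hm
  rw [MvPolynomial.support_X_mul, Finset.mem_map] at hm
  obtain ⟨m', hm', rfl⟩ := hm
  have := hp m' hm'
  simp [map_add]
  omega

/-- The graded free module `⨁_a R(-d_a)`. -/
def free {ι : Type} (d : ι → ℤ) : GrMod k where
  obj v := ∀ a, poly k (v - d a)
  X l v w hw := LinearMap.pi fun a => (((LinearMap.mulLeft k (MvPolynomial.X l)).comp
    (poly k (v - d a)).subtype).codRestrict (poly k (w - d a))
      fun p => X_mul_mem_poly l (by omega) p.2).comp (LinearMap.proj a)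
  X_comm l m v w y hw hy s := by
    funext a
    apply Subtype.ext
    exact mul_left_comm _ _ _

/-- A minimal graded free resolution `⋯ → P₂ → P₁ → P₀ → N → 0` with finitely generated free
modules `P_j = ⨁_a R(-d_(j,a))`; minimality means that the image of `P_(j+1)` lies in
`(X₀, X₁, X₂, X₃) P_j`. -/
structure MinimalFreeResolution (N : GrMod k) where
  rank : ℕ → ℕ
  deg : ∀ j, Fin (rank j) → ℤ
  ε : hom (free (deg 0)) N
  d : ∀ j, hom (free (k := k) (deg (j + 1))) (free (deg j))
  surjective : ∀ v, Function.Surjective (ε.1 v)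
  exact_zero : ∀ v, Function.Exact ((d 0).1 v) (ε.1 v)
  exact_succ : ∀ j v, Function.Exact ((d (j + 1)).1 v) ((d j).1 v)
  minimal : ∀ j v (x : (free (k := k) (deg (j + 1))).obj v) (a : Fin (rank j)),
    MvPolynomial.constantCoeff (((d j).1 v x a : poly k (v - deg j a)) : MvPolynomial (Fin 4) k) = 0

/-- The graded Betti numbers: the number of summands `R(-i)` of `P_j`. Here `j` starts at `0`, so
that `betti 0 i`, `betti 1 i`, `betti 2 i` are usually written `β_(1,i)`, `β_(2,i)`, `β_(3,i)`. -/
def MinimalFreeResolution.betti {N : GrMod k} (P : MinimalFreeResolution N) (j : ℕ) (i : ℤ) : ℕ :=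
  Fintype.card {a : Fin (P.rank j) // P.deg j a = i}

end GrMod

/-! ### Cohomology -/

variable (F : (space k).Modules)

/-- The graded module `H⁰_*(F) = ⨁_v H⁰(ℙ³, F(v))`. -/
def H0star : GrMod k where
  obj v := Tw F v ⊤
  X l v w hw := mulX F l v w hw ⊤
  X_comm l m v w y hw hy s := mulX_comm F l m v w y hw hy ⊤ s

/-- The intersection of the charts `D₊(X_i)`, `i = I 0 < ⋯ < I p`. -/
def inter (k : Type u) [Field k] {p : ℕ} (I : Fin (p + 1) ↪o Fin 4) : (space k).Opens :=
  ⨅ a, chart k (I a)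

/-- The Čech `p`-cochains of `F(v)` for the covering of `ℙ³` by the four affine charts. -/
abbrev cochain (v : ℤ) (p : ℕ) : Type u :=
  ∀ I : Fin (p + 1) ↪o Fin 4, Tw F v (inter k I)

theorem inter_le {p : ℕ} (I : Fin (p + 2) ↪o Fin 4) (a : Fin (p + 2)) :
    inter k I ≤ inter k ((Fin.succAboveOrderEmb a).trans I) :=
  le_iInf fun b => iInf_le _ (a.succAbove b)

/-- The Čech differential
`(dc)_(i₀ ⋯ i_(p+1)) = ∑ₐ (-1)ᵃ c_(i₀ ⋯ îₐ ⋯ i_(p+1))`, restricted to the intersection. -/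
def cechD (v : ℤ) (p : ℕ) : cochain F v p →ₗ[k] cochain F v (p + 1) :=
  LinearMap.pi fun I => ∑ a : Fin (p + 2), ((-1 : k) ^ (a : ℕ)) •
    (twistRes F v (inter_le I a)).comp (LinearMap.proj ((Fin.succAboveOrderEmb a).trans I))

/-- Čech coboundaries. -/
def coboundaries (v : ℤ) : ∀ p : ℕ, Submodule k (cochain F v p)
  | 0 => ⊥
  | p + 1 => LinearMap.range (cechD F v p)

/-- The cohomology `Hᵖ(ℙ³, F(v))`, as Čech cohomology of the standard affine covering:
cocycles modulo coboundaries. -/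
abbrev H (p : ℕ) (v : ℤ) : Type u :=
  LinearMap.ker (cechD F v p) ⧸ (coboundaries F v p).submoduleOf (LinearMap.ker (cechD F v p))

/-- `hᵖ(F(v)) = dim_k Hᵖ(ℙ³, F(v))`. -/
def h (p : ℕ) (v : ℤ) : ℕ := Module.finrank k (H F p v)

/-- Multiplication by `X_l` on Čech cochains. -/
def cochainX (p : ℕ) (l : Fin 4) (v w : ℤ) (hw : v + 1 = w) :
    cochain F v p →ₗ[k] cochain F w p :=
  LinearMap.pi fun I => (mulX F l v w hw (inter k I)).comp (LinearMap.proj I)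

theorem cechD_cochainX (p : ℕ) (l : Fin 4) (v w : ℤ) (hw : v + 1 = w) (c : cochain F v p) :
    cechD F w p (cochainX F p l v w hw c) = cochainX F (p + 1) l v w hw (cechD F v p c) := by
  funext I
  simp [cechD, cochainX, LinearMap.sum_apply, twistRes_mulX, map_sum]

theorem cochainX_mem_ker (p : ℕ) (l : Fin 4) (v w : ℤ) (hw : v + 1 = w) (c : cochain F v p)
    (hc : c ∈ LinearMap.ker (cechD F v p)) :
    cochainX F p l v w hw c ∈ LinearMap.ker (cechD F w p) := by
  rw [LinearMap.mem_ker] at hc ⊢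
  rw [cechD_cochainX, hc, map_zero]

theorem cochainX_mem_coboundaries (p : ℕ) (l : Fin 4) (v w : ℤ) (hw : v + 1 = w)
    (c : cochain F v p) (hc : c ∈ coboundaries F v p) :
    cochainX F p l v w hw c ∈ coboundaries F w p := by
  cases p with
  | zero =>
    obtain rfl : c = 0 := hc
    exact (map_zero _ : cochainX F 0 l v w hw 0 = 0)
  | succ p =>
    obtain ⟨b, rfl⟩ := hc
    exact ⟨cochainX F p l v w hw b, cechD_cochainX F p l v w hw b⟩

/-- Multiplication by `X_l` on cohomology. -/
def HX (p : ℕ) (l : Fin 4) (v w : ℤ) (hw : v + 1 = w) : H F p v →ₗ[k] H F p w :=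
  Submodule.mapQ _ _ ((cochainX F p l v w hw).restrict (cochainX_mem_ker F p l v w hw))
    fun c hc => cochainX_mem_coboundaries F p l v w hw c.1 hc

/-- The graded module `Hᵖ_*(F) = ⨁_v Hᵖ(ℙ³, F(v))`. -/
def Hstar (p : ℕ) : GrMod k where
  obj v := H F p v
  X l v w hw := HX F p l v w hw
  X_comm l m v w y hw hy s := by
    obtain ⟨c, rfl⟩ := Submodule.Quotient.mk_surjective _ s
    exact congrArg (Submodule.Quotient.mk (p := (coboundaries F y p).submoduleOf _))
      (Subtype.ext (funext fun I => mulX_comm F l m v w y hw hy _ (c.1 I)))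

end P3

end

/-! ### Quasi-coherent sheaves on affine opens: sections over a basic open as a localization -/

noncomputable section
universe u
open AlgebraicGeometry CategoryTheory TopologicalSpace
namespace P3
-- Let F also denote the graded module H⁰_*(F), let B_j = `dualFree (P.deg j)`, which is H³_* of the
-- sheaf associated with P_j, and let Q be the cokernel of B_2 → B_1. Three facts carry the proof.
--
-- Depth. Compatible families f_i with X_i f_j = X_j f_i in H⁰_* come from one section
-- (`koszulExact_H0star`). Comparing the minimal resolution with Koszul complexes then shows that
-- P_2 → P_1 is injective (`d_one_injective`), so only three rows of Betti numbers enter.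
--
-- Geometry. Over an intersection of charts, the sections of all twists form the localization of
-- H⁰_*(F) at the corresponding variables (`isLoc_twRes_inter`). Hence the localized resolution
-- presents the Čech complex of F by Čech complexes of free modules. The latter are exact in degree
-- two, and their H³ is B_j by taking residues (`lcechD_exact`, `lresidue_exact`). A diagram chase
-- (`exists_connecting_hom`, `h_three`) yields an exact sequence 0 → E → Q → B_0 → H³_*(F) → 0, in
-- which Q plays the role of H³_* of the first syzygy sheaf.
--
-- Algebra. A map N → B_j is a family of linear forms on the spaces N_(d_a - 4), so B_j is
-- injective. Thus Hom(P_•, B_0) is exact beyond its first term; since Q is the cokernel of B_2 →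
-- B_1 and P_2 → P_1 is injective, so is Hom(P_•, Q). Therefore dim Hom(F, B_0) and dim Hom(F, Q)
-- are alternating sums over the generators of P_0, P_1, P_2. The map Hom(F, B_1) → Hom(F, B_0) is
-- the transpose of Hom(P_0, F(-4)) → Hom(P_1, F(-4)), whose kernel is Hom(F, F(-4)) = 0; so it is
-- surjective, and so is Hom(F, Q) → Hom(F, B_0), through which it factors. Consequently dim Hom(F,
-- E) = dim Hom(F, Q) - dim Hom(F, B_0), and degree by degree dim Q_v - dim (B_0)_v = h²(F(v)) -
-- h³(F(v)) (`finrank_hom_eq`).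
theorem isLocalizing_restrict {X : Scheme.{u}} (M : X.Modules) (hM : M.IsQuasicoherent) {U : X.Opens}
    (hU : IsAffineOpen U) : IsLocalizing (modulesSpecToSheaf.obj (M.restrict hU.fromSpec)) := by
  rw [← isIso_fromTildeΓ_iff_isLocalizing]
  have : SheafOfModules.IsQuasicoherent (R := X.ringCatSheaf) M := hM
  infer_instance

/-- Sections over an open of Spec Γ(X, U) carry two actions of Γ(X, U): the one of the affine scheme
and the one by restriction in X. This identifies them. -/
theorem appIso_inv_fromSpec {X : Scheme.{u}} {U : X.Opens} (hU : IsAffineOpen U)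
    (W : (Spec Γ(X, U)).Opens) (hW : hU.fromSpec ''ᵁ W ≤ U) (r : Γ(X, U)) :
    (hU.fromSpec.appIso W).inv ((Spec Γ(X, U)).presheaf.map W.leTop.op
      ((Scheme.ΓSpecIso Γ(X, U)).inv r)) = X.presheaf.map (homOfLE hW).op r := by
  have h : (Scheme.ΓSpecIso Γ(X, U)).inv ≫ (Spec Γ(X, U)).presheaf.map W.leTop.op ≫
      (hU.fromSpec.appIso W).inv = X.presheaf.map (homOfLE hW).op := by
    rw [← Category.assoc, Iso.comp_inv_eq, Scheme.Hom.appIso_hom', Scheme.Hom.map_appLE, 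
      Scheme.Hom.appLE, hU.fromSpec_app_self, Category.assoc, ← Functor.map_comp]
    rfl
  exact congr($h r)
  
section
variable {X : Scheme.{u}} (M : X.Modules) {U V : X.Opens}

theorem resOf_resOf {U V W : X.Opens} (h : U ≤ V) (h' : V ≤ W) (s : Γ(M, W)) :
    resOf M h (resOf M h' s) = resOf M (h.trans h') s := by
  change M.presheaf.map _ (M.presheaf.map _ s) = M.presheaf.map _ s
  rw [← ConcreteCategory.comp_apply, ← Functor.map_comp]; rfl

theorem resOf_smul {U V : X.Opens} (h : U ≤ V) (r : Γ(X, V)) (s : Γ(M, V)) :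
    resOf M h (r • s) = resFun h r • resOf M h s := Scheme.Modules.map_smul M (homOfLE h) r s

theorem resOf_self {U : X.Opens} (s : Γ(M, U)) : resOf M le_rfl s = s := by
  change M.presheaf.map (𝟙 _) s = s
  simp

theorem resOf_zero {U V : X.Opens} (h : U ≤ V) : resOf M h 0 = 0 :=
  map_zero (M.presheaf.map (homOfLE h).op).hom

theorem resFun_resFun {U V W : X.Opens} (h : U ≤ V) (h' : V ≤ W) (r : Γ(X, W)) :
    resFun h (resFun h' r) = resFun (h.trans h') r := by
  simp only [resFun]
  rw [← CommRingCat.comp_apply, ← Functor.map_comp]; rfl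

theorem smul_restrict_fromSpec (hU : IsAffineOpen U) (W : (Spec Γ(X, U)).Opens)
    (hW : hU.fromSpec ''ᵁ W ≤ U) (r : Γ(X, U)) (x : Γ(M.restrict hU.fromSpec, W)) :
    (M.restrictAppIso hU.fromSpec W).hom (r • x) =
      resFun hW r • (M.restrictAppIso hU.fromSpec W).hom x := by
  rw [Scheme.Modules.smul_Spec_def, Scheme.Modules.smul_restrictAppIso_hom_apply,
    appIso_inv_fromSpec hU W hW]
  rfl

/-- Half of the statement that Γ(M, V) is the localization of Γ(M, U) at f. The equation for V is a
hypothesis so that V may be given as an intersection with a chart. -/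
theorem exists_pow_smul_eq_zero (hM : M.IsQuasicoherent) (hU : IsAffineOpen U) (f : Γ(X, U))
    (hVU : V ≤ U) (hV : V = X.basicOpen f) (s : Γ(M, U)) (hs : resOf M hVU s = 0) :
    ∃ n : ℕ, f ^ n • s = 0 := by
  have key := isLocalizing_restrict M hM hU f
  have hT : hU.fromSpec ''ᵁ ⊤ = U := by simp
  have hB : hU.fromSpec ''ᵁ (PrimeSpectrum.basicOpen f) = V := by
    rw [hV]; exact hU.fromSpec_image_basicOpen f
  let s' : Γ(M.restrict hU.fromSpec, ⊤) := resOf M hT.le s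
  have h1 := key.exists_of_eq (x₁ := s') (x₂ := (0 : Γ(M.restrict hU.fromSpec, ⊤))) ?_
  · obtain ⟨⟨_, n, rfl⟩, h2⟩ := h1
    refine ⟨n, ?_⟩
    have h3 := smul_restrict_fromSpec M hU ⊤ hT.le (f ^ n) s'
    have h4 : (f ^ n) • s' = (f ^ n) • (0 : Γ(M.restrict hU.fromSpec, ⊤)) := h2
    rw [h4, smul_zero, map_zero] at h3
    have h5 := congrArg (resOf M hT.ge) h3
    change resOf M hT.ge 0 = resOf M hT.ge (resFun hT.le (f ^ n) • resOf M hT.le s) at h5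
    rw [← resOf_smul, resOf_resOf, resOf_self, resOf_zero] at h5
    exact h5.symm
  · change resOf M (hU.fromSpec.image_mono le_top) (resOf M hT.le s) =
      resOf M (hU.fromSpec.image_mono le_top) 0
    rw [resOf_zero, resOf_resOf, ← resOf_resOf M hB.le hVU, hs, resOf_zero]

/-- The other half: a section over the basic open extends after multiplication by a power of f. -/
theorem exists_resOf_eq_pow_smul (hM : M.IsQuasicoherent) (hU : IsAffineOpen U) (f : Γ(X, U))
    (hVU : V ≤ U) (hV : V = X.basicOpen f) (t : Γ(M, V)) :
    ∃ (n : ℕ) (s : Γ(M, U)), resOf M hVU s = resFun hVU f ^ n • t := by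
  have key := isLocalizing_restrict M hM hU f
  have hT : hU.fromSpec ''ᵁ ⊤ = U := by simp
  let W : (Spec Γ(X, U)).Opens := PrimeSpectrum.basicOpen f
  have hB : hU.fromSpec ''ᵁ W = V := by
    rw [hV]; exact hU.fromSpec_image_basicOpen f
  let t' : Γ(M.restrict hU.fromSpec, W) := resOf M hB.le t
  obtain ⟨⟨s, ⟨_, n, rfl⟩⟩, h2⟩ := key.surj t'
  have h3 := smul_restrict_fromSpec M hU W (hB.le.trans hVU) (f ^ n) t'
  let s' : Γ(M, hU.fromSpec ''ᵁ ⊤) := s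
  refine ⟨n, resOf M hT.ge s', ?_⟩
  have h4 : (f ^ n) • t' = resOf M (hU.fromSpec.image_mono (le_top : W ≤ ⊤)) s' := h2
  rw [h4] at h3
  have h5 := congrArg (resOf M hB.ge) h3
  change resOf M hB.ge (resOf M _ s') = resOf M hB.ge (resFun (hB.le.trans hVU) (f ^ n) •
    resOf M hB.le t) at h5
  rw [resOf_smul, resOf_resOf, resOf_resOf, resOf_self, resFun_resFun] at h5
  rw [resOf_resOf, h5, map_pow]
end
end P3

end

/-! ### Graded modules: action of polynomials, and maps out of free modules -/

noncomputable section
universe u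
namespace P3
variable {k : Type u} [Field k]
open MvPolynomial
open GrMod (poly hom homDeg free X_mul_mem_poly)

theorem C_mem_poly (c : k) : (C c : MvPolynomial (Fin 4) k) ∈ poly k 0 := by
  intro m hm
  have := support_monomial_subset hm
  simp at this
  simp [this]

theorem one_mem_poly : (1 : MvPolynomial (Fin 4) k) ∈ poly k 0 := C_mem_poly 1

theorem monomial_mem_poly (m : Fin 4 →₀ ℕ) (c : k) {n : ℤ} (h : (m.degree : ℤ) = n) :
    monomial m c ∈ poly k n := by
  intro m' hm
  have := support_monomial_subset hm
  simp at this
  rw [this, h]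

/-- A homogeneous polynomial is a sum of monomials of the same degree, and each monomial arises from
a constant by multiplying by one variable at a time. The motive carries the degree, so that claims
about graded pieces, where only the variables act by definition, can be proved by it. -/
theorem poly_induction {motive : ℤ → MvPolynomial (Fin 4) k → Prop}
    (zero : ∀ n, motive n 0) (const : ∀ c, motive 0 (C c))
    (add : ∀ n p q, p ∈ poly k n → q ∈ poly k n → motive n p → motive n q → motive n (p + q))
    (X_mul : ∀ l n p, p ∈ poly k n → motive n p → motive (n + 1) (X l * p))
    {n : ℤ} {p : MvPolynomial (Fin 4) k} (hp : p ∈ poly k n) : motive n p := by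
  have mono : ∀ (d : ℕ) (m : Fin 4 →₀ ℕ) (c : k), m.degree = d → motive d (monomial m c) := by
    intro d
    induction d with
    | zero =>
      intro m c hm
      rw [Finsupp.degree_eq_zero_iff] at hm
      subst hm
      exact const c
    | succ d ih =>
      intro m c hm
      have hm0 : m ≠ 0 := by rintro rfl; simp at hm
      obtain ⟨i, hi⟩ := Finsupp.ne_iff.1 hm0
      have hle : Finsupp.single i 1 ≤ m := by
        rw [Finsupp.single_le_iff]; exact Nat.one_le_iff_ne_zero.2 hi
      obtain ⟨m', rfl⟩ := exists_add_of_le hle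
      rw [map_add, Finsupp.degree_single] at hm
      have hX : monomial (Finsupp.single i 1 + m') c = X i * monomial m' c := by
        rw [X, monomial_mul, one_mul]
      rw [hX]
      push_cast
      have hm' : m'.degree = d := by omega
      exact X_mul i d _ (monomial_mem_poly m' c (by exact_mod_cast hm')) (ih m' c hm')
  have key : ∀ s : Finset (Fin 4 →₀ ℕ), (∀ m ∈ s, (m.degree : ℤ) = n) →
      (∑ m ∈ s, monomial m (coeff m p)) ∈ poly k n ∧ motive n (∑ m ∈ s, monomial m (coeff m p)) := by
    classical
    intro s
    induction s using Finset.induction_on with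
    | empty => intro _; simpa using zero n
    | insert m s hms ih =>
      intro hs
      have h1 := ih fun m' hm' => hs m' (Finset.mem_insert_of_mem hm')
      have h2 := hs m (Finset.mem_insert_self _ _)
      rw [Finset.sum_insert hms]
      have h3 := monomial_mem_poly (k := k) m (coeff m p) h2
      refine ⟨add_mem h3 h1.1, add n _ _ h3 h1.1 ?_ h1.2⟩
      rw [← h2]; exact mono _ m _ rfl
  have := (key p.support hp).2
  rwa [support_sum_monomial_coeff] at this

theorem mul_mem_poly {a b : ℤ} {p q : MvPolynomial (Fin 4) k} (hp : p ∈ poly k a)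
    (hq : q ∈ poly k b) : p * q ∈ poly k (a + b) := by
  refine poly_induction (motive := fun n p => p * q ∈ poly k (n + b)) ?_ ?_ ?_ ?_ hp
  · intro n; simp
  · intro c; rw [C_mul', zero_add]; exact Submodule.smul_mem _ _ hq
  · intro n p p' _ _ h h'; rw [add_mul]; exact add_mem h h'
  · intro l n p _ h; rw [mul_assoc]; exact X_mul_mem_poly l (by ring) h

instance (n : ℤ) : FiniteDimensional k (poly k n) := by
  let s : Set (Fin 4 →₀ ℕ) := {m | (m.degree : ℤ) = n}
  have hs : s.Finite := by
    refine (Finsupp.finite_of_degree_le n.toNat).subset ?_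
    intro m hm
    have : (m.degree : ℤ) = n := hm
    change m.degree ≤ _
    omega
  have h : poly k n ≤ Submodule.span k (Set.image (fun m => monomial m (1 : k)) s) := by
    intro p hp
    rw [← support_sum_monomial_coeff p]
    refine Submodule.sum_mem _ fun m hm => ?_
    rw [← mul_one (coeff m p), ← smul_eq_mul, ← smul_monomial]
    exact Submodule.smul_mem _ _ (Submodule.subset_span ⟨m, hp m hm, rfl⟩)
  have := FiniteDimensional.span_of_finite k (hs.image fun m => monomial m (1 : k))
  exact Submodule.finiteDimensional_of_le h

/-- All graded pieces at once. -/
abbrev Tot (N : GrMod k) : Type u := ∀ v, N.obj v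

variable (N N' : GrMod k)

def totX (l : Fin 4) : Module.End k (Tot N) :=
  LinearMap.pi fun w => (N.X l (w - 1) w (by omega)).comp (LinearMap.proj (w - 1))

theorem totX_apply (l : Fin 4) (s : Tot N) (w : ℤ) :
    totX N l s w = N.X l (w - 1) w (by omega) (s (w - 1)) := rfl

theorem totX_comm (l m : Fin 4) : totX N l * totX N m = totX N m * totX N l :=
  LinearMap.ext fun _ => funext fun _ => N.X_comm l m _ _ _ _ _ _

/-- The variables act by commuting endomorphisms of the product of all graded pieces, so they
generate a commutative subalgebra, into which polynomials can be evaluated. -/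
theorem exists_act : ∃ φ : MvPolynomial (Fin 4) k →ₐ[k] Module.End k (Tot N),
    ∀ l, φ (X l) = totX N l := by
  let _ : CommRing (Algebra.adjoin k (Set.range (totX N))) := 
    { (inferInstance : Ring (Algebra.adjoin k (Set.range (totX N)))) with
      mul_comm := (Algebra.isMulCommutative_adjoin k (s := Set.range (totX N)) (by
        rintro _ ⟨l, rfl⟩ _ ⟨m, rfl⟩; exact totX_comm N l m)).is_comm.comm }
  refine ⟨(Algebra.adjoin k (Set.range (totX N))).val.comp
    (aeval fun l => ⟨totX N l, Algebra.subset_adjoin ⟨l, rfl⟩⟩), fun l => ?_⟩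
  simp

def act : MvPolynomial (Fin 4) k →ₐ[k] Module.End k (Tot N) := (exists_act N).choose

theorem act_X (l : Fin 4) : act N (X l) = totX N l := (exists_act N).choose_spec l

/-- Multiplication by a polynomial, from degree `v` to degree `w`. -/
def pmul (v w : ℤ) : MvPolynomial (Fin 4) k →ₗ[k] N.obj v →ₗ[k] N.obj w :=
  LinearMap.mk₂ k (fun p x => act N p (Pi.single v x : ∀ v, N.obj v) w)
    (fun p q x => by rw [map_add]; rfl) (fun c p x => by rw [map_smul]; rfl)
    (fun p x y => by rw [Pi.single_add]; exact congrFun (map_add (act N p) _ _) w)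
    (fun c p x => by rw [Pi.single_smul]; exact congrFun (map_smul (act N p) c _) w)

variable {N N'}
theorem pmul_apply (v w : ℤ) (p : MvPolynomial (Fin 4) k) (x : N.obj v) :
    pmul N v w p x = act N p (Pi.single v x : ∀ v, N.obj v) w := rfl

theorem pmul_C (v : ℤ) (c : k) (x : N.obj v) : pmul N v v (C c) x = c • x := by
  rw [pmul_apply, ← algebraMap_eq, AlgHom.commutes]
  change (c • (Pi.single v x : ∀ v, N.obj v)) v = _
  simp

theorem pmul_one (v : ℤ) (x : N.obj v) : pmul N v v 1 x = x := by
  rw [← C_1, pmul_C, one_smul]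

/-- No homogeneity of p is needed: `pmul` reads off the component of p · x in the target degree and
discards the others. -/
theorem pmul_X_mul (l : Fin 4) (v w y : ℤ) (hy : w + 1 = y) (p : MvPolynomial (Fin 4) k)
    (x : N.obj v) : pmul N v y (X l * p) x = N.X l w y hy (pmul N v w p x) := by
  obtain rfl : w = y - 1 := by omega
  rw [pmul_apply, map_mul, act_X]; rfl

theorem totX_single (l : Fin 4) (v w : ℤ) (hw : v + 1 = w) (x : N.obj v) :
    totX N l (Pi.single v x : ∀ v, N.obj v) = (Pi.single w (N.X l v w hw x) : ∀ v, N.obj v) := by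
  obtain rfl : v = w - 1 := by omega
  funext y
  rw [totX_apply]
  by_cases h : y = w
  · subst h; simp
  · rw [Pi.single_eq_of_ne h, Pi.single_eq_of_ne (by omega), map_zero]

theorem pmul_X (l : Fin 4) (u v w : ℤ) (hv : u + 1 = v) (p : MvPolynomial (Fin 4) k)
    (x : N.obj u) : pmul N v w p (N.X l u v hv x) = pmul N u w (X l * p) x := by
  rw [pmul_apply, pmul_apply, mul_comm, map_mul, act_X]
  change _ = act N p (totX N l (Pi.single u x : ∀ v, N.obj v)) w
  rw [totX_single l u v hv]

theorem map_pmul {φ : ∀ v, N.obj v →ₗ[k] N'.obj v} (hφ : φ ∈ hom N N') (v w : ℤ)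
    (p : MvPolynomial (Fin 4) k) (x : N.obj v) :
    φ w (pmul N v w p x) = pmul N' v w p (φ v x) := by
  let Φ : Tot N →ₗ[k] Tot N' := LinearMap.pi fun v => (φ v).comp (LinearMap.proj v)
  have h : ∀ s, Φ (act N p s) = act N' p (Φ s) := by
    induction p using MvPolynomial.induction_on with
    | C c =>
      intro s
      rw [← algebraMap_eq, AlgHom.commutes, AlgHom.commutes]
      exact map_smul Φ c s
    | add p q hp hq =>
      intro s
      rw [map_add, map_add, LinearMap.add_apply, LinearMap.add_apply, map_add, hp, hq]
    | mul_X p l hp =>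
      intro s
      rw [map_mul, map_mul, Module.End.mul_apply, Module.End.mul_apply, hp, act_X, act_X]
      congr 1
      funext w
      exact hφ l _ _ _ _
  have h1 := congrFun (h (Pi.single v x : ∀ v, N.obj v)) w
  have h2 : Φ (Pi.single v x : ∀ v, N.obj v) = (Pi.single v (φ v x) : ∀ v, N'.obj v) := by
    funext y
    change φ y (Pi.single v x y) = _
    by_cases h : y = v
    · subst h; simp
    · rw [Pi.single_eq_of_ne h, Pi.single_eq_of_ne h, map_zero]
  rw [h2] at h1
  exact h1

/-- For modules whose pieces map to a genuine module over the polynomial ring, such as polynomial or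
Laurent vectors, `pmul` becomes scalar multiplication. The degree condition on p ensures that
nothing is discarded. -/
theorem pmul_eq_smul {G : Type*} [AddCommGroup G] [Module k G] [Module (MvPolynomial (Fin 4) k) G]
    [IsScalarTower k (MvPolynomial (Fin 4) k) G] (j : ∀ v, N.obj v →ₗ[k] G)
    (hj : ∀ l v w hw x, j w (N.X l v w hw x) = (X l : MvPolynomial (Fin 4) k) • j v x)
    {n v w : ℤ} (hw : v + n = w) {p : MvPolynomial (Fin 4) k} (hp : p ∈ poly k n) (x : N.obj v) :
    j w (pmul N v w p x) = p • j v x := by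
  refine poly_induction (motive := fun n p => ∀ w, v + n = w → j w (pmul N v w p x) = p • j v x)
    ?_ ?_ ?_ ?_ hp w hw
  · intro n w _; simp
  · intro c w hw
    obtain rfl : v = w := by omega
    rw [pmul_C, map_smul, ← algebraMap_eq, algebraMap_smul]
  · intro n p q _ _ hp hq w hw
    rw [map_add, LinearMap.add_apply, map_add, hp w hw, hq w hw, add_smul]
  · intro l n p _ h w hw
    rw [pmul_X_mul l v (v + n) w (by omega), hj, h _ rfl, mul_smul]

/-! ### Maps out of free modules -/

variable {r : ℕ} (d : Fin r → ℤ)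

theorem free_ext {v : ℤ} {x y : (free (k := k) d).obj v} (h : ∀ a, (x a : MvPolynomial (Fin 4) k) = (y a : poly k (v - d a))) :
    x = y := funext fun a => Subtype.ext (h a)

/-- The inclusion of a graded piece of a free module. -/
def freeIncl (v : ℤ) : (free (k := k) d).obj v →ₗ[k] (Fin r → MvPolynomial (Fin 4) k) :=
  LinearMap.pi fun a => (poly k (v - d a)).subtype.comp (LinearMap.proj a)

theorem freeIncl_injective (v : ℤ) : Function.Injective (freeIncl (k := k) d v) :=
  fun _ _ h => free_ext d fun a => congrFun h a

theorem freeIncl_X (l : Fin 4) (v w : ℤ) (hw : v + 1 = w) (x : (free (k := k) d).obj v) :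
    freeIncl d w ((free (k := k) d).X l v w hw x) =
      (X l : MvPolynomial (Fin 4) k) • freeIncl d v x := rfl

/-- The standard basis. -/
def gen (a : Fin r) : (free (k := k) d).obj (d a) :=
  Pi.single a ⟨1, by rw [sub_self]; exact one_mem_poly⟩

theorem freeIncl_gen (a : Fin r) : freeIncl (k := k) d (d a) (gen d a) = Pi.single a 1 := by
  funext b
  change ((Pi.single a _ : ∀ b, poly k (d a - d b)) b : MvPolynomial (Fin 4) k) = _
  by_cases h : b = a
  · subst h; simp
  · simp [Pi.single_eq_of_ne h]

theorem free_eq_sum (v : ℤ) (x : (free (k := k) d).obj v) :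
    x = ∑ a, pmul _ (d a) v (x a : MvPolynomial (Fin 4) k) (gen d a) := by
  apply freeIncl_injective d
  rw [map_sum]
  have h : ∀ a, freeIncl d v (pmul _ (d a) v (x a : MvPolynomial (Fin 4) k) (gen d a)) =
      (x a : MvPolynomial (Fin 4) k) • Pi.single a 1 := fun a => by
    rw [pmul_eq_smul (freeIncl d) (freeIncl_X d) (n := v - d a) (by ring) (x a).2, freeIncl_gen]
  simp_rw [h]
  exact pi_eq_sum_univ' _

theorem hom_free_apply {φ : ∀ v, (free (k := k) d).obj v →ₗ[k] N.obj v} (hφ : φ ∈ hom (free d) N)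
    (v : ℤ) (x : (free (k := k) d).obj v) :
    φ v x = ∑ a, pmul N (d a) v (x a : MvPolynomial (Fin 4) k) (φ (d a) (gen d a)) := by
  conv_lhs => rw [free_eq_sum d v x]
  rw [map_sum]
  exact Finset.sum_congr rfl fun a _ => map_pmul hφ _ _ _ _

variable (N) in
/-- A map out of a free module is determined by the images of the basis. -/
def homFreeEquiv : hom (free (k := k) d) N ≃ₗ[k] (∀ a, N.obj (d a)) where
  toFun φ a := φ.1 (d a) (gen d a)
  map_add' _ _ := rfl
  map_smul' _ _ := rfl
  invFun n := ⟨fun v => ∑ a, ((pmul N (d a) v).flip (n a)).comp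
      ((poly k (v - d a)).subtype.comp (LinearMap.proj a)), fun l v w hw x => by
    simp only [LinearMap.sum_apply, map_sum]
    exact Finset.sum_congr rfl fun a _ => pmul_X_mul l (d a) v w hw _ _⟩
  left_inv φ := by
    refine Subtype.ext (funext fun v => LinearMap.ext fun x => ?_)
    rw [hom_free_apply d φ.2]
    simp [LinearMap.sum_apply]
    rfl
  right_inv n := by
    funext a
    simp only [LinearMap.sum_apply]
    rw [Finset.sum_eq_single a]
    · change pmul N (d a) (d a) (gen (k := k) d a a : MvPolynomial (Fin 4) k) (n a) = n a
      have := congrFun (freeIncl_gen (k := k) d a) a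
      rw [Pi.single_eq_same] at this
      change (gen (k := k) d a a : MvPolynomial (Fin 4) k) = 1 at this
      rw [this, pmul_one]
    · intro b _ hb
      change pmul N (d b) (d a) (gen (k := k) d a b : MvPolynomial (Fin 4) k) (n b) = 0
      have := congrFun (freeIncl_gen (k := k) d a) b
      rw [Pi.single_eq_of_ne hb] at this
      change (gen (k := k) d a b : MvPolynomial (Fin 4) k) = 0 at this
      rw [this]; simp
    · simp

end P3

end

/-! ### Graded duals of free modules and their injectivity -/

noncomputable section
universe u
namespace P3
variable {k : Type u} [Field k]
open MvPolynomial
open GrMod (poly hom homDeg free X_mul_mem_poly)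

variable {N N' L L' : GrMod k}

def precomp (L : GrMod k) (φ : hom N N') : hom N' L →ₗ[k] hom N L where
  toFun θ := ⟨fun v => (θ.1 v).comp (φ.1 v), fun l v w hw s => by
    simp only [LinearMap.comp_apply]; rw [φ.2 l v w hw, θ.2 l v w hw]⟩
  map_add' _ _ := rfl
  map_smul' _ _ := rfl

def postcomp (N : GrMod k) (ψ : hom L L') : hom N L →ₗ[k] hom N L' where
  toFun θ := ⟨fun v => (ψ.1 v).comp (θ.1 v), fun l v w hw s => by
    simp only [LinearMap.comp_apply]; rw [θ.2 l v w hw, ψ.2 l v w hw]⟩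
  map_add' θ η := Subtype.ext (funext fun v => LinearMap.ext fun x => map_add (ψ.1 v) _ _)
  map_smul' c θ := Subtype.ext (funext fun v => LinearMap.ext fun x => map_smul (ψ.1 v) c _)

theorem hom_ext {θ η : hom N L} (h : ∀ v x, θ.1 v x = η.1 v x) : θ = η :=
  Subtype.ext (funext fun v => LinearMap.ext fun x => h v x)

/-- The graded `k`-dual of the free module `⨁_a R(d_a - 4)`: this is the top local cohomology
of `⨁_a R(-d_a)`. -/
def dualFree {r : ℕ} (d : Fin r → ℤ) : GrMod k where
  obj v := ∀ a, Module.Dual k (poly k (d a + -4 - v))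
  X l v w hw := LinearMap.pi fun a => (Module.Dual.transpose (R := k)
    ((((LinearMap.mulLeft k (X l)).comp (poly k (d a + -4 - w)).subtype).codRestrict
      (poly k (d a + -4 - v)) fun p => X_mul_mem_poly l (by omega) p.2))).comp (LinearMap.proj a)
  X_comm l m v w y hw hy s := by
    funext a
    refine LinearMap.ext fun p => ?_
    exact congrArg (s a) (Subtype.ext (mul_left_comm _ _ _))

variable {r : ℕ} (d : Fin r → ℤ)

theorem dualFree_X (l : Fin 4) (v w : ℤ) (hw : v + 1 = w) (ξ : (dualFree (k := k) d).obj v)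
    (a : Fin r) (q : poly k (d a + -4 - w)) :
    (dualFree d).X l v w hw ξ a q = ξ a ⟨X l * q.1, X_mul_mem_poly l (by omega) q.2⟩ := rfl

theorem dualFree_pmul {n v w : ℤ} (hw : v + n = w) {p : MvPolynomial (Fin 4) k}
    (hp : p ∈ poly k n) (ξ : (dualFree (k := k) d).obj v) (a : Fin r)
    (q : poly k (d a + -4 - w)) (h : p * q.1 ∈ poly k (d a + -4 - v)) :
    pmul _ v w p ξ a q = ξ a ⟨p * q.1, h⟩ := by
  refine poly_induction (motive := fun n p => ∀ w, v + n = w → ∀ (q : poly k (d a + -4 - w))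
    (h : p * q.1 ∈ poly k (d a + -4 - v)), pmul _ v w p ξ a q = ξ a ⟨p * q.1, h⟩)
    ?_ ?_ ?_ ?_ hp w hw q h
  · intro n w _ q h
    have : (⟨0 * q.1, h⟩ : poly k (d a + -4 - v)) = 0 := Subtype.ext (zero_mul _)
    rw [this, map_zero, map_zero]; rfl
  · intro c w hw q h
    obtain rfl : v = w := by omega
    have : (⟨C c * q.1, h⟩ : poly k (d a + -4 - v)) = c • q := Subtype.ext C_mul'
    rw [pmul_C, this, map_smul]; rfl
  · intro n p p' hp hp' ih ih' w hw q h
    have h1 : p * q.1 ∈ poly k (d a + -4 - v) := by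
      have := mul_mem_poly hp q.2
      rwa [show n + (d a + -4 - w) = d a + -4 - v by omega] at this
    have h2 : p' * q.1 ∈ poly k (d a + -4 - v) := by
      have := mul_mem_poly hp' q.2
      rwa [show n + (d a + -4 - w) = d a + -4 - v by omega] at this
    have : (⟨(p + p') * q.1, h⟩ : poly k (d a + -4 - v)) = ⟨p * q.1, h1⟩ + ⟨p' * q.1, h2⟩ :=
      Subtype.ext (add_mul _ _ _)
    rw [this, map_add, map_add, ← ih w hw q h1, ← ih' w hw q h2]; rfl
  · intro l n p hp ih w hw q h
    rw [pmul_X_mul l v (v + n) w (by omega), dualFree_X, ih _ rfl]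
    · exact congrArg (ξ a) (Subtype.ext (by change p * (X l * q.1) = X l * p * q.1; ring))
    · change p * (X l * q.1) ∈ _
      rwa [mul_left_comm, ← mul_assoc]

/-- Evaluation at the unit of the dual of the free module. -/
def evOne (a : Fin r) : (dualFree (k := k) d).obj (d a + -4) →ₗ[k] k where
  toFun ξ := ξ a ⟨1, by rw [sub_self]; exact one_mem_poly⟩
  map_add' _ _ := rfl
  map_smul' _ _ := rfl

/-- The map into the dual of a free module with given coordinates. -/
def dualHom (N : GrMod k) (μ : ∀ a, Module.Dual k (N.obj (d a + -4))) : hom N (dualFree d) :=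
  ⟨fun v => LinearMap.pi fun a => LinearMap.mk₂ k
      (fun x (q : poly k (d a + -4 - v)) => μ a (pmul N v (d a + -4) q x))
      (fun _ _ _ => by simp) (fun _ _ _ => by simp) (fun _ _ _ => by simp) (fun _ _ _ => by simp),
    fun l v w hw x => by
    funext a
    refine LinearMap.ext fun q => ?_
    exact congrArg (μ a) (pmul_X l v w _ hw q x)⟩

theorem dualHom_apply (μ : ∀ a, Module.Dual k (N.obj (d a + -4))) (v : ℤ) (x : N.obj v)
    (a : Fin r) (q : poly k (d a + -4 - v)) :
    (dualHom d N μ).1 v x a q = μ a (pmul N v (d a + -4) q x) := rfl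

/-- Since q acts on functionals by transposing multiplication, θ(x)(q) = (q θ(x))(1) = θ(q x)(1). So
a map into the dual is the same as a linear form on N in degree d_a - 4 for each a, which is why
extension problems reduce to vector spaces. -/
theorem hom_dualFree_apply (θ : hom N (dualFree d)) (v : ℤ) (x : N.obj v)
    (a : Fin r) (q : poly k (d a + -4 - v)) :
    θ.1 v x a q = evOne d a (θ.1 (d a + -4) (pmul N v (d a + -4) q x)) := by
  rw [map_pmul θ.2]
  refine Eq.trans ?_ (dualFree_pmul d (n := d a + -4 - v) (by ring) q.2 _ a
    ⟨1, by rw [sub_self]; exact one_mem_poly⟩ (by simp)).symm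
  exact congrArg _ (Subtype.ext (mul_one _).symm)

theorem hom_dualFree_ext {θ η : hom N (dualFree d)}
    (h : ∀ a x, evOne d a (θ.1 (d a + -4) x) = evOne d a (η.1 (d a + -4) x)) : θ = η :=
  hom_ext fun v x => funext fun a => LinearMap.ext fun q => by
    rw [hom_dualFree_apply, hom_dualFree_apply, h]

theorem evOne_dualHom (μ : ∀ a, Module.Dual k (N.obj (d a + -4))) (a : Fin r)
    (x : N.obj (d a + -4)) : evOne d a ((dualHom d N μ).1 (d a + -4) x) = μ a x := by
  refine (dualHom_apply d μ _ x a _).trans ?_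
  rw [pmul_one]

/-- Over a field, μ induces a map on the range of ψ, which extends to all of W. -/
theorem exists_comp_eq_of_ker_le {V W U : Type*} [AddCommGroup V] [Module k V] [AddCommGroup W]
    [Module k W] [AddCommGroup U] [Module k U] (ψ : V →ₗ[k] W) (μ : V →ₗ[k] U)
    (h : LinearMap.ker ψ ≤ LinearMap.ker μ) : ∃ ν : W →ₗ[k] U, ν.comp ψ = μ := by
  obtain ⟨ν, hν⟩ := LinearMap.exists_extend
    (((LinearMap.ker ψ).liftQ μ h).comp ψ.quotKerEquivRange.symm.toLinearMap)
  refine ⟨ν, LinearMap.ext fun x => ?_⟩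
  have := LinearMap.congr_fun hν ⟨ψ x, x, rfl⟩
  refine this.trans ?_
  have h2 : ψ.quotKerEquivRange.symm ⟨ψ x, x, rfl⟩ = Submodule.Quotient.mk x := by
    rw [LinearEquiv.symm_apply_eq]; rfl
  simp [h2]

/-- Duals of free modules are injective. -/
theorem exists_precomp_eq (ψ : hom N N') (θ : hom N (dualFree d))
    (h : ∀ a x, ψ.1 (d a + -4) x = 0 → θ.1 (d a + -4) x = 0) :
    ∃ η, precomp (dualFree d) ψ η = θ := by
  have : ∀ a, ∃ ν : Module.Dual k (N'.obj (d a + -4)), ν.comp (ψ.1 (d a + -4)) =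
      (evOne d a).comp (θ.1 (d a + -4)) := fun a =>
    exists_comp_eq_of_ker_le _ _ fun x hx => by
      rw [LinearMap.mem_ker, LinearMap.comp_apply, h a x hx, map_zero]
  choose ν hν using this
  refine ⟨dualHom d N' ν, hom_dualFree_ext d fun a x => ?_⟩
  refine (evOne_dualHom d ν a _).trans ?_
  exact LinearMap.congr_fun (hν a) x

end P3

end

/-! ### Maps of free modules, their transposes, and lifting lemmas -/

noncomputable section
universe u
namespace P3
variable {k : Type u} [Field k]
open MvPolynomial
open GrMod (poly hom homDeg free X_mul_mem_poly)

variable {N N' L L' : GrMod k}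

section matrix
variable {r₀ r₁ : ℕ} {d₀ : Fin r₀ → ℤ} {d₁ : Fin r₁ → ℤ}

/-- The matrix of a map of free modules. -/
def mat (D : hom (free (k := k) d₁) (free d₀)) : Matrix (Fin r₀) (Fin r₁) (MvPolynomial (Fin 4) k) :=
  fun b a => freeIncl d₀ (d₁ a) (D.1 (d₁ a) (gen d₁ a)) b

theorem mat_mem (D : hom (free (k := k) d₁) (free d₀)) (b : Fin r₀) (a : Fin r₁) :
    mat D b a ∈ poly k (d₁ a - d₀ b) := (D.1 (d₁ a) (gen d₁ a) b).2

theorem freeIncl_apply (D : hom (free (k := k) d₁) (free d₀)) (v : ℤ) (x : (free d₁).obj v) :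
    freeIncl d₀ v (D.1 v x) = (mat D).mulVec (freeIncl d₁ v x) := by
  rw [hom_free_apply d₁ D.2, map_sum]
  funext b
  rw [Finset.sum_apply, Matrix.mulVec, dotProduct]
  refine Finset.sum_congr rfl fun a _ => ?_
  rw [pmul_eq_smul (freeIncl d₀) (freeIncl_X d₀) (n := v - d₁ a) (by ring) (x a).2, mul_comm]
  rfl

/-- The map of dual modules induced by a map of free modules. -/
def dualMat (D : hom (free (k := k) d₁) (free d₀)) : hom (dualFree (k := k) d₁) (dualFree d₀) :=
  dualHom d₀ (dualFree d₁) fun b =>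
    { toFun := fun ξ => ∑ a, ξ a ⟨mat D b a, by
        rw [show d₁ a + -4 - (d₀ b + -4) = d₁ a - d₀ b by ring]; exact mat_mem D b a⟩
      map_add' := fun ξ η => by rw [← Finset.sum_add_distrib]; rfl
      map_smul' := fun c ξ => by rw [RingHom.id_apply, Finset.smul_sum]; rfl }

theorem mul_mat_mem (D : hom (free (k := k) d₁) (free d₀)) (b : Fin r₀) (a : Fin r₁) {v : ℤ}
    {q : MvPolynomial (Fin 4) k} (hq : q ∈ poly k (d₀ b + -4 - v)) :
    q * mat D b a ∈ poly k (d₁ a + -4 - v) := by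
  have := mul_mem_poly hq (mat_mem D b a)
  rwa [show d₀ b + -4 - v + (d₁ a - d₀ b) = d₁ a + -4 - v by ring] at this

theorem dualMat_apply (D : hom (free (k := k) d₁) (free d₀)) (v : ℤ)
    (ξ : (dualFree (k := k) d₁).obj v) (b : Fin r₀) (q : poly k (d₀ b + -4 - v)) :
    (dualMat D).1 v ξ b q = ∑ a, ξ a ⟨q * mat D b a, mul_mat_mem D b a q.2⟩ := by
  refine (dualHom_apply (N := dualFree d₁) d₀ _ v ξ b q).trans ?_
  change (∑ a, pmul (dualFree d₁) v (d₀ b + -4) q.1 ξ a ⟨mat D b a, _⟩) = _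
  refine Finset.sum_congr rfl fun a _ => ?_
  exact dualFree_pmul d₁ (n := d₀ b + -4 - v) (v := v) (w := d₀ b + -4) (p := q.1) (by ring) q.2 ξ a
    ⟨mat D b a, _⟩ (mul_mat_mem D b a q.2)

theorem pmul_shift (m : ℤ) {n v w : ℤ} (hw : v + n = w) {p : MvPolynomial (Fin 4) k}
    (hp : p ∈ poly k n) (x : (N.shift m).obj v) :
    pmul (N.shift m) v w p x = pmul N (v + m) (w + m) p x := by
  refine poly_induction (motive := fun n p => ∀ w, v + n = w →
    pmul (N.shift m) v w p x = pmul N (v + m) (w + m) p x) ?_ ?_ ?_ ?_ hp w hw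
  · intro n w _; simp; rfl
  · intro c w hw
    obtain rfl : v = w := by omega
    rw [pmul_C]; exact (pmul_C (N := N) (v + m) c x).symm
  · intro n p q _ _ hp hq w hw
    rw [map_add, LinearMap.add_apply, hp w hw, hq w hw, map_add]; rfl
  · intro l n p _ h w hw
    rw [pmul_X_mul l v (v + n) w (by omega), h _ rfl]
    exact (pmul_X_mul (N := N) l (v + m) (v + n + m) (w + m) (by omega) p x).symm

/-- Maps into the duals are families of linear forms, and composing with `dualMat D` is the
transpose of the map Hom(P_0, N(-4)) → Hom(P_1, N(-4)) given by D. The hypothesis makes the latter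
injective, and linear forms extend along an injection. -/
theorem postcomp_dualMat_surjective (D : hom (free (k := k) d₁) (free d₀))
    (h : ∀ φ : hom (free d₀) (N.shift (-4)), precomp (N.shift (-4)) D φ = 0 → φ = 0) :
    Function.Surjective (postcomp N (dualMat D)) := by
  intro θ
  -- T is precomposition with D, written in terms of the images of the basis elements.
  let T : (∀ b, N.obj (d₀ b + -4)) →ₗ[k] (∀ a, N.obj (d₁ a + -4)) :=
    LinearMap.pi fun a => ∑ b, (pmul N (d₀ b + -4) (d₁ a + -4) (mat D b a)).comp (LinearMap.proj b)
  have hT : LinearMap.ker T = ⊥ := by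
    rw [LinearMap.ker_eq_bot']
    intro n hn
    let n' : ∀ b, (N.shift (-4)).obj (d₀ b) := n
    have h1 := h ((homFreeEquiv (N.shift (-4)) d₀).symm n') (by
      apply (homFreeEquiv (N.shift (-4)) d₁).injective
      rw [map_zero]
      refine Eq.trans ?_ hn
      funext a
      refine Eq.trans (hom_free_apply d₀ ((homFreeEquiv (N.shift (-4)) d₀).symm n').2 (d₁ a)
        (D.1 (d₁ a) (gen d₁ a))) ?_
      simp only [T, LinearMap.pi_apply, LinearMap.sum_apply]
      refine Finset.sum_congr rfl fun b _ => ?_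
      rw [pmul_shift (-4) (n := d₁ a - d₀ b) (by ring) (D.1 (d₁ a) (gen d₁ a) b).2]
      have h2 := congrFun ((homFreeEquiv (N.shift (-4)) d₀).apply_symm_apply n') b
      exact congrArg _ h2)
    have h3 := (homFreeEquiv (N.shift (-4)) d₀).apply_symm_apply n'
    rw [h1, map_zero] at h3
    exact h3.symm
  -- All components of θ together form one linear form on the source of T; ν extends it, and its
  -- coordinates define the preimage of θ.
  obtain ⟨ν, hν⟩ := exists_comp_eq_of_ker_le T
    (∑ b, (evOne d₀ b).comp ((θ.1 (d₀ b + -4)).comp (LinearMap.proj b))) (hT ▸ bot_le)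
  refine ⟨dualHom d₁ N fun a => ν.comp (LinearMap.single k
    (fun a : Fin r₁ => N.obj (d₁ a + -4)) a), hom_dualFree_ext d₀ fun b x => ?_⟩
  have h1 := LinearMap.congr_fun hν (Pi.single b x)
  rw [LinearMap.sum_apply, Finset.sum_eq_single b] at h1
  · simp only [LinearMap.comp_apply, LinearMap.proj_apply, Pi.single_eq_same] at h1
    rw [← h1]
    refine Eq.trans (dualMat_apply D (d₀ b + -4) _ b _) ?_
    have h2 : T (Pi.single b x) = ∑ a, Pi.single a
        (pmul N (d₀ b + -4) (d₁ a + -4) (mat D b a) x) := by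
      rw [Finset.univ_sum_single]
      funext a
      simp only [T, LinearMap.pi_apply, LinearMap.sum_apply, LinearMap.comp_apply,
        LinearMap.proj_apply]
      rw [Finset.sum_eq_single b]
      · rw [Pi.single_eq_same]
      · intro c _ hc; rw [Pi.single_eq_of_ne hc, map_zero]
      · simp
    rw [h2, map_sum]
    refine Finset.sum_congr rfl fun a _ => ?_
    refine (dualHom_apply d₁ _ _ _ _ _).trans ?_
    change ν (Pi.single a (pmul N _ _ (1 * mat D b a) x)) = _
    rw [one_mul]
  · intro c _ hc
    simp [Pi.single_eq_of_ne hc]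
  · simp

end matrix

/-- Projectivity of free modules; only the images of the basis elements have to be lifted. -/
theorem exists_postcomp_eq {r : ℕ} {d : Fin r → ℤ} (ρ : hom L L') (φ : hom (free (k := k) d) L')
    (h : ∀ a, ∃ y, ρ.1 (d a) y = φ.1 (d a) (gen d a)) : ∃ ψ, postcomp (free d) ρ ψ = φ := by
  choose y hy using h
  refine ⟨(homFreeEquiv L d).symm y, (homFreeEquiv L' d).injective (funext fun a => ?_)⟩
  refine Eq.trans ?_ (hy a)
  exact congrArg _ (congrFun ((homFreeEquiv L d).apply_symm_apply y) a)

/-- The factorization is chosen degree by degree as a k-linear map; compatibility with the variables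
is automatic, since every element comes from N. -/
theorem exists_desc (ε : hom N N') (hε : ∀ v, Function.Surjective (ε.1 v)) (φ : hom N L)
    (h : ∀ v x, ε.1 v x = 0 → φ.1 v x = 0) : ∃ η, precomp L ε η = φ := by
  have : ∀ v, ∃ ν : N'.obj v →ₗ[k] L.obj v, ν.comp (ε.1 v) = φ.1 v := fun v =>
    exists_comp_eq_of_ker_le _ _ fun x hx => h v x hx
  choose ν hν using this
  refine ⟨⟨ν, fun l v w hw s => ?_⟩, Subtype.ext (funext hν)⟩
  obtain ⟨x, rfl⟩ := hε v s
  rw [← ε.2 l v w hw]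
  have h1 := LinearMap.congr_fun (hν w) (N.X l v w hw x)
  have h2 := LinearMap.congr_fun (hν v) x
  rw [LinearMap.comp_apply] at h1 h2
  rw [h1, h2, φ.2 l v w hw]

theorem exists_lift (i : hom L L') (hi : ∀ v, Function.Injective (i.1 v)) (φ : hom N L')
    (h : ∀ v x, φ.1 v x ∈ LinearMap.range (i.1 v)) : ∃ ψ, postcomp N i ψ = φ := by
  refine ⟨⟨fun v => (LinearEquiv.ofInjective (i.1 v) (hi v)).symm.toLinearMap.comp
    ((φ.1 v).codRestrict _ (h v)), fun l v w hw s => ?_⟩, hom_ext fun v x => ?_⟩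
  · apply hi w
    rw [i.2 l v w hw]
    have h1 := LinearEquiv.ofInjective_symm_apply (f := i.1 w) (h := hi w)
      ((φ.1 w).codRestrict _ (h w) (N.X l v w hw s))
    have h2 := LinearEquiv.ofInjective_symm_apply (f := i.1 v) (h := hi v) ((φ.1 v).codRestrict _ (h v) s)
    refine h1.trans (Eq.trans ?_ (congrArg _ h2.symm))
    exact φ.2 l v w hw s
  · exact LinearEquiv.ofInjective_symm_apply (f := i.1 v) (h := hi v) ((φ.1 v).codRestrict _ (h v) x)

theorem finrank_alternating {V₀ V₁ V₂ V₃ : Type*} [AddCommGroup V₀] [Module k V₀] [AddCommGroup V₁]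
    [Module k V₁] [AddCommGroup V₂] [Module k V₂] [AddCommGroup V₃] [Module k V₃]
    [FiniteDimensional k V₁] [FiniteDimensional k V₂] (f : V₀ →ₗ[k] V₁) (g : V₁ →ₗ[k] V₂)
    (h : V₂ →ₗ[k] V₃) (hf : Function.Injective f) (hfg : Function.Exact f g)
    (hgh : Function.Exact g h) (hh : Function.Surjective h) :
    FiniteDimensional k V₀ ∧ (Module.finrank k V₀ : ℤ) =
      Module.finrank k V₁ - Module.finrank k V₂ + Module.finrank k V₃ := by
  have hfin := FiniteDimensional.of_injective f hf
  have h1 := LinearMap.finrank_range_of_inj hf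
  have h2 := g.finrank_range_add_finrank_ker
  have h3 := h.finrank_range_add_finrank_ker
  rw [hfg.linearMap_ker_eq] at h2
  rw [hgh.linearMap_ker_eq, LinearMap.range_eq_top.2 hh, finrank_top] at h3
  refine ⟨hfin, ?_⟩
  omega

end P3

end

/-! ### The dimension count for Hom into the kernel of Q → B_0 -/

noncomputable section
universe u
namespace P3
variable {k : Type u} [Field k]
open MvPolynomial Module
open GrMod (poly hom homDeg free X_mul_mem_poly)

instance {r : ℕ} (d : Fin r → ℤ) (v : ℤ) : FiniteDimensional k ((dualFree (k := k) d).obj v) :=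
  inferInstanceAs (FiniteDimensional k (∀ a, Module.Dual k (poly k (d a + -4 - v))))

theorem finite_hom_free {r : ℕ} (d : Fin r → ℤ) (N : GrMod k) [∀ v, FiniteDimensional k (N.obj v)] :
    FiniteDimensional k (hom (free d) N) :=
  LinearEquiv.finiteDimensional (homFreeEquiv N d).symm

theorem finrank_hom_free {r : ℕ} (d : Fin r → ℤ) (N : GrMod k) [∀ v, FiniteDimensional k (N.obj v)] :
    finrank k (hom (free d) N) = ∑ a, finrank k (N.obj (d a)) := by
  rw [(homFreeEquiv N d).finrank_eq, finrank_pi_fintype]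

variable {F : GrMod k} (P : GrMod.MinimalFreeResolution F)

/-- The alternating sum over the first three terms of a resolution. -/
def altSum (f : ℤ → ℤ) : ℤ :=
  (∑ a, f (P.deg 0 a)) - (∑ a, f (P.deg 1 a)) + ∑ a, f (P.deg 2 a)

theorem altSum_sub (f g : ℤ → ℤ) : altSum P (fun v => f v - g v) = altSum P f - altSum P g := by
  simp only [altSum, Finset.sum_sub_distrib]; ring

/-- Left exactness of Hom is automatic; the hypotheses are exactness of Hom(P_•, N) at P_1 and at
P_2, where the complex stops. Then the dimension is an Euler characteristic. -/
theorem finrank_hom_of_acyclic (N : GrMod k) [∀ v, FiniteDimensional k (N.obj v)]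
    (h₁ : ∀ φ : hom (free (P.deg 1)) N, precomp N (P.d 1) φ = 0 → ∃ ψ, precomp N (P.d 0) ψ = φ)
    (h₂ : Function.Surjective (precomp N (P.d 1))) :
    FiniteDimensional k (hom F N) ∧
      (finrank k (hom F N) : ℤ) = altSum P fun v => finrank k (N.obj v) := by
  have i0 := finite_hom_free (P.deg 0) N
  have i1 := finite_hom_free (P.deg 1) N
  have h := finrank_alternating (precomp N P.ε) (precomp N (P.d 0)) (precomp N (P.d 1))
    ?_ ?_ ?_ h₂
  · refine ⟨h.1, ?_⟩
    rw [h.2, finrank_hom_free, finrank_hom_free, finrank_hom_free, altSum]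
    push_cast; rfl
  · intro θ η h
    refine hom_ext fun v x => ?_
    obtain ⟨y, rfl⟩ := P.surjective v x
    exact LinearMap.congr_fun (congrFun (congrArg Subtype.val h) v) y
  · intro φ
    constructor
    · intro h
      refine exists_desc P.ε P.surjective φ fun v x hx => ?_
      obtain ⟨y, rfl⟩ := (P.exact_zero v x).1 hx
      exact LinearMap.congr_fun (congrFun (congrArg Subtype.val h) v) y
    · rintro ⟨ψ, rfl⟩
      refine hom_ext fun v x => ?_
      change ψ.1 v (P.ε.1 v ((P.d 0).1 v x)) = 0
      rw [(P.exact_zero v).apply_apply_eq_zero, map_zero]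
  · intro φ
    refine ⟨h₁ φ, ?_⟩
    rintro ⟨ψ, rfl⟩
    refine hom_ext fun v x => ?_
    change ψ.1 v ((P.d 0).1 v ((P.d 1).1 v x)) = 0
    rw [(P.exact_succ 0 v).apply_apply_eq_zero, map_zero]

variable {P} in
-- Extension of maps along the injection P_2 → P_1, as duals of free modules are injective.
theorem precomp_dualFree_surjective (hinj : ∀ v, Function.Injective ((P.d 1).1 v)) {r : ℕ}
    (d : Fin r → ℤ) : Function.Surjective (precomp (dualFree d) (P.d 1)) := fun θ =>
  exists_precomp_eq d (P.d 1) θ fun a x hx => by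
    rw [(map_eq_zero_iff _ (hinj _)).1 hx, map_zero]

theorem exists_precomp_dualFree {r : ℕ} (d : Fin r → ℤ) (φ : hom (free (P.deg 1)) (dualFree d))
    (h : precomp (dualFree d) (P.d 1) φ = 0) : ∃ ψ, precomp (dualFree d) (P.d 0) ψ = φ :=
  exists_precomp_eq d (P.d 0) φ fun a x hx => by
    obtain ⟨y, rfl⟩ := (P.exact_succ 0 _ x).1 hx
    exact LinearMap.congr_fun (congrFun (congrArg Subtype.val h) _) y

/-- Apply Hom(F, -) to 0 → E → Q → B_0. The last map stays surjective because of the vanishing in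
degree -4, and the dimensions of the other two terms are alternating sums. -/
theorem finrank_hom_eq (hinj : ∀ v, Function.Injective ((P.d 1).1 v)) (hF : homDeg (-4) F F = ⊥)
    (Q E : GrMod k) (π : hom (dualFree (P.deg 1)) Q) (δ : hom Q (dualFree (P.deg 0))) (i : hom E Q)
    (hπ : ∀ v, Function.Surjective (π.1 v))
    (hπ' : ∀ v, Function.Exact ((dualMat (P.d 1)).1 v) (π.1 v))
    (hδ : ∀ v x, δ.1 v (π.1 v x) = (dualMat (P.d 0)).1 v x)
    (hi : ∀ v, Function.Injective (i.1 v)) (hiδ : ∀ v, Function.Exact (i.1 v) (δ.1 v)) :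
    Module.Finite k (hom F E) ∧ (finrank k (hom F E) : ℤ) = altSum P fun v =>
      (finrank k (E.obj v) : ℤ) - finrank k ((dualFree (P.deg 0)).obj v ⧸
        LinearMap.range ((dualMat (P.d 0)).1 v)) := by
  have finQ : ∀ v, FiniteDimensional k (Q.obj v) := fun v => Module.Finite.of_surjective _ (hπ v)
  have finB := finrank_hom_of_acyclic P (dualFree (P.deg 0)) (exists_precomp_dualFree P _)
    (precomp_dualFree_surjective hinj _)
  have finQ' := finrank_hom_of_acyclic P Q ?_ ?_
  · have := finB.1
    have := finQ'.1
    have hinjE : Function.Injective (postcomp F i) := fun θ η h =>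
      hom_ext fun v x => hi v (LinearMap.congr_fun (congrFun (congrArg Subtype.val h) v) x)
    have hex : Function.Exact (postcomp F i) (postcomp F δ) := by
      intro φ
      constructor
      · intro h
        refine exists_lift i hi φ fun v x => ?_
        exact (hiδ v _).1 (LinearMap.congr_fun (congrFun (congrArg Subtype.val h) v) x)
      · rintro ⟨ψ, rfl⟩
        exact hom_ext fun v x => (hiδ v).apply_apply_eq_zero _
    -- It suffices to lift to Hom(F, B_1). A map P_0 → F(-4) that dies on P_1 descends to F → F(-4),
    -- hence vanishes by assumption.
    have hsurj : Function.Surjective (postcomp F δ) := by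
      intro θ
      obtain ⟨η, rfl⟩ := postcomp_dualMat_surjective (N := F) (P.d 0) (fun φ h => by
        obtain ⟨ψ, rfl⟩ := exists_desc P.ε P.surjective φ fun v x hx => by
          obtain ⟨y, rfl⟩ := (P.exact_zero v x).1 hx
          exact LinearMap.congr_fun (congrFun (congrArg Subtype.val h) v) y
        have h0 : ψ = 0 := Subtype.ext (by
          have := ψ.2
          change ψ.1 ∈ homDeg (-4) F F at this
          rw [hF] at this
          exact this)
        rw [h0, map_zero]) θ
      exact ⟨postcomp F π η, hom_ext fun v x => hδ v _⟩
    refine ⟨FiniteDimensional.of_injective _ hinjE, ?_⟩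
    have h1 := (postcomp F δ).finrank_range_add_finrank_ker
    rw [hex.linearMap_ker_eq, LinearMap.finrank_range_of_inj hinjE, LinearMap.range_eq_top.2 hsurj,
      finrank_top] at h1
    have h2 : (finrank k (hom F E) : ℤ) = finrank k (hom F Q) - finrank k (hom F (dualFree (P.deg 0))) := by
      omega
    rw [h2, finB.2, finQ'.2, ← altSum_sub]
    congr 1
    funext v
    -- Rank-nullity for Q_v → (B_0)_v, whose kernel is E_v and whose image is that of (B_1)_v, as π
    -- is surjective.
    have h3 := (δ.1 v).finrank_range_add_finrank_ker
    rw [(hiδ v).linearMap_ker_eq, LinearMap.finrank_range_of_inj (hi v)] at h3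
    have h4 : LinearMap.range (δ.1 v) = LinearMap.range ((dualMat (P.d 0)).1 v) := by
      rw [← show (δ.1 v).comp (π.1 v) = (dualMat (P.d 0)).1 v from LinearMap.ext (hδ v),
        LinearMap.range_comp_of_range_eq_top _ (LinearMap.range_eq_top.2 (hπ v))]
    have h5 := (LinearMap.range ((dualMat (P.d 0)).1 v)).finrank_quotient_add_finrank
    rw [h4] at h3
    omega
  -- Exactness of Hom(P_•, Q) at P_1. Lift φ to x : P_1 → B_1. On P_2 it lands in the image of B_2,
  -- so it is given there by some y : P_2 → B_2, which extends to y' on P_1. Correcting x by y'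
  -- leaves its image in Q unchanged and makes it vanish on P_2, so it extends to P_0.
  · intro φ h
    obtain ⟨x, rfl⟩ := exists_postcomp_eq π φ fun a => hπ _ _
    obtain ⟨y, hy⟩ := exists_postcomp_eq (dualMat (P.d 1)) (precomp _ (P.d 1) x) fun a =>
      (hπ' _ _).1 (LinearMap.congr_fun (congrFun (congrArg Subtype.val h) _) _)
    obtain ⟨y', rfl⟩ := precomp_dualFree_surjective hinj _ y
    obtain ⟨z, hz⟩ := exists_precomp_dualFree P _ (x - postcomp _ (dualMat (P.d 1)) y') (by
      rw [map_sub, sub_eq_zero, ← hy]; rfl)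
    refine ⟨postcomp _ π z, ?_⟩
    have h1 : postcomp _ π (precomp _ (P.d 0) z) = postcomp _ π x - 0 := by
      rw [hz, map_sub]
      congr 1
      exact hom_ext fun v x => (hπ' v).apply_apply_eq_zero _
    rw [sub_zero] at h1
    exact h1
  -- Surjectivity onto Hom(P_2, Q): lift to B_1 and extend along P_2 → P_1.
  · intro φ
    obtain ⟨x, rfl⟩ := exists_postcomp_eq π φ fun a => hπ _ _
    obtain ⟨y, rfl⟩ := precomp_dualFree_surjective hinj _ x
    exact ⟨postcomp _ π y, rfl⟩

end P3

end

/-! ### Koszul complexes and projective dimension -/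

noncomputable section
universe u
namespace P3
variable {k : Type u} [Field k]
open MvPolynomial
open GrMod (poly hom homDeg free X_mul_mem_poly)

/-- The quotient of the division by the variable `X_i`. -/
def divX (i : Fin 4) (p : MvPolynomial (Fin 4) k) : MvPolynomial (Fin 4) k :=
  p.divMonomial (Finsupp.single i 1)

theorem divX_add (i : Fin 4) (p q : MvPolynomial (Fin 4) k) :
    divX i (p + q) = divX i p + divX i q := add_divMonomial _ _ _

theorem divX_zero (i : Fin 4) : divX i (0 : MvPolynomial (Fin 4) k) = 0 := zero_divMonomial _

theorem coeff_divX (i : Fin 4) (p : MvPolynomial (Fin 4) k) (m : Fin 4 →₀ ℕ) :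
    coeff m (divX i p) = coeff (Finsupp.single i 1 + m) p := coeff_divMonomial _ _ _

theorem divX_X_mul (i : Fin 4) (p : MvPolynomial (Fin 4) k) : divX i (X i * p) = p :=
  X_mul_divMonomial _ _

theorem divX_X_mul_of_ne {i j : Fin 4} (h : i ≠ j) (p : MvPolynomial (Fin 4) k) :
    divX i (X j * p) = X j * divX i p := by
  ext m
  rw [coeff_divX, coeff_X_mul', coeff_X_mul']
  have h1 : (j ∈ (Finsupp.single i 1 + m).support) ↔ j ∈ m.support := by
    simp [h]
  simp only [h1]
  split_ifs with h2
  · rw [coeff_divX]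
    congr 1
    have hle : Finsupp.single j 1 ≤ m := by
      rw [Finsupp.single_le_iff]; exact Nat.one_le_iff_ne_zero.2 (Finsupp.mem_support_iff.1 h2)
    rw [add_tsub_assoc_of_le hle]
  · rfl

theorem divX_neg (i : Fin 4) (p : MvPolynomial (Fin 4) k) : divX i (-p) = -divX i p := by
  ext m; simp [coeff_divX]

theorem divX_mem (i : Fin 4) {n : ℤ} {p : MvPolynomial (Fin 4) k} (hp : p ∈ poly k n) :
    divX i p ∈ poly k (n - 1) := by
  intro m hm
  rw [mem_support_iff, coeff_divX, ← mem_support_iff] at hm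
  have := hp _ hm
  rw [map_add, Finsupp.degree_single] at this
  push_cast at this
  omega

theorem X_mul_divX_mem (i : Fin 4) {n : ℤ} {p : MvPolynomial (Fin 4) k} (hp : p ∈ poly k n) :
    X i * divX i p ∈ poly k n := X_mul_mem_poly i (by ring) (divX_mem i hp)

theorem X_ne (i : Fin 4) : (X i : MvPolynomial (Fin 4) k) ≠ 0 := X_ne_zero i

/-- Eliminate one variable at a time. Subtracting X_3 times the quotients by X_3 removes that
variable from the coefficients and leaves a relation among X_0, X_1, X_2; repeat with X_2 and X_1.
Division by a variable respects degrees, which bounds the witnesses. -/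
theorem poly_koszul_one {n : ℤ} {y₀ y₁ y₂ y₃ : MvPolynomial (Fin 4) k} (h₀ : y₀ ∈ poly k n)
    (h₁ : y₁ ∈ poly k n) (h₂ : y₂ ∈ poly k n)
    (h : X 0 * y₀ + X 1 * y₁ + X 2 * y₂ + X 3 * y₃ = 0) :
    ∃ z₀₁ ∈ poly k (n - 1), ∃ z₀₂ ∈ poly k (n - 1), ∃ z₀₃ ∈ poly k (n - 1),
    ∃ z₁₂ ∈ poly k (n - 1), ∃ z₁₃ ∈ poly k (n - 1), ∃ z₂₃ ∈ poly k (n - 1),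
      y₀ = X 1 * z₀₁ + X 2 * z₀₂ + X 3 * z₀₃ ∧ y₁ = -(X 0 * z₀₁) + X 2 * z₁₂ + X 3 * z₁₃ ∧
      y₂ = -(X 0 * z₀₂) - X 1 * z₁₂ + X 3 * z₂₃ ∧ y₃ = -(X 0 * z₀₃) - X 1 * z₁₃ - X 2 * z₂₃ := by
  have e₃ := congrArg (divX 3) h
  simp only [divX_add, divX_X_mul, divX_zero, divX_X_mul_of_ne (show (3 : Fin 4) ≠ 0 by decide),
    divX_X_mul_of_ne (show (3 : Fin 4) ≠ 1 by decide),
    divX_X_mul_of_ne (show (3 : Fin 4) ≠ 2 by decide)] at e₃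
  have m₀ := sub_mem h₀ (X_mul_divX_mem 3 h₀)
  have m₁ := sub_mem h₁ (X_mul_divX_mem 3 h₁)
  set y₀' := y₀ - X 3 * divX 3 y₀ with hy₀
  set y₁' := y₁ - X 3 * divX 3 y₁ with hy₁
  set y₂' := y₂ - X 3 * divX 3 y₂ with hy₂
  have h' : X 0 * y₀' + X 1 * y₁' + X 2 * y₂' = 0 := by
    rw [hy₀, hy₁, hy₂]; linear_combination h - X 3 * e₃
  have e₂ := congrArg (divX 2) h'
  simp only [divX_add, divX_X_mul, divX_zero, divX_X_mul_of_ne (show (2 : Fin 4) ≠ 0 by decide),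
    divX_X_mul_of_ne (show (2 : Fin 4) ≠ 1 by decide)] at e₂
  have n₀ := sub_mem m₀ (X_mul_divX_mem 2 m₀)
  set y₀'' := y₀' - X 2 * divX 2 y₀' with hy₀'
  set y₁'' := y₁' - X 2 * divX 2 y₁' with hy₁'
  have h'' : X 0 * y₀'' + X 1 * y₁'' = 0 := by
    rw [hy₀', hy₁']; linear_combination h' - X 2 * e₂
  have e₁ := congrArg (divX 1) h''
  simp only [divX_add, divX_X_mul, divX_zero,
    divX_X_mul_of_ne (show (1 : Fin 4) ≠ 0 by decide)] at e₁
  have h0 : y₀'' = X 1 * divX 1 y₀'' := by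
    apply mul_left_cancel₀ (X_ne (k := k) 0)
    linear_combination h'' - X 1 * e₁
  refine ⟨divX 1 y₀'', divX_mem 1 n₀, divX 2 y₀', divX_mem 2 m₀, divX 3 y₀, divX_mem 3 h₀,
    divX 2 y₁', divX_mem 2 m₁, divX 3 y₁, divX_mem 3 h₁, divX 3 y₂, divX_mem 3 h₂, ?_, ?_, ?_, ?_⟩
  · rw [← h0]; linear_combination -hy₀ - hy₀'
  · linear_combination e₁ - hy₁ - hy₁'
  · linear_combination e₂ - hy₂
  · linear_combination e₃

/-- The same elimination one step further in the Koszul complex; a_i belongs to the triple of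
variables omitting X_i. The fourth cycle equation is a consequence of the three given ones, X_3
being a nonzerodivisor. -/
theorem poly_koszul_two {n : ℤ} {z₀₁ z₀₂ z₀₃ z₁₂ z₁₃ z₂₃ : MvPolynomial (Fin 4) k}
    (h₀₁ : z₀₁ ∈ poly k n) (h₀₂ : z₀₂ ∈ poly k n) (h₁₂ : z₁₂ ∈ poly k n)
    (e₀ : X 1 * z₀₁ + X 2 * z₀₂ + X 3 * z₀₃ = 0)
    (e₁ : -(X 0 * z₀₁) + X 2 * z₁₂ + X 3 * z₁₃ = 0)
    (e₂ : -(X 0 * z₀₂) - X 1 * z₁₂ + X 3 * z₂₃ = 0) :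
    ∃ a₀ ∈ poly k (n - 1), ∃ a₁ ∈ poly k (n - 1), ∃ a₂ ∈ poly k (n - 1), ∃ a₃ ∈ poly k (n - 1),
      z₀₁ = X 2 * a₃ + X 3 * a₂ ∧ z₀₂ = -(X 1 * a₃) + X 3 * a₁ ∧ z₀₃ = -(X 1 * a₂) - X 2 * a₁ ∧
      z₁₂ = X 0 * a₃ + X 3 * a₀ ∧ z₁₃ = X 0 * a₂ - X 2 * a₀ ∧ z₂₃ = X 0 * a₁ + X 1 * a₀ := by
  have f₀ := congrArg (divX 3) e₀
  have f₁ := congrArg (divX 3) e₁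
  have f₂ := congrArg (divX 3) e₂
  simp only [divX_add, divX_X_mul, divX_zero, divX_neg, sub_eq_add_neg,
    divX_X_mul_of_ne (show (3 : Fin 4) ≠ 0 by decide),
    divX_X_mul_of_ne (show (3 : Fin 4) ≠ 1 by decide),
    divX_X_mul_of_ne (show (3 : Fin 4) ≠ 2 by decide)] at f₀ f₁ f₂
  have m := sub_mem h₀₁ (X_mul_divX_mem 3 h₀₁)
  set w₀₁ := z₀₁ - X 3 * divX 3 z₀₁ with hw₀₁
  set w₀₂ := z₀₂ - X 3 * divX 3 z₀₂ with hw₀₂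
  set w₁₂ := z₁₂ - X 3 * divX 3 z₁₂ with hw₁₂
  have g₀ : X 1 * w₀₁ + X 2 * w₀₂ = 0 := by
    rw [hw₀₁, hw₀₂]; linear_combination e₀ - X 3 * f₀
  have g₁ : -(X 0 * w₀₁) + X 2 * w₁₂ = 0 := by
    rw [hw₀₁, hw₁₂]; linear_combination e₁ - X 3 * f₁
  have i₀ := congrArg (divX 2) g₀
  have i₁ := congrArg (divX 2) g₁
  simp only [divX_add, divX_X_mul, divX_zero, divX_neg,
    divX_X_mul_of_ne (show (2 : Fin 4) ≠ 0 by decide),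
    divX_X_mul_of_ne (show (2 : Fin 4) ≠ 1 by decide)] at i₀ i₁
  have h0 : w₀₁ = X 2 * divX 2 w₀₁ := by
    apply mul_left_cancel₀ (X_ne (k := k) 1)
    linear_combination g₀ - X 2 * i₀
  refine ⟨divX 3 z₁₂, divX_mem 3 h₁₂, divX 3 z₀₂, divX_mem 3 h₀₂, divX 3 z₀₁, divX_mem 3 h₀₁,
    divX 2 w₀₁, divX_mem 2 m, ?_, ?_, ?_, ?_, ?_, ?_⟩
  · rw [← h0, hw₀₁]; ring
  · linear_combination i₀ - hw₀₂
  · linear_combination f₀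
  · linear_combination i₁ - hw₁₂
  · linear_combination f₁
  · linear_combination f₂

theorem poly_eq_sum_X_mul {n : ℤ} {p : MvPolynomial (Fin 4) k} (hp : p ∈ poly k n)
    (h : constantCoeff p = 0) : ∃ y₀ ∈ poly k (n - 1), ∃ y₁ ∈ poly k (n - 1),
    ∃ y₂ ∈ poly k (n - 1), ∃ y₃ ∈ poly k (n - 1),
      p = X 0 * y₀ + X 1 * y₁ + X 2 * y₂ + X 3 * y₃ := by
  have key : ∃ y : Fin 4 → MvPolynomial (Fin 4) k, (∀ i, y i ∈ poly k (n - 1)) ∧ ∃ c,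
      p = ∑ i, X i * y i + C c := by
    refine poly_induction (motive := fun n p => ∃ y : Fin 4 → MvPolynomial (Fin 4) k,
      (∀ i, y i ∈ poly k (n - 1)) ∧ ∃ c, p = ∑ i, X i * y i + C c) ?_ ?_ ?_ ?_ hp
    · exact fun n => ⟨0, fun i => zero_mem _, 0, by simp⟩
    · exact fun c => ⟨0, fun i => zero_mem _, c, by simp⟩
    · rintro n p q _ _ ⟨y, hy, c, rfl⟩ ⟨y', hy', c', rfl⟩
      exact ⟨y + y', fun i => add_mem (hy i) (hy' i), c + c', by
        simp only [Pi.add_apply, mul_add, Finset.sum_add_distrib, map_add]; ring⟩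
    · intro l n p hp _
      refine ⟨Pi.single l p, fun i => ?_, 0, ?_⟩
      · rw [add_sub_cancel_right]
        by_cases h : i = l
        · subst h; simpa using hp
        · rw [Pi.single_eq_of_ne h]; exact zero_mem _
      · rw [Finset.sum_eq_single l]
        · simp
        · intro i _ hi; rw [Pi.single_eq_of_ne hi, mul_zero]
        · simp
  obtain ⟨y, hy, c, rfl⟩ := key
  refine ⟨y 0, hy 0, y 1, hy 1, y 2, hy 2, y 3, hy 3, ?_⟩
  have hc : c = 0 := by simpa [map_sum] using h
  rw [hc, Fin.sum_univ_four, map_zero, add_zero]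

section free
variable {r : ℕ} {d : Fin r → ℤ}

theorem free_koszul_one (v w y : ℤ) (hw : v + 1 = w) (hy : w + 1 = y)
    (y₀ y₁ y₂ y₃ : (free (k := k) d).obj w)
    (h : (free d).X 0 w y hy y₀ + (free d).X 1 w y hy y₁ + (free d).X 2 w y hy y₂ +
      (free d).X 3 w y hy y₃ = 0) :
    ∃ z₀₁ z₀₂ z₀₃ z₁₂ z₁₃ z₂₃ : (free (k := k) d).obj v,
      y₀ = (free d).X 1 v w hw z₀₁ + (free d).X 2 v w hw z₀₂ + (free d).X 3 v w hw z₀₃ ∧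
      y₁ = -(free d).X 0 v w hw z₀₁ + (free d).X 2 v w hw z₁₂ + (free d).X 3 v w hw z₁₃ ∧
      y₂ = -(free d).X 0 v w hw z₀₂ - (free d).X 1 v w hw z₁₂ + (free d).X 3 v w hw z₂₃ ∧
      y₃ = -(free d).X 0 v w hw z₀₃ - (free d).X 1 v w hw z₁₃ - (free d).X 2 v w hw z₂₃ := by
  subst hw
  have key := fun a => poly_koszul_one (y₀ a).2 (y₁ a).2 (y₂ a).2
    (y₃ := (y₃ a : poly k (v + 1 - d a)).1) (congrArg Subtype.val (congrFun h a))
  have e : ∀ a, v + 1 - d a - 1 = v - d a := fun a => by ring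
  simp only [e] at key
  choose z₀₁ m₀₁ z₀₂ m₀₂ z₀₃ m₀₃ z₁₂ m₁₂ z₁₃ m₁₃ z₂₃ m₂₃ h₀ h₁ h₂ h₃ using key
  exact ⟨fun a => ⟨_, m₀₁ a⟩, fun a => ⟨_, m₀₂ a⟩, fun a => ⟨_, m₀₃ a⟩, fun a => ⟨_, m₁₂ a⟩,
    fun a => ⟨_, m₁₃ a⟩, fun a => ⟨_, m₂₃ a⟩, free_ext d h₀, free_ext d h₁, free_ext d h₂,
    free_ext d h₃⟩

theorem free_koszul_two (v w y : ℤ) (hw : v + 1 = w) (hy : w + 1 = y)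
    (z₀₁ z₀₂ z₀₃ z₁₂ z₁₃ z₂₃ : (free (k := k) d).obj w)
    (e₀ : (free d).X 1 w y hy z₀₁ + (free d).X 2 w y hy z₀₂ + (free d).X 3 w y hy z₀₃ = 0)
    (e₁ : -(free d).X 0 w y hy z₀₁ + (free d).X 2 w y hy z₁₂ + (free d).X 3 w y hy z₁₃ = 0)
    (e₂ : -(free d).X 0 w y hy z₀₂ - (free d).X 1 w y hy z₁₂ + (free d).X 3 w y hy z₂₃ = 0) :
    ∃ a₀ a₁ a₂ a₃ : (free (k := k) d).obj v,
      z₀₁ = (free d).X 2 v w hw a₃ + (free d).X 3 v w hw a₂ ∧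
      z₀₂ = -(free d).X 1 v w hw a₃ + (free d).X 3 v w hw a₁ ∧
      z₀₃ = -(free d).X 1 v w hw a₂ - (free d).X 2 v w hw a₁ ∧
      z₁₂ = (free d).X 0 v w hw a₃ + (free d).X 3 v w hw a₀ ∧
      z₁₃ = (free d).X 0 v w hw a₂ - (free d).X 2 v w hw a₀ ∧
      z₂₃ = (free d).X 0 v w hw a₁ + (free d).X 1 v w hw a₀ := by
  subst hw
  have key := fun a => poly_koszul_two (z₀₁ a).2 (z₀₂ a).2 (z₁₂ a).2
    (z₀₃ := (z₀₃ a : poly k (v + 1 - d a)).1) (z₁₃ := (z₁₃ a : poly k (v + 1 - d a)).1)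
    (z₂₃ := (z₂₃ a : poly k (v + 1 - d a)).1) (congrArg Subtype.val (congrFun e₀ a))
    (congrArg Subtype.val (congrFun e₁ a)) (congrArg Subtype.val (congrFun e₂ a))
  have e : ∀ a, v + 1 - d a - 1 = v - d a := fun a => by ring
  simp only [e] at key
  choose a₀ m₀ a₁ m₁ a₂ m₂ a₃ m₃ h₁ h₂ h₃ h₄ h₅ h₆ using key
  exact ⟨fun a => ⟨_, m₀ a⟩, fun a => ⟨_, m₁ a⟩, fun a => ⟨_, m₂ a⟩, fun a => ⟨_, m₃ a⟩,
    free_ext d h₁, free_ext d h₂, free_ext d h₃, free_ext d h₄, free_ext d h₅, free_ext d h₆⟩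

theorem free_eq_sum_X (v w : ℤ) (hw : v + 1 = w) (x : (free (k := k) d).obj w)
    (h : ∀ a, constantCoeff ((x a : poly k (w - d a)) : MvPolynomial (Fin 4) k) = 0) :
    ∃ y₀ y₁ y₂ y₃ : (free (k := k) d).obj v,
      x = (free d).X 0 v w hw y₀ + (free d).X 1 v w hw y₁ + (free d).X 2 v w hw y₂ +
        (free d).X 3 v w hw y₃ := by
  subst hw
  have key := fun a => poly_eq_sum_X_mul (x a).2 (h a)
  have e : ∀ a, v + 1 - d a - 1 = v - d a := fun a => by ring
  simp only [e] at key
  choose y₀ m₀ y₁ m₁ y₂ m₂ y₃ m₃ h using key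
  exact ⟨fun a => ⟨_, m₀ a⟩, fun a => ⟨_, m₁ a⟩, fun a => ⟨_, m₂ a⟩, fun a => ⟨_, m₃ a⟩,
    free_ext d h⟩

theorem free_eq_zero {v : ℤ} (hv : ∀ a, v < d a) (x : (free (k := k) d).obj v) : x = 0 := by
  refine free_ext d fun a => ?_
  have h := (x a).2
  change ((x a : poly k (v - d a)) : MvPolynomial (Fin 4) k) = 0
  rw [← support_eq_empty, Finset.eq_empty_iff_forall_notMem]
  intro m hm
  have h1 := h m hm
  have h2 := hv a
  omega
end free

/-- Exactness of the Koszul complex at the last but one place: this is the condition of depth at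
least two, given that of depth at least one. -/
def KoszulExact (N : GrMod k) : Prop :=
  ∀ (v w y : ℤ) (hw : v + 1 = w) (hy : w + 1 = y) (f₀ f₁ f₂ f₃ : N.obj w),
    N.X 0 w y hy f₁ = N.X 1 w y hy f₀ → N.X 0 w y hy f₂ = N.X 2 w y hy f₀ →
    N.X 0 w y hy f₃ = N.X 3 w y hy f₀ → N.X 1 w y hy f₂ = N.X 2 w y hy f₁ →
    N.X 1 w y hy f₃ = N.X 3 w y hy f₁ → N.X 2 w y hy f₃ = N.X 3 w y hy f₂ →
    ∃ u : N.obj v, f₀ = N.X 0 v w hw u ∧ f₁ = N.X 1 v w hw u ∧ f₂ = N.X 2 v w hw u ∧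
      f₃ = N.X 3 v w hw u

variable {F : GrMod k} (P : GrMod.MinimalFreeResolution F)

set_option maxHeartbeats 800000 in
-- This is the vanishing of Tor_3(F, k), computed by zigzag in the double complex of the resolution
-- and the Koszul complex. By minimality x = Σ X_i y_i, and one descends through P_1 and P_0 to a
-- Koszul cycle in F. It is a boundary by hypothesis. Climbing back, each correction makes the next
-- element liftable, until y differs from a Koszul boundary by an element of the kernel in degree v
-- - 1, which is zero by induction. Then x is a Koszul boundary of a boundary.
theorem d_one_eq_zero (hF : KoszulExact F) (v : ℤ)
    (ih : ∀ y : (free (P.deg 2)).obj (v - 1), (P.d 1).1 (v - 1) y = 0 → y = 0)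
    (x : (free (P.deg 2)).obj v) (hx : (P.d 1).1 v x = 0) : x = 0 := by
  have h43 : v - 4 + 1 = v - 3 := by ring
  have h32 : v - 3 + 1 = v - 2 := by ring
  have h21 : v - 2 + 1 = v - 1 := by ring
  have h10 : v - 1 + 1 = v := by ring
  obtain ⟨t, rfl⟩ := (P.exact_succ 1 v x).1 hx
  obtain ⟨y₀, y₁, y₂, y₃, hy⟩ := free_eq_sum_X (v - 1) v h10 ((P.d 2).1 v t) (P.minimal 2 v t)
  rw [hy] at hx ⊢
  have hd := (P.d 1).2
  have hd0 := (P.d 0).2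
  have hε := P.ε.2
  simp only [map_add, hd _ _ _ h10] at hx
  obtain ⟨z₀₁, z₀₂, z₀₃, z₁₂, z₁₃, z₂₃, k₀, k₁, k₂, k₃⟩ :=
    free_koszul_one (v - 2) (v - 1) v h21 h10 _ _ _ _ hx
  have hdd : ∀ y, (P.d 0).1 (v - 1) ((P.d 1).1 (v - 1) y) = 0 := fun y =>
    (P.exact_succ 0 _).apply_apply_eq_zero y
  have l₀ := congrArg ((P.d 0).1 (v - 1)) k₀
  have l₁ := congrArg ((P.d 0).1 (v - 1)) k₁
  have l₂ := congrArg ((P.d 0).1 (v - 1)) k₂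
  simp only [map_add, map_sub, map_neg, hd0 _ _ _ h21, hdd] at l₀ l₁ l₂
  obtain ⟨a₀, a₁, a₂, a₃, m₁, m₂, m₃, m₄, m₅, m₆⟩ :=
    free_koszul_two (v - 3) (v - 2) (v - 1) h32 h21 _ _ _ _ _ _ l₀.symm l₁.symm l₂.symm
  have hεd : ∀ y, P.ε.1 (v - 2) ((P.d 0).1 (v - 2) y) = 0 := fun y =>
    (P.exact_zero _).apply_apply_eq_zero y
  have n₁ := congrArg (P.ε.1 (v - 2)) m₁
  have n₂ := congrArg (P.ε.1 (v - 2)) m₂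
  have n₃ := congrArg (P.ε.1 (v - 2)) m₃
  have n₄ := congrArg (P.ε.1 (v - 2)) m₄
  have n₅ := congrArg (P.ε.1 (v - 2)) m₅
  have n₆ := congrArg (P.ε.1 (v - 2)) m₆
  simp only [map_add, map_sub, map_neg, hε _ _ _ h32, hεd] at n₁ n₂ n₃ n₄ n₅ n₆
  -- The alternating signs turn the Koszul relations of the a_i, indexed by the omitted variable,
  -- into the symmetric conditions X_i f_j = X_j f_i.
  obtain ⟨u, u₀, u₁, u₂, u₃⟩ := hF (v - 4) (v - 3) (v - 2) h43 h32
    (P.ε.1 _ a₀) (-P.ε.1 _ a₁) (P.ε.1 _ a₂) (-P.ε.1 _ a₃)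
    (by rw [map_neg, neg_eq_iff_add_eq_zero]; exact n₆.symm)
    (sub_eq_zero.1 n₅.symm)
    (by rw [map_neg, neg_eq_iff_add_eq_zero]; exact n₄.symm)
    (by rw [map_neg, eq_comm, ← sub_eq_zero, n₃]; abel)
    (by rw [map_neg, map_neg, ← sub_eq_zero, n₂]; abel)
    (by rw [map_neg, neg_eq_iff_add_eq_zero]; exact n₁.symm)
  obtain ⟨u, rfl⟩ := P.surjective _ u
  have ht : ∀ a, P.ε.1 (v - 3) a = 0 → ∃ t, (P.d 0).1 (v - 3) t = a := fun a h => (P.exact_zero _ a).1 h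
  -- The way back: subtracting the boundary of the lift of u puts each a_i into the kernel of ε,
  -- hence into the image of P_1.
  obtain ⟨t₀, ht₀⟩ := ht (a₀ - (free (P.deg 0)).X 0 _ _ h43 u) (by
    rw [map_sub, hε _ _ _ h43, u₀, sub_self])
  obtain ⟨t₁, ht₁⟩ := ht (a₁ + (free (P.deg 0)).X 1 _ _ h43 u) (by
    rw [map_add, hε _ _ _ h43, ← u₁, add_neg_cancel])
  obtain ⟨t₂, ht₂⟩ := ht (a₂ - (free (P.deg 0)).X 2 _ _ h43 u) (by
    rw [map_sub, hε _ _ _ h43, u₂, sub_self])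
  obtain ⟨t₃, ht₃⟩ := ht (a₃ + (free (P.deg 0)).X 3 _ _ h43 u) (by
    rw [map_add, hε _ _ _ h43, ← u₃, add_neg_cancel])
  have hs : ∀ z, (P.d 0).1 (v - 2) z = 0 → ∃ s, (P.d 1).1 (v - 2) s = z := fun z h =>
    (P.exact_succ 0 _ z).1 h
  have hc := fun l m => (free (k := k) (P.deg 0)).X_comm l m _ _ _ h43 h32
  have hc1 := fun l m => (free (k := k) (P.deg 1)).X_comm l m _ _ _ h32 h21
  have hc2 := fun l m => (free (k := k) (P.deg 2)).X_comm l m _ _ _ h21 h10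
  -- Likewise, subtracting the boundary of t from z gives elements in the image of P_2.
  obtain ⟨s₀₁, p₀₁⟩ := hs (z₀₁ - ((free (P.deg 1)).X 2 _ _ h32 t₃ + (free (P.deg 1)).X 3 _ _ h32 t₂)) (by
    rw [map_sub, m₁, map_add, hd0 2 _ _ h32 t₃, hd0 3 _ _ h32 t₂, ht₃, ht₂, map_add, map_sub,
      hc 3 2]; abel)
  obtain ⟨s₀₂, p₀₂⟩ := hs (z₀₂ - (-(free (P.deg 1)).X 1 _ _ h32 t₃ + (free (P.deg 1)).X 3 _ _ h32 t₁)) (by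
    rw [map_sub, m₂, map_add, map_neg, hd0 1 _ _ h32 t₃, hd0 3 _ _ h32 t₁, ht₃, ht₁, map_add,
      map_add, hc 3 1]; abel)
  obtain ⟨s₀₃, p₀₃⟩ := hs (z₀₃ - (-(free (P.deg 1)).X 1 _ _ h32 t₂ - (free (P.deg 1)).X 2 _ _ h32 t₁)) (by
    rw [map_sub, m₃, map_sub, map_neg, hd0 1 _ _ h32 t₂, hd0 2 _ _ h32 t₁, ht₂, ht₁, map_add,
      map_sub, hc 2 1]; abel)
  obtain ⟨s₁₂, p₁₂⟩ := hs (z₁₂ - ((free (P.deg 1)).X 0 _ _ h32 t₃ + (free (P.deg 1)).X 3 _ _ h32 t₀)) (by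
    rw [map_sub, m₄, map_add, hd0 0 _ _ h32 t₃, hd0 3 _ _ h32 t₀, ht₃, ht₀, map_add, map_sub,
      hc 3 0]; abel)
  obtain ⟨s₁₃, p₁₃⟩ := hs (z₁₃ - ((free (P.deg 1)).X 0 _ _ h32 t₂ - (free (P.deg 1)).X 2 _ _ h32 t₀)) (by
    rw [map_sub, m₅, map_sub, hd0 0 _ _ h32 t₂, hd0 2 _ _ h32 t₀, ht₂, ht₀, map_sub, map_sub,
      hc 2 0]; abel)
  obtain ⟨s₂₃, p₂₃⟩ := hs (z₂₃ - ((free (P.deg 1)).X 0 _ _ h32 t₁ + (free (P.deg 1)).X 1 _ _ h32 t₀)) (by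
    rw [map_sub, m₆, map_add, hd0 0 _ _ h32 t₁, hd0 1 _ _ h32 t₀, ht₁, ht₀, map_add, map_sub,
      hc 1 0]; abel)
  rw [eq_sub_iff_add_eq] at p₀₁ p₀₂ p₀₃ p₁₂ p₁₃ p₂₃
  -- Subtracting the boundary of s from y leaves elements of the kernel in degree v - 1, where the
  -- induction hypothesis applies.
  have q₀ := sub_eq_zero.1 (ih (y₀ - ((free (P.deg 2)).X 1 _ _ h21 s₀₁ + (free (P.deg 2)).X 2 _ _ h21 s₀₂ + (free (P.deg 2)).X 3 _ _ h21 s₀₃)) (by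
    rw [map_sub, k₀, map_add, map_add, hd 1 _ _ h21 s₀₁, hd 2 _ _ h21 s₀₂, hd 3 _ _ h21 s₀₃,
      ← p₀₁, ← p₀₂, ← p₀₃]
    simp only [map_add, map_sub, map_neg, hc1 2 1, hc1 3 1, hc1 3 2]
    abel))
  have q₁ := sub_eq_zero.1 (ih (y₁ - (-(free (P.deg 2)).X 0 _ _ h21 s₀₁ + (free (P.deg 2)).X 2 _ _ h21 s₁₂ + (free (P.deg 2)).X 3 _ _ h21 s₁₃)) (by
    rw [map_sub, k₁, map_add, map_add, map_neg, hd 0 _ _ h21 s₀₁, hd 2 _ _ h21 s₁₂,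
      hd 3 _ _ h21 s₁₃, ← p₀₁, ← p₁₂, ← p₁₃]
    simp only [map_add, map_sub, hc1 2 0, hc1 3 0, hc1 3 2]
    abel))
  have q₂ := sub_eq_zero.1 (ih (y₂ - (-(free (P.deg 2)).X 0 _ _ h21 s₀₂ - (free (P.deg 2)).X 1 _ _ h21 s₁₂ + (free (P.deg 2)).X 3 _ _ h21 s₂₃)) (by
    rw [map_sub, k₂, map_add, map_sub, map_neg, hd 0 _ _ h21 s₀₂, hd 1 _ _ h21 s₁₂,
      hd 3 _ _ h21 s₂₃, ← p₀₂, ← p₁₂, ← p₂₃]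
    simp only [map_add, map_neg, hc1 1 0, hc1 3 0, hc1 3 1]
    abel))
  have q₃ := sub_eq_zero.1 (ih (y₃ - (-(free (P.deg 2)).X 0 _ _ h21 s₀₃ - (free (P.deg 2)).X 1 _ _ h21 s₁₃ - (free (P.deg 2)).X 2 _ _ h21 s₂₃)) (by
    rw [map_sub, k₃, map_sub, map_sub, map_neg, hd 0 _ _ h21 s₀₃, hd 1 _ _ h21 s₁₃,
      hd 2 _ _ h21 s₂₃, ← p₀₃, ← p₁₃, ← p₂₃]
    simp only [map_add, map_sub, map_neg, hc1 1 0, hc1 2 0, hc1 2 1]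
    abel))
  rw [q₀, q₁, q₂, q₃]
  simp only [map_add, map_sub, map_neg, hc2 1 0, hc2 2 0, hc2 3 0, hc2 2 1, hc2 3 1, hc2 3 2]
  abel

/-- A module of depth at least two has projective dimension at most two. -/
theorem d_one_injective (hF : KoszulExact F) (v : ℤ) :
    Function.Injective ((P.d 1).1 v) := by
  rw [injective_iff_map_eq_zero]
  -- A degree below all generators of P_2, where P_2 vanishes; the induction on the degree starts
  -- there.
  obtain ⟨b, hb⟩ : ∃ b, ∀ a, b < P.deg 2 a :=
    ⟨(∑ a, -|P.deg 2 a|) - 1, fun a => by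
      have h1 := Finset.single_le_sum (f := fun a => |P.deg 2 a|) (fun i _ => abs_nonneg _)
        (Finset.mem_univ a)
      have h2 := neg_abs_le (P.deg 2 a)
      rw [Finset.sum_neg_distrib]
      linarith⟩
  rcases le_total v b with hv | hv
  · exact fun x _ => free_eq_zero (fun a => hv.trans_lt (hb a)) x
  · induction v, hv using Int.leInduction with
    | base => exact fun x _ => free_eq_zero hb x
    | succ n _ ih =>
      refine d_one_eq_zero P hF _ ?_
      rw [add_sub_cancel_right]
      exact ih

end P3

end

/-! ### Nonvanishing loci of the coordinate ratios -/

noncomputable section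
universe u
open AlgebraicGeometry CategoryTheory TopologicalSpace
namespace P3
attribute [local instance] MvPolynomial.gradedAlgebra
variable {k : Type u} [Field k]

/-- At a point where X_j / X_i is invertible, the fraction is a unit in the localization at the
corresponding prime, so X_j is not in the prime. -/
theorem basicOpen_ratio_le (i j : Fin 4) (U : (space k).Opens) (hU : U ≤ chart k i) :
    (space k).basicOpen (ratio i j U hU) ≤ chart k j := by
  intro x hx
  have hu := RingedSpace.isUnit_res_basicOpen _ (ratio i j U hU)
  set W := (space k).basicOpen (ratio i j U hU) with hW
  have hWU : W ≤ U := (space k).basicOpen_le _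
  change IsUnit ((space k).presheaf.map (homOfLE hWU).op (ratio i j U hU)) at hu
  rw [ratio_res] at hu
  obtain ⟨g, hg⟩ := hu.exists_right_inv
  intro hxj
  have h1 := congr(($hg).val ⟨x, hx⟩)
  have h2 : (ratio i j W (hWU.trans hU)).val ⟨x, hx⟩ * g.val ⟨x, hx⟩ = 1 := h1
  have h3 := IsUnit.of_mul_eq_one _ h2
  rw [← HomogeneousLocalization.isUnit_iff_isUnit_val] at h3
  have h4 := ProjectiveSpectrum.Proj.awayToSection_apply (gr k) (MvPolynomial.X i) (HomogeneousLocalization.Away.mk (gr k) (X_mem k i) 1 (MvPolynomial.X j) (X_mem' k j)) ⟨x, (hWU.trans hU) hx⟩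
  have h5 : (ratio i j W (hWU.trans hU)).val ⟨x, hx⟩ = ((ProjectiveSpectrum.Proj.awayToSection (gr k)
    (MvPolynomial.X i)).1 (HomogeneousLocalization.Away.mk (gr k) (X_mem k i) 1 (MvPolynomial.X j)
      (X_mem' k j))).val ⟨x, (hWU.trans hU) hx⟩ := rfl
  rw [h5, h4] at h3
  rw [HomogeneousLocalization.Away.mk, HomogeneousLocalization.val_mk, Localization.mk_eq_mk',
    IsLocalization.map_mk'] at h3
  have : (ProjectiveSpectrum.asHomogeneousIdeal (𝒜 := gr k) x).toIdeal.IsPrime := x.isPrime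
  exact (IsLocalization.AtPrime.isUnit_mk'_iff _
    (ProjectiveSpectrum.asHomogeneousIdeal (𝒜 := gr k) x).toIdeal _ _).1 h3 hxj

/-- This makes intersecting with a further chart a basic open inside an affine open, to which the
extension lemmas for quasi-coherent sheaves apply. -/
theorem basicOpen_ratio (i j : Fin 4) (U : (space k).Opens) (hU : U ≤ chart k i) :
    (space k).basicOpen (ratio i j U hU) = U ⊓ chart k j := by
  apply le_antisymm (le_inf ((space k).basicOpen_le _) (basicOpen_ratio_le i j U hU))
  have h := (space k).basicOpen_of_isUnit (ratioUnit i j (U ⊓ chart k j) (inf_le_left.trans hU)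
    inf_le_right).isUnit
  rw [show ((ratioUnit i j (U ⊓ chart k j) (inf_le_left.trans hU) inf_le_right : Γ(space k, _)ˣ) :
    Γ(space k, U ⊓ chart k j)) = (space k).presheaf.map (homOfLE inf_le_left).op (ratio i j U hU) from
    (ratio_res i j inf_le_left hU).symm, Scheme.basicOpen_res] at h
  exact h.ge.trans inf_le_right

theorem isAffineOpen_chart (i : Fin 4) : IsAffineOpen (chart k i) :=
  Proj.isAffineOpen_basicOpen (gr k) _ (X_mem k i) one_pos

end P3

end

/-! ### Localization of graded modules at a set of variables -/

noncomputable section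
universe u
namespace P3
variable {k : Type u} [Field k]
open MvPolynomial
open GrMod (poly hom homDeg free X_mul_mem_poly)

/-- The monic monomials of degree `n` in the variables `X_i`, `i ∈ S`. -/
inductive MonIn (S : Set (Fin 4)) : ℕ → MvPolynomial (Fin 4) k → Prop
  | one : MonIn S 0 1
  | X_mul {i : Fin 4} (hi : i ∈ S) {n : ℕ} {p : MvPolynomial (Fin 4) k} (hp : MonIn S n p) :
      MonIn S (n + 1) (X i * p)

namespace MonIn
variable {S T : Set (Fin 4)} {n m : ℕ} {p q : MvPolynomial (Fin 4) k}

theorem mem_poly (hp : MonIn S n p) : p ∈ poly k n := by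
  induction hp with
  | one => exact one_mem_poly
  | X_mul hi _ ih => exact X_mul_mem_poly _ (by push_cast; rfl) ih

theorem mono (h : S ⊆ T) (hp : MonIn S n p) : MonIn T n p := by
  induction hp with
  | one => exact one
  | X_mul hi _ ih => exact X_mul (h hi) ih

theorem mul (hp : MonIn S n p) (hq : MonIn S m q) : MonIn S (n + m) (p * q) := by
  induction hp with
  | one => rwa [zero_add, one_mul]
  | X_mul hi _ ih => rw [mul_assoc, add_right_comm]; exact X_mul hi ih

theorem X_pow {i : Fin 4} (hi : i ∈ S) (n : ℕ) : MonIn S n ((X i : MvPolynomial (Fin 4) k) ^ n) := by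
  induction n with
  | zero => rw [pow_zero]; exact one
  | succ n ih => rw [pow_succ']; exact X_mul hi ih

theorem prod_X_pow {s : Finset (Fin 4)} (hs : (s : Set (Fin 4)) ⊆ S) (n : ℕ) :
    MonIn S (s.card * n) (∏ i ∈ s, (X i : MvPolynomial (Fin 4) k) ^ n) := by
  classical
  induction s using Finset.induction_on with
  | empty => simpa using one
  | insert i s hi ih =>
    rw [Finset.coe_insert, Set.insert_subset_iff] at hs
    rw [Finset.prod_insert hi, Finset.card_insert_of_notMem hi, add_mul, one_mul, add_comm]
    exact (X_pow hs.1 n).mul (ih hs.2)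
end MonIn

/-- Here p must be homogeneous of the exact degree, because the right side passes through the single
intermediate degree w. -/
theorem pmul_mul {N : GrMod k} {m v w : ℤ} (hw : v + m = w) (y : ℤ) {p : MvPolynomial (Fin 4) k}
    (hp : p ∈ poly k m) (q : MvPolynomial (Fin 4) k) (x : N.obj v) :
    pmul N v y (q * p) x = pmul N w y q (pmul N v w p x) := by
  refine poly_induction (motive := fun m p => ∀ w, v + m = w → ∀ q, pmul N v y (q * p) x =
    pmul N w y q (pmul N v w p x)) ?_ ?_ ?_ ?_ hp w hw q
  · intro m w _ q; simp
  · intro c w hw q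
    obtain rfl : v = w := by omega
    rw [pmul_C, map_smul, mul_comm, C_mul', map_smul, LinearMap.smul_apply]
  · intro m p p' _ _ h h' w hw q
    rw [mul_add, map_add, LinearMap.add_apply, h w hw, h' w hw, map_add, LinearMap.add_apply, map_add]
  · intro l m p _ h w hw q
    rw [pmul_X_mul l v (v + m) w (by omega), pmul_X, ← h _ rfl]
    congr 2
    ring

theorem X_pmul {N : GrMod k} (l : Fin 4) {v v' w w' : ℤ} (hv : v + 1 = v') (hw : w + 1 = w')
    (p : MvPolynomial (Fin 4) k) (x : N.obj v) :
    pmul N v' w' p (N.X l v v' hv x) = N.X l w w' hw (pmul N v w p x) := by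
  rw [pmul_X, pmul_X_mul l v w w' hw]

/-- The variables `X_i`, `i ∈ S`, act bijectively on `L`. -/
def InvOn (S : Set (Fin 4)) (L : GrMod k) : Prop :=
  ∀ i ∈ S, ∀ v w hw, Function.Bijective (L.X i v w hw)

theorem InvOn.bijective {S : Set (Fin 4)} {L : GrMod k} (h : InvOn S L) {n : ℕ}
    {p : MvPolynomial (Fin 4) k} (hp : MonIn S n p) {v w : ℤ} (hw : v + n = w) :
    Function.Bijective (pmul L v w p) := by
  induction hp generalizing w with
  | one =>
    obtain rfl : v = w := by simpa using hw
    have : pmul L v v 1 = LinearMap.id := LinearMap.ext fun x => pmul_one v x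
    rw [this]; exact Function.bijective_id
  | @X_mul i hi n p hp ih =>
    push_cast at hw
    have : ⇑(pmul L v w (X i * p)) = L.X i (v + n) w (by omega) ∘ pmul L v (v + n) p :=
      funext fun x => pmul_X_mul _ _ _ _ _ _ _
    rw [this]
    exact (h i hi _ _ _).comp (ih rfl)

variable {N L : GrMod k}

/-- `L` is the localization of `N` at the variables `X_i`, `i ∈ S`. -/
structure IsLoc (S : Set (Fin 4)) (ι : hom N L) : Prop where
  inv : InvOn S L
  surj : ∀ v (t : L.obj v), ∃ n p, MonIn S n p ∧ ∃ w, ∃ (_ : v + n = w) (s : N.obj w),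
    ι.1 w s = pmul L v w p t
  ker : ∀ v (s : N.obj v), ι.1 v s = 0 → ∃ n p, MonIn S n p ∧ ∃ w, ∃ (_ : v + n = w),
    pmul N v w p s = 0

/-- The universal property of localization. The map is built from its graph, to avoid choosing
denominators in a linear way. -/
theorem IsLoc.exists_extension {S : Set (Fin 4)} {ι : hom N L} (h : IsLoc S ι) {L' : GrMod k}
    (hL' : InvOn S L') (φ : hom N L') : ∃ ψ : hom L L', ∀ v s, ψ.1 v (ι.1 v s) = φ.1 v s := by
  -- Pairs (t, t') that a common denominator p sends to the two images of the same s. The relation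
  -- is total because fractions fill L, and single-valued because p is invertible on L'.
  let W : ∀ v, Submodule k (L.obj v × L'.obj v) := fun v =>
    { carrier := {t | ∃ n p, MonIn S n p ∧ ∃ w, ∃ (_ : v + n = w) (s : N.obj w),
        ι.1 w s = pmul L v w p t.1 ∧ φ.1 w s = pmul L' v w p t.2}
      zero_mem' := ⟨0, 1, .one, v, by simp, 0, by simp, by simp⟩
      add_mem' := by
        rintro t t' ⟨n, p, hp, w, hw, s, h₁, h₂⟩ ⟨m, q, hq, w', hw', s', h₁', h₂'⟩
        refine ⟨n + m, p * q, hp.mul hq, v + n + m, by push_cast; ring,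
          pmul N w _ q s + pmul N w' _ p s', ?_, ?_⟩
        · rw [map_add, map_pmul ι.2, map_pmul ι.2, h₁, h₁', Prod.fst_add, map_add,
            ← pmul_mul hw' _ hq.mem_poly, ← pmul_mul hw _ hp.mem_poly, mul_comm q p]
        · rw [map_add, map_pmul φ.2, map_pmul φ.2, h₂, h₂', Prod.snd_add, map_add,
            ← pmul_mul hw' _ hq.mem_poly, ← pmul_mul hw _ hp.mem_poly, mul_comm q p]
      smul_mem' := by
        rintro c t ⟨n, p, hp, w, hw, s, h₁, h₂⟩
        exact ⟨n, p, hp, w, hw, c • s, by rw [map_smul, h₁, Prod.smul_fst, map_smul],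
          by rw [map_smul, h₂, Prod.smul_snd, map_smul]⟩ }
  have hsurj : ∀ v t, ∃ t', (t, t') ∈ W v := fun v t => by
    obtain ⟨n, p, hp, w, hw, s, hs⟩ := h.surj v t
    obtain ⟨t', ht'⟩ := (hL'.bijective hp hw).2 (φ.1 w s)
    exact ⟨t', n, p, hp, w, hw, s, hs, ht'.symm⟩
  have hzero : ∀ v t', ((0, t') : L.obj v × L'.obj v) ∈ W v → t' = 0 := by
    rintro v t' ⟨n, p, hp, w, hw, s, h₁, h₂⟩
    obtain ⟨m, q, hq, w', hw', hs⟩ := h.ker w s (by rw [h₁, map_zero])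
    apply (hL'.bijective (hq.mul hp) (w := w') (by push_cast; omega)).1
    rw [pmul_mul hw _ hp.mem_poly, ← h₂, ← map_pmul φ.2, hs, map_zero, map_zero]
  have hν : ∀ v, ∃ ν : L.obj v →ₗ[k] L'.obj v, ∀ t t', (t, t') ∈ W v → ν t = t' := fun v => by
    obtain ⟨ν, hν⟩ := exists_comp_eq_of_ker_le ((LinearMap.fst k _ _).comp (W v).subtype)
      ((LinearMap.snd k _ _).comp (W v).subtype) (by
        rintro ⟨⟨t, t'⟩, ht⟩ h0
        obtain rfl : t = 0 := h0
        exact hzero v t' ht)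
    exact ⟨ν, fun t t' ht => LinearMap.congr_fun hν ⟨(t, t'), ht⟩⟩
  choose ν hν using hν
  refine ⟨⟨ν, fun l v w hw t => ?_⟩, fun v s => hν _ _ _ ⟨0, 1, .one, v, by simp, s, ?_, ?_⟩⟩
  · obtain ⟨t', ht'⟩ := hsurj v t
    rw [hν v t t' ht']
    apply hν
    obtain ⟨n, p, hp, y, hy, s, h₁, h₂⟩ := ht'
    refine ⟨n, p, hp, y + 1, by omega, N.X l y _ rfl s, ?_, ?_⟩
    · rw [ι.2 l y _ rfl, h₁]; exact (X_pmul l hw rfl p t).symm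
    · rw [φ.2 l y _ rfl, h₂]; exact (X_pmul l hw rfl p t').symm
  · rw [pmul_one]
  · rw [pmul_one]

theorem IsLoc.hom_ext {S : Set (Fin 4)} {ι : hom N L} (h : IsLoc S ι) {L' : GrMod k}
    (hL' : InvOn S L') {ψ ψ' : hom L L'} (hψ : ∀ v s, ψ.1 v (ι.1 v s) = ψ'.1 v (ι.1 v s))
    (v : ℤ) (t : L.obj v) : ψ.1 v t = ψ'.1 v t := by
  obtain ⟨n, p, hp, w, hw, s, hs⟩ := h.surj v t
  apply (hL'.bijective hp hw).1
  rw [← map_pmul ψ.2, ← map_pmul ψ'.2, ← hs, hψ]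

variable {N₁ N₀ L₁ L₀ : GrMod k} {S : Set (Fin 4)} {ι : hom N L} {ι₀ : hom N₀ L₀} {ι₁ : hom N₁ L₁}

theorem IsLoc.surjective (h : IsLoc S ι) (h₀ : IsLoc S ι₀) (φ : hom N₀ N) (ψ : hom L₀ L)
    (hψ : ∀ v s, ψ.1 v (ι₀.1 v s) = ι.1 v (φ.1 v s)) (hφ : ∀ v, Function.Surjective (φ.1 v)) (v : ℤ) :
    Function.Surjective (ψ.1 v) := by
  intro t
  obtain ⟨n, p, hp, w, hw, s, hs⟩ := h.surj v t
  obtain ⟨s, rfl⟩ := hφ w s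
  obtain ⟨t', ht'⟩ := (h₀.inv.bijective hp hw).2 (ι₀.1 w s)
  refine ⟨t', (h.inv.bijective hp hw).1 ?_⟩
  rw [← map_pmul ψ.2, ht', hψ, hs]

/-- Exactness of localization: clear denominators, use exactness upstairs, and divide again. An
element killed only after localization costs one more denominator q. -/
theorem IsLoc.exact (h : IsLoc S ι) (h₀ : IsLoc S ι₀) (h₁ : IsLoc S ι₁)
    (φ : hom N₀ N) (φ₁ : hom N₁ N₀) (ψ : hom L₀ L) (ψ₁ : hom L₁ L₀)
    (hψ : ∀ v s, ψ.1 v (ι₀.1 v s) = ι.1 v (φ.1 v s))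
    (hψ₁ : ∀ v s, ψ₁.1 v (ι₁.1 v s) = ι₀.1 v (φ₁.1 v s))
    (hφ : ∀ v, Function.Exact (φ₁.1 v) (φ.1 v)) (v : ℤ) :
    Function.Exact (ψ₁.1 v) (ψ.1 v) := by
  intro t
  constructor
  · intro ht
    obtain ⟨n, p, hp, w, hw, s, hs⟩ := h₀.surj v t
    obtain ⟨m, q, hq, w', hw', hs'⟩ := h.ker w (φ.1 w s) (by
      rw [← hψ, hs, map_pmul ψ.2, ht, map_zero])
    rw [← map_pmul φ.2] at hs'
    obtain ⟨s₁, hs₁⟩ := (hφ _ _).1 hs'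
    have hw₂ : v + (m + n : ℕ) = w' := by push_cast; omega
    obtain ⟨t₁, ht₁⟩ := (h₁.inv.bijective (hq.mul hp) hw₂).2 (ι₁.1 _ s₁)
    refine ⟨t₁, (h₀.inv.bijective (hq.mul hp) hw₂).1 ?_⟩
    rw [← map_pmul ψ₁.2, ht₁, hψ₁, hs₁, map_pmul ι₀.2, hs, pmul_mul hw _ hp.mem_poly]
  · rintro ⟨t₁, rfl⟩
    obtain ⟨n, p, hp, w, hw, s, hs⟩ := h₁.surj v t₁
    apply (h.inv.bijective hp hw).1
    rw [← map_pmul ψ.2, ← map_pmul ψ₁.2, ← hs, hψ₁, hψ, (hφ _).apply_apply_eq_zero, map_zero,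
      map_zero]

/-- The composition of two homomorphisms. -/
def comp (ψ : hom N₀ N) (φ : hom N₁ N₀) : hom N₁ N :=
  ⟨fun v => (ψ.1 v).comp (φ.1 v), fun l v w hw s => by
    simp only [LinearMap.comp_apply]; rw [φ.2 l v w hw, ψ.2 l v w hw]⟩

theorem comp_apply (ψ : hom N₀ N) (φ : hom N₁ N₀) (v : ℤ) (x : N₁.obj v) :
    (comp ψ φ).1 v x = ψ.1 v (φ.1 v x) := rfl

/-- Localizing in two steps. Invertibility of all variables on the final module is a hypothesis;
here it will come from geometry. -/
theorem IsLoc.comp {T : Set (Fin 4)} {ι₁ : hom N₁ N₀} {ι₀ : hom N₀ N} (h₁ : IsLoc S ι₁)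
    (h₀ : IsLoc T ι₀) (hN : InvOn (S ∪ T) N) : IsLoc (S ∪ T) (comp ι₀ ι₁) where
  inv := hN
  surj v t := by
    obtain ⟨n, p, hp, w, hw, s, hs⟩ := h₀.surj v t
    obtain ⟨m, q, hq, w', hw', s', hs'⟩ := h₁.surj w s
    refine ⟨m + n, q * p, (hq.mono Set.subset_union_left).mul (hp.mono Set.subset_union_right), w',
      by push_cast; omega, s', ?_⟩
    rw [comp_apply, hs', map_pmul ι₀.2, hs, pmul_mul hw _ hp.mem_poly]
  ker v s hs := by
    obtain ⟨n, p, hp, w, hw, hs'⟩ := h₀.ker v _ hs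
    rw [← map_pmul ι₁.2] at hs'
    obtain ⟨m, q, hq, w', hw', hs''⟩ := h₁.ker w _ hs'
    refine ⟨m + n, q * p, (hq.mono Set.subset_union_left).mul (hp.mono Set.subset_union_right), w',
      by push_cast; omega, ?_⟩
    rw [pmul_mul hw _ hp.mem_poly, hs'']

end P3

end

/-! ### Laurent polynomials as localizations of free modules -/

noncomputable section
universe u
namespace P3
variable {k : Type u} [Field k]
open MvPolynomial
open GrMod (poly hom homDeg free X_mul_mem_poly)

/-- Laurent polynomials in four variables. -/
abbrev Lau (k : Type u) [Field k] : Type u := AddMonoidAlgebra k (Fin 4 → ℤ)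

/-- The exponents of monomials, as exponents of Laurent monomials. -/
def castExp : (Fin 4 →₀ ℕ) →+ (Fin 4 → ℤ) where
  toFun m i := m i
  map_zero' := rfl
  map_add' m n := by funext i; simp

theorem castExp_injective : Function.Injective castExp := fun m n h => by
  ext i; exact Int.ofNat_injective (congrFun h i)

theorem exists_castExp {e : Fin 4 → ℤ} (he : ∀ i, 0 ≤ e i) : ∃ m, castExp m = e :=
  ⟨Finsupp.equivFunOnFinite.symm fun i => (e i).toNat, funext fun i => Int.toNat_of_nonneg (he i)⟩

theorem sum_castExp (m : Fin 4 →₀ ℕ) : ∑ i, castExp m i = m.degree := by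
  rw [Finsupp.degree_eq_sum]; push_cast; rfl

/-- Polynomials as Laurent polynomials. -/
def toLau : MvPolynomial (Fin 4) k →ₐ[k] Lau k := AddMonoidAlgebra.mapDomainAlgHom k k castExp

theorem toLau_injective : Function.Injective (toLau (k := k)) :=
  AddMonoidAlgebra.mapDomain_injective castExp_injective

theorem toLau_monomial (m : Fin 4 →₀ ℕ) (c : k) :
    toLau (monomial m c) = AddMonoidAlgebra.single (castExp m) c :=
  AddMonoidAlgebra.mapDomain_single

theorem toLau_X (l : Fin 4) :
    toLau (X l : MvPolynomial (Fin 4) k) = AddMonoidAlgebra.single (Pi.single l 1) 1 := by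
  rw [X, toLau_monomial]
  congr 1
  funext i
  by_cases h : i = l
  · subst h; simp [castExp]
  · simp [castExp, h]

/-- The exponents of total degree `n` that are non-negative outside `S`. -/
def expSet (S : Set (Fin 4)) (n : ℤ) : Set (Fin 4 → ℤ) := {e | ∑ i, e i = n ∧ ∀ j ∉ S, 0 ≤ e j}

/-- Homogeneous Laurent polynomials of degree `n` that are polynomial outside `S`. -/
def lau (k : Type u) [Field k] (S : Set (Fin 4)) (n : ℤ) : Submodule k (Lau k) where
  carrier := {f | ∀ e, f.coeff e ≠ 0 → e ∈ expSet S n}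
  zero_mem' e h := absurd rfl h
  add_mem' {f g} hf hg e h := by
    by_cases h' : f.coeff e = 0
    · refine hg e fun h'' => h ?_
      rw [AddMonoidAlgebra.coeff_add, Finsupp.add_apply, h', h'', add_zero]
    · exact hf e h'
  smul_mem' c f hf e h := hf e fun h' => h (by
    rw [AddMonoidAlgebra.coeff_smul, Finsupp.smul_apply, h', smul_zero])

theorem lau_mono {S T : Set (Fin 4)} (h : S ⊆ T) (n : ℤ) : lau k S n ≤ lau k T n :=
  fun _ hf e he => ⟨(hf e he).1, fun j hj => (hf e he).2 j fun hS => hj (h hS)⟩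

theorem single_mul_mem_lau {S : Set (Fin 4)} {n m : ℤ} {e : Fin 4 → ℤ} (he : e ∈ expSet S m) {f : Lau k}
    (hf : f ∈ lau k S n) : AddMonoidAlgebra.single e (1 : k) * f ∈ lau k S (n + m) := by
  intro e' h
  rw [AddMonoidAlgebra.coeff_single_mul_apply, one_mul] at h
  have h1 := hf _ h
  constructor
  · have := h1.1
    simp only [Pi.add_apply, Pi.neg_apply, Finset.sum_add_distrib, Finset.sum_neg_distrib, he.1] at this
    omega
  · intro j hj
    have := h1.2 j hj
    have := he.2 j hj
    simp only [Pi.add_apply, Pi.neg_apply] at *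
    omega

theorem toLau_mem {n : ℤ} {p : MvPolynomial (Fin 4) k} (hp : p ∈ poly k n) (S : Set (Fin 4)) :
    toLau p ∈ lau k S n := by
  rw [← support_sum_monomial_coeff p, map_sum]
  refine Submodule.sum_mem _ fun m hm => ?_
  rw [toLau_monomial]
  intro e he
  rw [AddMonoidAlgebra.coeff_single, Finsupp.single_apply] at he
  obtain rfl : castExp m = e := by by_contra h; simp [h] at he
  exact ⟨(sum_castExp m).trans (hp m hm), fun j _ => Int.natCast_nonneg _⟩

theorem exists_toLau {n : ℤ} {f : Lau k} (hf : f ∈ lau k ∅ n) : ∃ p ∈ poly k n, toLau p = f := by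
  have hr : ∀ e, f.coeff e ≠ 0 → ∃ m, castExp m = e := fun e he =>
    exists_castExp fun i => (hf e he).2 i (Set.notMem_empty i)
  refine ⟨AddMonoidAlgebra.comapDomain castExp castExp_injective f, fun m hm => ?_,
    AddMonoidAlgebra.mapDomain_comapDomain ?_ _⟩
  · rw [mem_support_iff] at hm
    rw [← (hf (castExp m) hm).1, sum_castExp]
  · intro e he
    exact hr e (Finsupp.mem_support_iff.1 he)

/-- The sum of the exponents in `expSet S n` that satisfy a condition. -/
def lauFilter (P : Set (Fin 4 → ℤ)) (f : Lau k) : Lau k :=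
  open Classical in .ofCoeff (f.coeff.filter (· ∈ P))

theorem coeff_lauFilter_of_mem {P : Set (Fin 4 → ℤ)} (f : Lau k) {e : Fin 4 → ℤ} (he : e ∈ P) :
    (lauFilter P f).coeff e = f.coeff e := by
  classical exact Finsupp.filter_apply_pos _ _ he

theorem coeff_lauFilter_of_notMem {P : Set (Fin 4 → ℤ)} (f : Lau k) {e : Fin 4 → ℤ} (he : e ∉ P) :
    (lauFilter P f).coeff e = 0 := by
  classical exact Finsupp.filter_apply_neg _ _ he

section module
variable {r : ℕ} (d : Fin r → ℤ)

instance : Module (MvPolynomial (Fin 4) k) (Lau k) := Module.compHom _ (toLau (k := k)).toRingHom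

theorem lau_smul_def (p : MvPolynomial (Fin 4) k) (f : Lau k) : p • f = toLau p * f := rfl

instance : IsScalarTower k (MvPolynomial (Fin 4) k) (Lau k) :=
  ⟨fun c p f => by rw [lau_smul_def, lau_smul_def, map_smul, smul_mul_assoc]⟩

theorem X_smul_mem_lau {S : Set (Fin 4)} (l : Fin 4) {v w : ℤ} (hw : v + 1 = w) {f : Lau k}
    (hf : f ∈ lau k S v) : (X l : MvPolynomial (Fin 4) k) • f ∈ lau k S w := by
  subst hw
  rw [lau_smul_def, toLau_X]
  refine single_mul_mem_lau ⟨by simp, fun j _ => ?_⟩ hf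
  by_cases h : j = l
  · subst h; simp
  · simp [h]

/-- The localization of the free module `⨁_a R(-d_a)` at the variables `X_i`, `i ∈ S`. -/
def laur (S : Set (Fin 4)) : GrMod k where
  obj v := ∀ a, lau k S (v - d a)
  X l v w hw := LinearMap.pi fun a =>
    { toFun := fun f => ⟨(X l : MvPolynomial (Fin 4) k) • (f a).1,
        X_smul_mem_lau l (by omega) (f a).2⟩
      map_add' := fun f g => Subtype.ext (smul_add _ _ _)
      map_smul' := fun c f => Subtype.ext (mul_smul_comm c _ _) }
  X_comm l m v w y hw hy s := funext fun a => Subtype.ext (mul_left_comm _ _ _)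

variable {d} {S T : Set (Fin 4)}

/-- The inclusion of a graded piece of `laur d S`. -/
def laurIncl (v : ℤ) : (laur (k := k) d S).obj v →ₗ[k] (Fin r → Lau k) :=
  LinearMap.pi fun a => (lau k S (v - d a)).subtype.comp (LinearMap.proj a)

theorem laur_ext {v : ℤ} {x y : (laur (k := k) d S).obj v} (h : ∀ a, laurIncl v x a = laurIncl v y a) :
    x = y := funext fun a => Subtype.ext (h a)

theorem laurIncl_mem {v : ℤ} (x : (laur (k := k) d S).obj v) (a : Fin r) :
    laurIncl v x a ∈ lau k S (v - d a) := (x a).2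

theorem exists_laurIncl_eq {v : ℤ} {f : Fin r → Lau k} (hf : ∀ a, f a ∈ lau k S (v - d a)) :
    ∃ x : (laur d S).obj v, laurIncl v x = f := ⟨fun a => ⟨f a, hf a⟩, rfl⟩

theorem laurIncl_X (l : Fin 4) (v w : ℤ) (hw : v + 1 = w) (x : (laur (k := k) d S).obj v) :
    laurIncl w ((laur d S).X l v w hw x) = (X l : MvPolynomial (Fin 4) k) • laurIncl v x := rfl

theorem laurIncl_pmul {n v w : ℤ} (hw : v + n = w) {p : MvPolynomial (Fin 4) k} (hp : p ∈ poly k n)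
    (x : (laur (k := k) d S).obj v) : laurIncl w (pmul _ v w p x) = p • laurIncl v x :=
  pmul_eq_smul laurIncl laurIncl_X hw hp x

variable (d) in
/-- The inclusion between localizations. -/
def laurMap (h : S ⊆ T) : hom (laur (k := k) d S) (laur d T) :=
  ⟨fun v => LinearMap.pi fun a => (Submodule.inclusion (lau_mono h (v - d a))).comp (LinearMap.proj a),
    fun _ _ _ _ _ => rfl⟩

theorem laurIncl_laurMap (h : S ⊆ T) (v : ℤ) (x : (laur (k := k) d S).obj v) :
    laurIncl v ((laurMap d h).1 v x) = laurIncl v x := rfl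

variable (d S) in
/-- The localization map. -/
def toLaur : hom (free (k := k) d) (laur d S) :=
  ⟨fun v => LinearMap.pi fun a =>
      { toFun := fun x => ⟨toLau (x a : poly k (v - d a)).1, toLau_mem (x a).2 S⟩
        map_add' := fun _ _ => Subtype.ext (map_add toLau _ _)
        map_smul' := fun c _ => Subtype.ext (map_smul toLau c _) },
    fun _ _ _ _ _ => funext fun _ => Subtype.ext (map_mul toLau _ _)⟩

theorem laurIncl_toLaur (v : ℤ) (x : (free (k := k) d).obj v) (a : Fin r) :
    laurIncl v ((toLaur d S).1 v x) a = toLau (freeIncl d v x a) := rfl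

theorem invOn_laur : InvOn S (laur (k := k) d S) := by
  intro i hi v w hw
  have hinv : AddMonoidAlgebra.single (-Pi.single i 1 : Fin 4 → ℤ) (1 : k) *
      AddMonoidAlgebra.single (Pi.single i 1) 1 = 1 := by
    rw [AddMonoidAlgebra.single_mul_single, neg_add_cancel, one_mul]; rfl
  constructor
  · rw [injective_iff_map_eq_zero]
    intro x hx
    refine laur_ext fun a => ?_
    have h1 := congrFun (congrArg (laurIncl w) hx) a
    rw [laurIncl_X, Pi.smul_apply, lau_smul_def, toLau_X] at h1
    have h2 := congrArg (AddMonoidAlgebra.single (-Pi.single i 1 : Fin 4 → ℤ) (1 : k) * ·) h1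
    simp only [← mul_assoc, hinv, one_mul] at h2
    rw [h2, map_zero, map_zero, Pi.zero_apply, mul_zero]
  · intro y
    obtain ⟨x, hx⟩ := exists_laurIncl_eq (d := d) (S := S) (v := v)
      (f := fun a => AddMonoidAlgebra.single (-Pi.single i 1 : Fin 4 → ℤ) (1 : k) * laurIncl w y a)
      fun a => by
        have := single_mul_mem_lau (m := -1) (e := -Pi.single i 1) (S := S) ⟨by simp, fun j hj => by
          have : j ≠ i := fun h => hj (h ▸ hi)
          simp [this]⟩ (laurIncl_mem y a)
        rwa [show w - d a + -1 = v - d a by omega] at this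
    refine ⟨x, laur_ext fun a => ?_⟩
    rw [laurIncl_X, Pi.smul_apply, lau_smul_def, toLau_X, hx, ← mul_assoc, mul_comm (AddMonoidAlgebra.single _ _),
      hinv, one_mul]

theorem isLoc_toLaur : IsLoc S (toLaur (k := k) d S) where
  inv := invOn_laur
  surj v t := by
    classical
    -- A bound on all negative exponents that occur, so that the N-th power of the product of the
    -- variables in S clears all denominators at once.
    obtain ⟨N, hN⟩ : ∃ N : ℕ, ∀ a e, (laurIncl v t a).coeff e ≠ 0 → ∀ i, -(N : ℤ) ≤ e i := by
      let s : Finset ((Fin 4 → ℤ) × Fin 4) :=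
        (Finset.univ.biUnion fun a => (laurIncl v t a).coeff.support) ×ˢ Finset.univ
      refine ⟨s.sup fun x => (x.1 x.2).natAbs, fun a e he i => ?_⟩
      have h1 : (e, i) ∈ s := Finset.mem_product.2
        ⟨Finset.mem_biUnion.2 ⟨a, Finset.mem_univ a, Finsupp.mem_support_iff.2 he⟩, Finset.mem_univ i⟩
      have h2 := Finset.le_sup (f := fun x : (Fin 4 → ℤ) × Fin 4 => (x.1 x.2).natAbs) h1
      dsimp only at h2
      omega
    let s : Finset (Fin 4) := Finset.univ.filter (· ∈ S)
    have hp : MonIn S _ _ := MonIn.prod_X_pow (k := k) (s := s) (by intro i; simp [s]) N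
    refine ⟨_, _, hp, _, rfl, ?_⟩
    have hprod : toLau (∏ i ∈ s, (X i : MvPolynomial (Fin 4) k) ^ N) =
        AddMonoidAlgebra.single (fun i => if i ∈ S then (N : ℤ) else 0) 1 := by
      have : ∏ i ∈ s, (X i : MvPolynomial (Fin 4) k) ^ N =
          monomial (∑ i ∈ s, Finsupp.single i N) 1 := by
        simp only [X_pow_eq_monomial]
        rw [monomial_sum_one]
      rw [this, toLau_monomial]
      congr 1
      funext i
      simp [castExp, Finsupp.single_apply, s]
    have hmem := laurIncl_mem (pmul _ v (v + (s.card * N : ℕ)) (∏ i ∈ s, (X i : MvPolynomial (Fin 4) k) ^ N) t)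
    rw [laurIncl_pmul rfl hp.mem_poly] at hmem
    have key : ∀ a, ∃ q ∈ poly k (v + (s.card * N : ℕ) - d a), toLau q =
        ((∏ i ∈ s, (X i : MvPolynomial (Fin 4) k) ^ N) • laurIncl v t) a := fun a => by
      refine exists_toLau fun e he => ⟨(hmem a e he).1, fun j _ => ?_⟩
      by_cases hj : j ∈ S
      · rw [Pi.smul_apply, lau_smul_def, hprod, AddMonoidAlgebra.coeff_single_mul_apply, one_mul] at he
        have := hN a _ he j
        simp [hj] at this
        omega
      · exact (hmem a e he).2 j hj
    choose q hq hq' using key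
    refine ⟨fun a => ⟨q a, hq a⟩, laur_ext fun a => ?_⟩
    rw [laurIncl_pmul rfl hp.mem_poly, ← hq']
    rfl
  ker v s hs := by
    refine ⟨0, 1, .one, v, by simp, ?_⟩
    rw [pmul_one]
    refine free_ext d fun a => ?_
    have := congrFun (congrArg (laurIncl v) hs) a
    rw [laurIncl_toLaur, map_zero, Pi.zero_apply, ← map_zero (toLau (k := k))] at this
    exact toLau_injective this
end module
end P3

end

/-! ### Localized maps of free modules and residues -/

noncomputable section
universe u
namespace P3
variable {k : Type u} [Field k]
open MvPolynomial
open GrMod (poly hom homDeg free X_mul_mem_poly)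

theorem smul_mem_lau {S : Set (Fin 4)} {n m w : ℤ} (hw : n + m = w) {p : MvPolynomial (Fin 4) k}
    (hp : p ∈ poly k m) {f : Lau k} (hf : f ∈ lau k S n) : p • f ∈ lau k S w := by
  refine poly_induction (motive := fun m p => ∀ w, n + m = w → p • f ∈ lau k S w) ?_ ?_ ?_ ?_ hp w hw
  · intro m w _; rw [zero_smul]; exact zero_mem _
  · intro c w hw
    obtain rfl : n = w := by omega
    rw [← algebraMap_eq, algebraMap_smul]; exact Submodule.smul_mem _ c hf
  · intro m p q _ _ h h' w hw; rw [add_smul]; exact add_mem (h w hw) (h' w hw)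
  · intro l m p _ h w hw
    rw [mul_smul]; exact X_smul_mem_lau l (by omega) (h (n + m) rfl)

section laurMat
variable {r₀ r₁ : ℕ} {d₀ : Fin r₀ → ℤ} {d₁ : Fin r₁ → ℤ} {S T : Set (Fin 4)}

variable (S) in
/-- The localization of a map of free modules. -/
def laurMat (D : hom (free (k := k) d₁) (free d₀)) : hom (laur (k := k) d₁ S) (laur d₀ S) :=
  ⟨fun v => LinearMap.pi fun b =>
      { toFun := fun x => ⟨∑ a, mat D b a • laurIncl v x a, Submodule.sum_mem _ fun a _ =>
          smul_mem_lau (by ring) (mat_mem D b a) (laurIncl_mem x a)⟩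
        map_add' := fun x y => Subtype.ext (by
          simp only [map_add, Pi.add_apply, smul_add, Finset.sum_add_distrib]; rfl)
        map_smul' := fun c x => Subtype.ext (by
          simp only [map_smul, Pi.smul_apply, smul_comm _ c, ← Finset.smul_sum]; rfl) },
    fun l v w hw x => funext fun b => Subtype.ext (by
      change ∑ a, mat D b a • (X l : MvPolynomial (Fin 4) k) • laurIncl v x a =
        (X l : MvPolynomial (Fin 4) k) • ∑ a, mat D b a • laurIncl v x a
      rw [Finset.smul_sum]
      exact Finset.sum_congr rfl fun a _ => smul_comm _ _ _)⟩

theorem laurIncl_laurMat (D : hom (free (k := k) d₁) (free d₀)) (v : ℤ)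
    (x : (laur (k := k) d₁ S).obj v) (b : Fin r₀) :
    laurIncl v ((laurMat S D).1 v x) b = ∑ a, mat D b a • laurIncl v x a := rfl

theorem laurMat_toLaur (D : hom (free (k := k) d₁) (free d₀)) (v : ℤ) (x : (free (k := k) d₁).obj v) :
    (laurMat S D).1 v ((toLaur d₁ S).1 v x) = (toLaur d₀ S).1 v (D.1 v x) := by
  refine laur_ext fun b => ?_
  rw [laurIncl_laurMat, laurIncl_toLaur, freeIncl_apply, Matrix.mulVec, dotProduct, map_sum]
  exact Finset.sum_congr rfl fun a _ => (map_mul toLau _ _).symm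

theorem laurMat_laurMap (D : hom (free (k := k) d₁) (free d₀)) (h : S ⊆ T) (v : ℤ)
    (x : (laur (k := k) d₁ S).obj v) :
    (laurMat T D).1 v ((laurMap d₁ h).1 v x) = (laurMap d₀ h).1 v ((laurMat S D).1 v x) := rfl
end laurMat

section residue
variable {r : ℕ} (d : Fin r → ℤ) (S : Set (Fin 4))

/-- The residue map: coefficients at `(X_0 X_1 X_2 X_3)⁻¹`. -/
def residue : hom (laur (k := k) d S) (dualFree d) :=
  dualHom d (laur d S) fun a =>
    { toFun := fun x => (laurIncl _ x a).coeff fun _ => -1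
      map_add' := fun _ _ => rfl
      map_smul' := fun _ _ => rfl }

variable {d S}

theorem residue_apply (v : ℤ) (x : (laur (k := k) d S).obj v) (a : Fin r)
    (q : poly k (d a + -4 - v)) :
    (residue d S).1 v x a q = (q.1 • laurIncl v x a).coeff fun _ => -1 := by
  refine (dualHom_apply (N := laur d S) d _ v x a q).trans ?_
  exact congrArg (fun f : Fin r → Lau k => (f a).coeff fun _ => -1)
    (laurIncl_pmul (n := d a + -4 - v) (by ring) q.2 x)

theorem residue_laurMat {r₀ r₁ : ℕ} {d₀ : Fin r₀ → ℤ} {d₁ : Fin r₁ → ℤ}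
    (D : hom (free (k := k) d₁) (free d₀)) (v : ℤ) (x : (laur (k := k) d₁ S).obj v) :
    (residue d₀ S).1 v ((laurMat S D).1 v x) = (dualMat D).1 v ((residue d₁ S).1 v x) := by
  refine funext fun b => LinearMap.ext fun q => ?_
  rw [residue_apply, dualMat_apply, laurIncl_laurMat, Finset.smul_sum, AddMonoidAlgebra.coeff_sum,
    Finset.sum_apply']
  refine Finset.sum_congr rfl fun a _ => ?_
  rw [residue_apply, mul_smul]

theorem monomial_smul_coeff (m : Fin 4 →₀ ℕ) (f : Lau k) (e : Fin 4 → ℤ) :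
    ((monomial m (1 : k)) • f).coeff e = f.coeff (-castExp m + e) := by
  rw [lau_smul_def, toLau_monomial, AddMonoidAlgebra.coeff_single_mul_apply, one_mul]

/-- The exponent of the Laurent monomial dual to a monomial. -/
theorem castExp_add_mem {m : Fin 4 →₀ ℕ} {n : ℤ} (h : (m.degree : ℤ) = -4 - n) :
    -castExp m + (fun _ => -1) ∈ expSet Set.univ n := by
  refine ⟨?_, fun j hj => absurd (Set.mem_univ j) hj⟩
  simp only [Pi.add_apply, Pi.neg_apply, Finset.sum_add_distrib, Finset.sum_neg_distrib, sum_castExp, h]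
  simp

/-- Pairing with the monomial of exponent m reads off the coefficient at -m - (1, 1, 1, 1). These
are exactly the exponents with all entries negative, so the residue vanishes when every exponent
that occurs has a nonnegative entry. -/
theorem residue_eq_zero_iff (v : ℤ) (x : (laur (k := k) d S).obj v) :
    (residue d S).1 v x = 0 ↔ ∀ a e, (laurIncl v x a).coeff e ≠ 0 → ∃ i, 0 ≤ e i := by
  constructor
  · intro h a e he
    by_contra! hneg
    obtain ⟨m, hm⟩ := exists_castExp (e := -e + fun _ => -1) fun i => by
      have := hneg i
      simp only [Pi.add_apply, Pi.neg_apply]; omega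
    have hdeg : (m.degree : ℤ) = d a + -4 - v := by
      rw [← sum_castExp, hm]
      simp only [Pi.add_apply, Pi.neg_apply, Finset.sum_add_distrib, Finset.sum_neg_distrib,
        (laurIncl_mem x a e he).1]
      simp; ring
    have h1 := LinearMap.congr_fun (congrFun h a) ⟨monomial m 1, monomial_mem_poly m 1 hdeg⟩
    rw [residue_apply, monomial_smul_coeff, hm] at h1
    refine he (Eq.trans ?_ h1)
    congr 1
    funext i; simp
  · intro h
    refine funext fun a => LinearMap.ext fun q => ?_
    rw [residue_apply]
    change _ = (0 : k)
    rw [← support_sum_monomial_coeff q.1, Finset.sum_smul, AddMonoidAlgebra.coeff_sum,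
      Finset.sum_apply']
    refine Finset.sum_eq_zero fun m _ => ?_
    rw [← mul_one (coeff m q.1), ← smul_eq_mul, ← smul_monomial, smul_assoc,
      AddMonoidAlgebra.coeff_smul, Finsupp.smul_apply, monomial_smul_coeff]
    by_contra h0
    obtain ⟨i, hi⟩ := h a _ (right_ne_zero_of_smul h0)
    simp only [Pi.add_apply, Pi.neg_apply] at hi
    have : 0 ≤ castExp m i := Int.natCast_nonneg _
    omega

theorem residue_surjective (hS : S = Set.univ) (v : ℤ) :
    Function.Surjective ((residue (k := k) d S).1 v) := by
  classical
  intro ξ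
  let M : Fin r → Finset (Fin 4 →₀ ℕ) := fun a =>
    (Finsupp.finite_of_degree_le (σ := Fin 4) (d a + -4 - v).toNat).toFinset.filter
      fun m => (m.degree : ℤ) = d a + -4 - v
  have hM : ∀ a m, m ∈ M a ↔ (m.degree : ℤ) = d a + -4 - v := fun a m => by
    simp only [M, Finset.mem_filter, Set.Finite.mem_toFinset, Set.mem_ofPred_eq]
    omega
  -- A functional ξ on a finite-dimensional space of polynomials is the residue of the finite sum of
  -- ξ(X^m) X^(-m-1).
  obtain ⟨x, hx⟩ := exists_laurIncl_eq (d := d) (S := S) (v := v)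
    (f := fun a => ∑ m ∈ (M a).attach, AddMonoidAlgebra.single (-castExp m.1 + fun _ => -1)
      (ξ a ⟨monomial m.1 1, monomial_mem_poly m.1 1 ((hM a m.1).1 m.2)⟩)) (fun a => by
    refine Submodule.sum_mem _ fun m _ e he => ?_
    rw [AddMonoidAlgebra.coeff_single, Finsupp.single_apply] at he
    obtain rfl : -castExp m.1 + (fun _ => -1) = e := by by_contra h; simp [h] at he
    rw [hS]
    refine castExp_add_mem ?_
    rw [(hM a m.1).1 m.2]; ring)
  refine ⟨x, funext fun a => LinearMap.ext fun q => ?_⟩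
  have hmono : ∀ m (hm : (m.degree : ℤ) = d a + -4 - v),
      (residue d S).1 v x a ⟨monomial m 1, monomial_mem_poly m 1 hm⟩ =
        ξ a ⟨monomial m 1, monomial_mem_poly m 1 hm⟩ := fun m hm => by
    rw [residue_apply, monomial_smul_coeff, hx, AddMonoidAlgebra.coeff_sum, Finset.sum_apply']
    rw [Finset.sum_eq_single ⟨m, (hM a m).2 hm⟩]
    · rw [AddMonoidAlgebra.coeff_single, Finsupp.single_eq_same]
    · intro m' _ hm'
      rw [AddMonoidAlgebra.coeff_single, Finsupp.single_apply, if_neg]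
      intro h
      apply hm'
      apply Subtype.ext
      apply castExp_injective
      simpa using h
    · exact fun h => absurd (Finset.mem_attach _ _) h
  have hq : q = ∑ m ∈ q.1.support.attach, coeff m.1 q.1 •
      (⟨monomial m.1 1, monomial_mem_poly m.1 1 (q.2 m.1 m.2)⟩ : poly k (d a + -4 - v)) := by
    apply Subtype.ext
    rw [AddSubmonoidClass.coe_finsetSum]
    simp only [SetLike.val_smul, smul_monomial, smul_eq_mul, mul_one]
    rw [Finset.sum_attach q.1.support fun m => monomial m (coeff m q.1), support_sum_monomial_coeff]
  rw [hq, map_sum, map_sum]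
  refine Finset.sum_congr rfl fun m _ => ?_
  rw [map_smul, map_smul, hmono _ (q.2 m.1 m.2)]
end residue

end P3

end

/-! ### Čech cohomology of graded free modules in degrees two and three -/

noncomputable section
universe u
namespace P3
variable {k : Type u} [Field k]
open MvPolynomial
open GrMod (poly hom homDeg free X_mul_mem_poly)

section split
variable {n : ℤ}

theorem mem_lau_pair {i j a b : Fin 4} (h : ({i, j} : Set (Fin 4))ᶜ ⊆ {a, b}) {f : Lau k}
    (hf : ∀ e, f.coeff e ≠ 0 → ∑ i, e i = n ∧ 0 ≤ e a ∧ 0 ≤ e b) : f ∈ lau k {i, j} n := by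
  intro e he
  obtain ⟨h0, ha, hb⟩ := hf e he
  refine ⟨h0, fun l hl => ?_⟩
  rcases h hl with rfl | rfl
  exacts [ha, hb]

theorem coeff_of_mem_compl {i : Fin 4} {f : Lau k} (hf : f ∈ lau k {i}ᶜ n) {e : Fin 4 → ℤ}
    (he : f.coeff e ≠ 0) : ∑ i, e i = n ∧ 0 ≤ e i :=
  ⟨(hf e he).1, (hf e he).2 i (fun h => h rfl)⟩

/-- Vanishing of H² for the sheaves 𝒪(n). The element y_i is polynomial in X_i; the task is to cut
it into pieces that are polynomial in two variables. Exponents are sorted by the signs of their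
entries, and where a second nonnegative entry is missing, the cocycle relation supplies it. -/
theorem lau_cech_exact {y₀ y₁ y₂ y₃ : Lau k} (h₀ : y₀ ∈ lau k {0}ᶜ n) (h₁ : y₁ ∈ lau k {1}ᶜ n)
    (h₂ : y₂ ∈ lau k {2}ᶜ n) (h₃ : y₃ ∈ lau k {3}ᶜ n) (h : y₀ - y₁ + y₂ - y₃ = 0) :
    ∃ w₀₁ ∈ lau k {0, 1} n, ∃ w₀₂ ∈ lau k {0, 2} n, ∃ w₀₃ ∈ lau k {0, 3} n,
    ∃ w₁₂ ∈ lau k {1, 2} n, ∃ w₁₃ ∈ lau k {1, 3} n, ∃ w₂₃ ∈ lau k {2, 3} n,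
      y₀ = w₂₃ - w₁₃ + w₁₂ ∧ y₁ = w₂₃ - w₀₃ + w₀₂ ∧ y₂ = w₁₃ - w₀₃ + w₀₁ ∧
      y₃ = w₁₂ - w₀₂ + w₀₁ := by
  set A : Set (Fin 4 → ℤ) := {e | 0 ≤ e 0} with hA
  set B : Set (Fin 4 → ℤ) := {e | ¬ 0 ≤ e 0 ∧ 0 ≤ e 1} with hB
  set C : Set (Fin 4 → ℤ) := {e | ¬ 0 ≤ e 0 ∧ ¬ 0 ≤ e 1} with hC
  have hsupp : ∀ (P : Set (Fin 4 → ℤ)) (f : Lau k) e, (lauFilter P f).coeff e ≠ 0 →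
      e ∈ P ∧ f.coeff e ≠ 0 := fun P f e he => by
    by_cases hP : e ∈ P
    · rw [coeff_lauFilter_of_mem f hP] at he; exact ⟨hP, he⟩
    · exact absurd (coeff_lauFilter_of_notMem f hP) he
  have hsum : ∀ f : Lau k, f = lauFilter A f + lauFilter B f + lauFilter C f := fun f => by
    refine AddMonoidAlgebra.coeff_injective (Finsupp.ext fun e => ?_)
    simp only [AddMonoidAlgebra.coeff_add, Finsupp.add_apply]
    by_cases h0 : 0 ≤ e 0
    · rw [coeff_lauFilter_of_mem f (show e ∈ A from h0),
        coeff_lauFilter_of_notMem f (show e ∉ B from fun h => h.1 h0),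
        coeff_lauFilter_of_notMem f (show e ∉ C from fun h => h.1 h0), add_zero, add_zero]
    · by_cases h1 : 0 ≤ e 1
      · rw [coeff_lauFilter_of_notMem f (show e ∉ A from h0),
          coeff_lauFilter_of_mem f (show e ∈ B from ⟨h0, h1⟩),
          coeff_lauFilter_of_notMem f (show e ∉ C from fun h => h.2 h1), zero_add, add_zero]
      · rw [coeff_lauFilter_of_notMem f (show e ∉ A from h0),
          coeff_lauFilter_of_notMem f (show e ∉ B from fun h => h1 h.2),
          coeff_lauFilter_of_mem f (show e ∈ C from ⟨h0, h1⟩), zero_add, zero_add]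
  have hzero : ∀ {i : Fin 4} {f : Lau k}, f ∈ lau k {i}ᶜ n → ∀ e, ¬ 0 ≤ e i → f.coeff e = 0 :=
    fun hf e he => by_contra fun h => he (coeff_of_mem_compl hf h).2
  have hcoeff : ∀ e, y₀.coeff e - y₁.coeff e + y₂.coeff e - y₃.coeff e = 0 := fun e =>
    congrArg (fun f : Lau k => f.coeff e) h
  -- the intersections with the complement of the last chart
  have m₁₂ : ∀ e, (lauFilter A y₃).coeff e ≠ 0 → ∑ i, e i = n ∧ 0 ≤ e 0 ∧ 0 ≤ e 3 := fun e he => by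
    obtain ⟨ha, he⟩ := hsupp _ _ _ he
    obtain ⟨h1, h2⟩ := coeff_of_mem_compl h₃ he
    exact ⟨h1, ha, h2⟩
  have m₀₂ : ∀ e, (-lauFilter B y₃).coeff e ≠ 0 → ∑ i, e i = n ∧ 0 ≤ e 1 ∧ 0 ≤ e 3 := fun e he => by
    rw [AddMonoidAlgebra.coeff_neg, Finsupp.neg_apply, neg_ne_zero] at he
    obtain ⟨ha, he⟩ := hsupp _ _ _ he
    obtain ⟨h1, h2⟩ := coeff_of_mem_compl h₃ he
    exact ⟨h1, ha.2, h2⟩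
  -- If the exponents at 0, 1 and 2 were all negative, y₀, y₁, y₂ would have no such term, so
  -- neither would y₃.
  have m₀₁ : ∀ e, (lauFilter C y₃).coeff e ≠ 0 → ∑ i, e i = n ∧ 0 ≤ e 2 ∧ 0 ≤ e 3 := fun e he => by
    obtain ⟨ha, he⟩ := hsupp _ _ _ he
    obtain ⟨h1, h2⟩ := coeff_of_mem_compl h₃ he
    refine ⟨h1, ?_, h2⟩
    by_contra h3
    apply he
    have := hcoeff e
    rw [hzero h₀ e ha.1, hzero h₁ e ha.2, hzero h₂ e h3] at this
    simpa using this
  have n₀ : y₀ - lauFilter A y₃ ∈ lau k {0}ᶜ n := sub_mem h₀ fun e he =>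
    ⟨(m₁₂ e he).1, fun j hj => by
      obtain rfl : j = 0 := not_not.1 hj
      exact (m₁₂ e he).2.1⟩
  have n₁ : y₁ - -lauFilter B y₃ ∈ lau k {1}ᶜ n := sub_mem h₁ fun e he =>
    ⟨(m₀₂ e he).1, fun j hj => by
      obtain rfl : j = 1 := not_not.1 hj
      exact (m₀₂ e he).2.1⟩
  have n₂ : y₂ - lauFilter C y₃ ∈ lau k {2}ᶜ n := sub_mem h₂ fun e he =>
    ⟨(m₀₁ e he).1, fun j hj => by
      obtain rfl : j = 2 := not_not.1 hj
      exact (m₀₁ e he).2.1⟩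
  -- The three pieces of y₃ are removed from the other components, leaving a relation among three
  -- terms, to be treated in the same way.
  have hsum₃ := hsum y₃
  set x₀ := y₀ - lauFilter A y₃ with hx₀
  set x₁ := y₁ - -lauFilter B y₃ with hx₁
  set x₂ := y₂ - lauFilter C y₃ with hx₂
  have hx : x₀ - x₁ + x₂ = 0 := by
    rw [hx₀, hx₁, hx₂]; linear_combination h + hsum₃
  have hxc : ∀ e, x₀.coeff e - x₁.coeff e + x₂.coeff e = 0 := fun e =>
    congrArg (fun f : Lau k => f.coeff e) hx
  have m₁₃ : ∀ e, (lauFilter A x₂).coeff e ≠ 0 → ∑ i, e i = n ∧ 0 ≤ e 0 ∧ 0 ≤ e 2 := fun e he => by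
    obtain ⟨ha, he⟩ := hsupp _ _ _ he
    obtain ⟨h1, h2⟩ := coeff_of_mem_compl n₂ he
    exact ⟨h1, ha, h2⟩
  have m₀₃ : ∀ e, (-lauFilter Aᶜ x₂).coeff e ≠ 0 → ∑ i, e i = n ∧ 0 ≤ e 1 ∧ 0 ≤ e 2 :=
    fun e he => by
    rw [AddMonoidAlgebra.coeff_neg, Finsupp.neg_apply, neg_ne_zero] at he
    obtain ⟨ha, he⟩ := hsupp _ _ _ he
    obtain ⟨h1, h2⟩ := coeff_of_mem_compl n₂ he
    refine ⟨h1, ?_, h2⟩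
    by_contra h3
    apply he
    have := hxc e
    rw [hzero n₀ e ha, hzero n₁ e h3] at this
    simpa using this
  have hsum₂ : x₂ = lauFilter A x₂ + lauFilter Aᶜ x₂ := by
    refine AddMonoidAlgebra.coeff_injective (Finsupp.ext fun e => ?_)
    rw [AddMonoidAlgebra.coeff_add, Finsupp.add_apply]
    by_cases h0 : e ∈ A
    · rw [coeff_lauFilter_of_mem _ h0, coeff_lauFilter_of_notMem _ (Set.notMem_compl_iff.2 h0), add_zero]
    · rw [coeff_lauFilter_of_notMem _ h0, coeff_lauFilter_of_mem _ h0, zero_add]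
  have o₀ : x₀ + lauFilter A x₂ ∈ lau k {0}ᶜ n := add_mem n₀ fun e he =>
    ⟨(m₁₃ e he).1, fun j hj => by
      obtain rfl : j = 0 := not_not.1 hj
      exact (m₁₃ e he).2.1⟩
  have o₁ : x₁ + -lauFilter Aᶜ x₂ ∈ lau k {1}ᶜ n := add_mem n₁ fun e he =>
    ⟨(m₀₃ e he).1, fun j hj => by
      obtain rfl : j = 1 := not_not.1 hj
      exact (m₀₃ e he).2.1⟩
  -- What remains is a single element that is polynomial in X_0 by one expression and in X_1 by the
  -- other.
  have o : x₀ + lauFilter A x₂ = x₁ + -lauFilter Aᶜ x₂ := by linear_combination hx - hsum₂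
  refine ⟨lauFilter C y₃, mem_lau_pair (a := 2) (b := 3) ?_ m₀₁, -lauFilter B y₃,
    mem_lau_pair (a := 1) (b := 3) ?_ m₀₂, -lauFilter Aᶜ x₂,
    mem_lau_pair (a := 1) (b := 2) ?_ m₀₃, lauFilter A y₃, mem_lau_pair (a := 0) (b := 3) ?_ m₁₂,
    lauFilter A x₂, mem_lau_pair (a := 0) (b := 2) ?_ m₁₃, x₀ + lauFilter A x₂,
    mem_lau_pair (a := 0) (b := 1) ?_ fun e he => ⟨(coeff_of_mem_compl o₀ he).1,
      (coeff_of_mem_compl o₀ he).2, (coeff_of_mem_compl o₁ (o ▸ he)).2⟩, ?_, ?_, ?_, ?_⟩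
  any_goals
    intro i hi
    fin_cases i <;> simp at hi ⊢
  · rw [hx₀]; ring
  · rw [o, hx₁]; ring
  · linear_combination hsum₂ - hx₂
  · linear_combination hsum₃

/-- Each term is assigned to the smallest index at which its exponent is nonnegative, hence to a
triple intersection of charts. -/
theorem lau_split {f : Lau k} (hf : f ∈ lau k Set.univ n) (h : ∀ e, f.coeff e ≠ 0 → ∃ i, 0 ≤ e i) :
    ∃ y₀ ∈ lau k {0}ᶜ n, ∃ y₁ ∈ lau k {1}ᶜ n, ∃ y₂ ∈ lau k {2}ᶜ n, ∃ y₃ ∈ lau k {3}ᶜ n,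
      f = y₀ - y₁ + y₂ - y₃ := by
  set P : Fin 4 → Set (Fin 4 → ℤ) := fun i => {e | 0 ≤ e i ∧ ∀ j < i, ¬ 0 ≤ e j} with hP
  have hmem : ∀ i, lauFilter (P i) f ∈ lau k {i}ᶜ n := fun i e he => by
    by_cases h0 : e ∈ P i
    · rw [coeff_lauFilter_of_mem f h0] at he
      refine ⟨(hf e he).1, fun j hj => ?_⟩
      obtain rfl : j = i := not_not.1 hj
      exact h0.1
    · exact absurd (coeff_lauFilter_of_notMem f h0) he
  have hsum : f = lauFilter (P 0) f + lauFilter (P 1) f + lauFilter (P 2) f + lauFilter (P 3) f := by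
    refine AddMonoidAlgebra.coeff_injective (Finsupp.ext fun e => ?_)
    have key : f.coeff e = ∑ i, (lauFilter (P i) f).coeff e := by
      by_cases he : ∃ i, 0 ≤ e i
      · obtain ⟨i, hi, hmin⟩ : ∃ i, 0 ≤ e i ∧ ∀ j < i, ¬ 0 ≤ e j := by
          obtain ⟨i, hi, hmin⟩ := WellFounded.has_min (r := (· < ·))
            (wellFounded_lt (α := Fin 4)) {i | 0 ≤ e i} he
          exact ⟨i, hi, fun j hj h => hmin j h hj⟩
        rw [Finset.sum_eq_single i, coeff_lauFilter_of_mem f (show e ∈ P i from ⟨hi, hmin⟩)]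
        · intro j _ hj
          refine coeff_lauFilter_of_notMem f fun hj' => ?_
          rcases lt_or_gt_of_ne hj with h1 | h1
          · exact hmin j h1 hj'.1
          · exact hj'.2 i h1 hi
        · exact fun h => absurd (Finset.mem_univ i) h
      · rw [Finset.sum_eq_zero fun i _ => coeff_lauFilter_of_notMem f fun hi => he ⟨i, hi.1⟩]
        exact by_contra fun h' => he (h e h')
    rw [key, Fin.sum_univ_four]
    rfl
  refine ⟨_, hmem 0, _, neg_mem (hmem 1), _, hmem 2, _, neg_mem (hmem 3), ?_⟩
  conv_lhs => rw [hsum]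
  abel
end split

/-- The `a`-th face of a simplex. -/
abbrev face {p : ℕ} (a : Fin (p + 2)) (I : Fin (p + 2) ↪o Fin 4) : Fin (p + 1) ↪o Fin 4 :=
  (Fin.succAboveOrderEmb a).trans I

theorem range_face {p : ℕ} (a : Fin (p + 2)) (I : Fin (p + 2) ↪o Fin 4) :
    Set.range (face a I) ⊆ Set.range I := by
  rintro _ ⟨i, rfl⟩
  exact ⟨a.succAbove i, rfl⟩

theorem eq_refl_of_four (I : Fin 4 ↪o Fin 4) : I = RelEmbedding.refl _ := by
  apply OrderEmbedding.range_inj.1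
  rw [(Finite.surjective_of_injective I.injective).range_eq]
  exact (Set.range_id).symm

theorem exists_eq_face (I : Fin 3 ↪o Fin 4) : ∃ a, I = face a (RelEmbedding.refl _) := by
  have : ¬ Function.Surjective I := fun h => by
    simpa using Fintype.card_le_of_surjective I h
  obtain ⟨a, ha⟩ := not_forall.1 this
  refine ⟨a, OrderEmbedding.range_inj.1 ?_⟩
  have h1 : Set.range (face a (RelEmbedding.refl _) : Fin 3 ↪o Fin 4) = {a}ᶜ :=
    Fin.range_succAbove a
  rw [h1]
  have h2 : Set.range I ⊆ {a}ᶜ := by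
    rintro _ ⟨i, rfl⟩ h
    exact ha ⟨i, h⟩
  apply Set.eq_of_subset_of_ncard_le h2
  rw [← Set.image_univ, Set.ncard_image_of_injective _ I.injective, Set.ncard_univ, Set.ncard_compl]
  simp

section cech
variable {r : ℕ} (d : Fin r → ℤ)

/-- Čech cochains of a graded free module. -/
abbrev lcochain (v : ℤ) (p : ℕ) : Type u :=
  ∀ I : Fin (p + 1) ↪o Fin 4, (laur (k := k) d (Set.range I)).obj v

/-- The Čech differential of a graded free module. -/
def lcechD (v : ℤ) (p : ℕ) : lcochain (k := k) d v p →ₗ[k] lcochain (k := k) d v (p + 1) :=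
  LinearMap.pi fun I => ∑ a : Fin (p + 2), ((-1 : k) ^ (a : ℕ)) •
    ((laurMap d (range_face a I)).1 v).comp (LinearMap.proj (face a I))

/-- The underlying Laurent polynomials of a cochain. -/
def lraw (v : ℤ) (p : ℕ) (I : Fin (p + 1) ↪o Fin 4) : lcochain (k := k) d v p →ₗ[k] (Fin r → Lau k) :=
  (laurIncl v).comp (LinearMap.proj I)

variable {d}

theorem lraw_lcechD {v : ℤ} {p : ℕ} (y : lcochain (k := k) d v p) (I : Fin (p + 2) ↪o Fin 4) :
    lraw d v (p + 1) I (lcechD d v p y) =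
      ∑ a : Fin (p + 2), ((-1 : k) ^ (a : ℕ)) • lraw d v p (face a I) y := by
  simp only [lraw, lcechD, LinearMap.pi_apply, LinearMap.sum_apply, map_sum, LinearMap.smul_apply,
    map_smul, LinearMap.comp_apply, laurIncl_laurMap, LinearMap.proj_apply]

theorem lraw_injective {v : ℤ} {p : ℕ} {y y' : lcochain (k := k) d v p}
    (h : ∀ I, lraw d v p I y = lraw d v p I y') : y = y' := by
  funext I
  exact laur_ext (congrFun (h I))

theorem lcechD_two_one (v : ℤ) (b : lcochain (k := k) d v 1) : lcechD d v 2 (lcechD d v 1 b) = 0 := by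
  refine lraw_injective fun I => ?_
  have h3 : ∀ J : Fin 3 ↪o Fin 4, lraw d v 2 J (lcechD d v 1 b) = lraw d v 1 (face 0 J) b -
      lraw d v 1 (face 1 J) b + lraw d v 1 (face 2 J) b := fun J => by
    refine (lraw_lcechD b J).trans ((Fin.sum_univ_three _).trans ?_)
    simp [sub_eq_add_neg]
  rw [lraw_lcechD, Fin.sum_univ_four, map_zero, h3, h3, h3, h3]
  have e : ∀ (a b : Fin 4) (s t : Fin 3), (∀ i : Fin 2, a.succAbove (s.succAbove i) =
      b.succAbove (t.succAbove i)) → face s (face a I) = face t (face b I) := fun a b s t h => by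
    ext i; exact congrArg (fun j => (I j : ℕ)) (h i)
  rw [e 0 1 0 0 (by decide), e 0 2 1 0 (by decide), e 0 3 2 0 (by decide), e 1 2 1 1 (by decide),
    e 1 3 2 1 (by decide), e 2 3 2 2 (by decide)]
  have hc : ∀ a : Fin 4, ((-1 : k) ^ (a : ℕ)) = ![1, -1, 1, -1] a := fun a => by
    fin_cases a <;> simp [pow_succ]
  simp only [hc, Matrix.cons_val, one_smul, neg_one_smul]
  abel

theorem lcechD_exact (v : ℤ) (y : lcochain (k := k) d v 2) (hy : lcechD d v 2 y = 0) :
    ∃ b, lcechD d v 1 b = y := by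
  set Y : Fin 4 → Fin r → Lau k := fun a => lraw d v 2 (face a (RelEmbedding.refl _)) y with hY
  have hmem : ∀ a b, Y a b ∈ lau k {a}ᶜ (v - d b) := fun a b =>
    lau_mono (show Set.range (face a (RelEmbedding.refl _) : Fin 3 ↪o Fin 4) ⊆ {a}ᶜ from
      (Fin.range_succAbove a).le) _ (laurIncl_mem (y (face a (RelEmbedding.refl _))) b)
  have hsum : ∀ b, Y 0 b - Y 1 b + Y 2 b - Y 3 b = 0 := fun b => by
    have h1 := lraw_lcechD y (RelEmbedding.refl _)
    rw [hy, map_zero, Fin.sum_univ_four] at h1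
    have h2 := congrFun h1 b
    change 0 = ((-1 : k) ^ 0) • Y 0 b + ((-1 : k) ^ 1) • Y 1 b + ((-1 : k) ^ 2) • Y 2 b +
      ((-1 : k) ^ 3) • Y 3 b at h2
    rw [h2, pow_zero, pow_one, neg_one_sq, pow_succ, neg_one_sq, one_mul, one_smul, one_smul,
      neg_one_smul, neg_one_smul]
    abel
  have key := fun b => lau_cech_exact (hmem 0 b) (hmem 1 b) (hmem 2 b) (hmem 3 b) (hsum b)
  choose w₀₁ h₀₁ w₀₂ h₀₂ w₀₃ h₀₃ w₁₂ h₁₂ w₁₃ h₁₃ w₂₃ h₂₃ e₀ e₁ e₂ e₃ using key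
  -- Only the entries above the diagonal matter, since simplices are increasing; the rest are filled
  -- with zero.
  let w : Fin 4 → Fin 4 → Fin r → Lau k := ![![0, w₀₁, w₀₂, w₀₃], ![0, 0, w₁₂, w₁₃],
    ![0, 0, 0, w₂₃], ![0, 0, 0, 0]]
  have hw : ∀ i j b, w i j b ∈ lau k {i, j} (v - d b) := fun i j b => by
    fin_cases i <;> fin_cases j <;> first
      | exact zero_mem _ | exact h₀₁ b | exact h₀₂ b | exact h₀₃ b | exact h₁₂ b | exact h₁₃ b
      | exact h₂₃ b
  have hr : ∀ J : Fin 2 ↪o Fin 4, ({J 0, J 1} : Set (Fin 4)) ⊆ Set.range J := fun J => by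
    rintro _ (rfl | rfl) <;> exact Set.mem_range_self _
  let b : lcochain (k := k) d v 1 := fun J c => ⟨w (J 0) (J 1) c, lau_mono (hr J) _ (hw _ _ c)⟩
  have hb : ∀ J, lraw d v 1 J b = w (J 0) (J 1) := fun J => rfl
  refine ⟨b, lraw_injective fun I => ?_⟩
  obtain ⟨a, rfl⟩ := exists_eq_face I
  rw [lraw_lcechD, Fin.sum_univ_three, hb, hb, hb]
  funext c
  change ((-1 : k) ^ 0) • w (a.succAbove 1) (a.succAbove 2) c +
    ((-1 : k) ^ 1) • w (a.succAbove 0) (a.succAbove 2) c +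
    ((-1 : k) ^ 2) • w (a.succAbove 0) (a.succAbove 1) c = Y a c
  rw [pow_zero, pow_one, neg_one_sq, one_smul, one_smul, neg_one_smul, ← sub_eq_add_neg]
  fin_cases a
  exacts [(e₀ c).symm, (e₁ c).symm, (e₂ c).symm, (e₃ c).symm]

/-- The residue of a Čech cochain of degree three. -/
def lresidue (d : Fin r → ℤ) (v : ℤ) : lcochain (k := k) d v 3 →ₗ[k] (dualFree (k := k) d).obj v :=
  ((residue d _).1 v).comp (LinearMap.proj (RelEmbedding.refl _))

theorem range_refl : Set.range (RelEmbedding.refl (· ≤ ·) : Fin 4 ↪o Fin 4) = Set.univ := Set.range_id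

theorem lresidue_surjective (v : ℤ) : Function.Surjective (lresidue (k := k) d v) := by
  intro ξ
  obtain ⟨x, hx⟩ := residue_surjective range_refl v ξ
  refine ⟨fun I => (eq_refl_of_four I) ▸ x, hx⟩

theorem lcochain_three_ext {v : ℤ} {f g : lcochain (k := k) d v 3}
    (h : lraw d v 3 (RelEmbedding.refl _) f = lraw d v 3 (RelEmbedding.refl _) g) : f = g :=
  lraw_injective fun I => by rw [eq_refl_of_four I, h]

/-- A cochain on the intersection of all charts is a coboundary precisely when no exponent is
negative in all entries, which is the vanishing of the residue. Together with `lresidue_surjective`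
this computes H³ of a free module. -/
theorem lresidue_exact (v : ℤ) : Function.Exact (lcechD (k := k) d v 2) (lresidue d v) := by
  intro f
  refine (residue_eq_zero_iff v (f (RelEmbedding.refl _))).trans ⟨fun h => ?_, ?_⟩
  · have key := fun c => lau_split (lau_mono (Set.subset_univ _) _
      (laurIncl_mem (f (RelEmbedding.refl _)) c)) (h c)
    choose y₀ h₀ y₁ h₁ y₂ h₂ y₃ h₃ e using key
    let Y : Fin 4 → Fin r → Lau k := ![y₀, y₁, y₂, y₃]
    have hY : ∀ a c, Y a c ∈ lau k {a}ᶜ (v - d c) := fun a c => by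
      fin_cases a
      exacts [h₀ c, h₁ c, h₂ c, h₃ c]
    have hI : ∀ I : Fin 3 ↪o Fin 4, ∃ a, I = face a (RelEmbedding.refl _) := exists_eq_face
    choose a ha using hI
    have hr : ∀ I : Fin 3 ↪o Fin 4, ({a I}ᶜ : Set (Fin 4)) ⊆ Set.range I := fun I => by
      conv_rhs => rw [ha I]
      exact (Fin.range_succAbove (a I)).ge
    have haa : ∀ b, a (face b (RelEmbedding.refl _)) = b := fun b => by
      have := congrArg (fun I : Fin 3 ↪o Fin 4 => Set.range I) (ha (face b (RelEmbedding.refl _)))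
      exact (Set.singleton_injective (compl_injective ((Fin.range_succAbove b).symm.trans
        (this.trans (Fin.range_succAbove _))))).symm
    let y : lcochain (k := k) d v 2 := fun I c => ⟨Y (a I) c, lau_mono (hr I) _ (hY _ c)⟩
    have hy : ∀ b, lraw d v 2 (face b (RelEmbedding.refl _)) y = Y b := fun b =>
      congrArg Y (haa b)
    refine ⟨y, lcochain_three_ext ?_⟩
    rw [lraw_lcechD, Fin.sum_univ_four, hy, hy, hy, hy]
    funext c
    change ((-1 : k) ^ 0) • y₀ c + ((-1 : k) ^ 1) • y₁ c + ((-1 : k) ^ 2) • y₂ c +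
      ((-1 : k) ^ 3) • y₃ c = _
    rw [pow_zero, pow_one, neg_one_sq, pow_succ, neg_one_sq, one_mul, one_smul, one_smul,
      neg_one_smul, neg_one_smul, ← sub_eq_add_neg, ← sub_eq_add_neg]
    exact (e c).symm
  · rintro ⟨y, rfl⟩ c e he
    change (lraw d v 3 (RelEmbedding.refl _) (lcechD d v 2 y) c).coeff e ≠ 0 at he
    rw [lraw_lcechD, Finset.sum_apply, AddMonoidAlgebra.coeff_sum, Finset.sum_apply'] at he
    obtain ⟨a, _, ha⟩ := Finset.exists_ne_zero_of_sum_ne_zero he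
    rw [Pi.smul_apply, AddMonoidAlgebra.coeff_smul, Finsupp.smul_apply] at ha
    have := lau_mono (show Set.range (face a (RelEmbedding.refl _) : Fin 3 ↪o Fin 4) ⊆ {a}ᶜ from
      (Fin.range_succAbove a).le) _ (laurIncl_mem (y (face a (RelEmbedding.refl _))) c) e
        (right_ne_zero_of_smul ha)
    exact ⟨a, this.2 a fun h => h rfl⟩
end cech

end P3

end

/-! ### Sections of the twists over intersections of charts -/

noncomputable section
universe u
open AlgebraicGeometry CategoryTheory TopologicalSpace
namespace P3
attribute [local instance] MvPolynomial.gradedAlgebra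
variable {k : Type u} [Field k]
open GrMod (poly hom homDeg free X_mul_mem_poly)

section chart
variable (F : (space k).Modules) {U V : (space k).Opens} {i j : Fin 4}

theorem exists_ratio_pow_smul_eq_zero (hF : F.IsQuasicoherent) (hU : IsAffineOpen U) (hVU : V ≤ U)
    (hj : U ≤ chart k j) (hV : V = U ⊓ chart k i) (s : Γ(F, U)) (hs : res F hVU s = 0) :
    ∃ n : ℕ, ratio j i U hj ^ n • s = 0 :=
  exists_pow_smul_eq_zero F hF hU (ratio j i U hj) hVU (by rw [hV, basicOpen_ratio]) s hs

theorem exists_res_eq_ratio_pow_smul (hF : F.IsQuasicoherent) (hU : IsAffineOpen U) (hVU : V ≤ U)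
    (hj : U ≤ chart k j) (hV : V = U ⊓ chart k i) (t : Γ(F, V)) :
    ∃ (n : ℕ) (s : Γ(F, U)), res F hVU s = ratio j i V (hVU.trans hj) ^ n • t := by
  obtain ⟨n, s, hs⟩ := exists_resOf_eq_pow_smul F hF hU (ratio j i U hj) hVU
    (by rw [hV, basicOpen_ratio]) t
  refine ⟨n, s, hs.trans ?_⟩
  rw [← ratio_res j i hVU hj]; rfl

theorem res_ratio_pow_smul (l : Fin 4) (h : U ≤ V) (hV : V ≤ chart k l) (n : ℕ) (s : Γ(F, V)) :
    res F h (ratio l i V hV ^ n • s) = ratio l i U (h.trans hV) ^ n • res F h s := by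
  rw [res_smul, map_pow, ratio_res]

theorem ratio_pow_mul_transition (v : ℤ) (n : ℕ) (i j l : Fin 4) (U : (space k).Opens)
    (hi : U ≤ chart k i) (hj : U ≤ chart k j) :
    ratio i l U hi ^ n * transition v i j U hi hj =
      transition (v + n) i j U hi hj * ratio j l U hj ^ n := by
  induction n with
  | zero => simp
  | succ n ih =>
    rw [pow_succ', mul_assoc, ih, ← mul_assoc, ratio_mul_transition, mul_assoc, ← pow_succ']
    congr 2
    push_cast; ring
end chart

variable (F : (space k).Modules)

/-- The graded module `⨁_v Γ(U, F(v))`. -/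
def twMod (U : (space k).Opens) : GrMod k where
  obj v := Tw F v U
  X l v w hw := mulX F l v w hw U
  X_comm l m v w y hw hy s := mulX_comm F l m v w y hw hy U s

/-- Restriction of sections of all twists. -/
def twRes {U V : (space k).Opens} (h : U ≤ V) : hom (twMod F V) (twMod F U) :=
  ⟨fun v => twistRes F v h, fun l v w hw s => twistRes_mulX F l v w hw h s⟩

theorem twRes_twRes {U V W : (space k).Opens} (h : U ≤ V) (h' : V ≤ W) (v : ℤ)
    (s : (twMod F W).obj v) :
    (twRes F h).1 v ((twRes F h').1 v s) = (twRes F (h.trans h')).1 v s :=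
  Subtype.ext (funext fun _ => res_res F _ _ _)

theorem comp_twRes {U V W : (space k).Opens} (h : U ≤ V) (h' : V ≤ W) :
    comp (twRes F h) (twRes F h') = twRes F (h.trans h') :=
  hom_ext fun v x => twRes_twRes F h h' v x

variable {F} {U : (space k).Opens}

/-- The coordinates of a section of a twist. -/
def twCoord {v : ℤ} (s : (twMod F U).obj v) (j : Fin 4) : Γ(F, U ⊓ chart k j) := s.1 j

theorem tw_ext {v : ℤ} {s t : (twMod F U).obj v} (h : ∀ j, twCoord s j = twCoord t j) : s = t :=
  Subtype.ext (funext h)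

theorem twCoord_X (l : Fin 4) (v w : ℤ) (hw : v + 1 = w) (s : (twMod F U).obj v) (j : Fin 4) :
    twCoord ((twMod F U).X l v w hw s) j = ratio j l (U ⊓ chart k j) inf_le_right • twCoord s j :=
  rfl

theorem twCoord_zero (v : ℤ) (j : Fin 4) : twCoord (0 : (twMod F U).obj v) j = 0 := rfl

theorem twCoord_res {V : (space k).Opens} (h : U ≤ V) (v : ℤ) (s : (twMod F V).obj v) (j : Fin 4) :
    twCoord ((twRes F h).1 v s) j = res F (inf_le_inf_right (chart k j) h) (twCoord s j) := rfl

theorem twCoord_pmul (l : Fin 4) (n : ℕ) (v w : ℤ) (hw : v + n = w) (s : (twMod F U).obj v)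
    (j : Fin 4) : twCoord (pmul _ v w (MvPolynomial.X l ^ n) s) j =
      ratio j l (U ⊓ chart k j) inf_le_right ^ n • twCoord s j := by
  induction n generalizing w with
  | zero =>
    obtain rfl : v = w := by simpa using hw
    rw [pow_zero, pmul_one, pow_zero, one_smul]
  | succ n ih =>
    rw [pow_succ', pmul_X_mul l v (v + n) w (by push_cast at hw; omega), twCoord_X, ih _ rfl,
      smul_smul, ← pow_succ']

/-- On an open set inside D₊(X_i), the inverse multiplies the j-th coordinate by X_j / X_i. -/
theorem bijective_X {i : Fin 4} (hU : U ≤ chart k i) (v w : ℤ) (hw : v + 1 = w) :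
    Function.Bijective ((twMod F U).X i v w hw) := by
  have hu : ∀ j, ratio j i (U ⊓ chart k j) inf_le_right *
      ratio i j (U ⊓ chart k j) (inf_le_left.trans hU) = 1 := fun j => by
    rw [ratio_mul_ratio, ratio_self]
  constructor
  · rw [injective_iff_map_eq_zero]
    intro s hs
    refine tw_ext fun j => ?_
    have h1 : twCoord _ j = twCoord _ j := congrArg (twCoord · j) hs
    rw [twCoord_X] at h1
    rw [← one_smul Γ(space k, U ⊓ chart k j) (twCoord s j), ← hu j, mul_comm, mul_smul, h1,
      twCoord_zero, twCoord_zero, smul_zero]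
  · subst hw
    intro t
    refine ⟨⟨fun j => ratio i j (U ⊓ chart k j) (inf_le_left.trans hU) • t.1 j, fun j l => ?_⟩,
      tw_ext fun j => ?_⟩
    · set A := (U ⊓ chart k j) ⊓ (U ⊓ chart k l) with hA
      have hAj : A ≤ chart k j := inf_le_left.trans inf_le_right
      have hAl : A ≤ chart k l := inf_le_right.trans inf_le_right
      have hAi : A ≤ chart k i := inf_le_left.trans (inf_le_left.trans hU)
      rw [res_smul, res_smul, ratio_res, ratio_res, t.2 j l, smul_smul, smul_smul]
      congr 1
      have h1 := ratio_mul_transition v j l i A hAj hAl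
      have h2 : ratio i j A hAi * ratio j i A hAj = 1 := by rw [ratio_mul_ratio, ratio_self]
      have h3 : ratio l i A hAl * ratio i l A hAi = 1 := by rw [ratio_mul_ratio, ratio_self]
      linear_combination (- ratio i j A hAi * ratio i l A hAi) * h1 +
        (ratio i l A hAi * transition v j l A hAj hAl) * h2 -
        (ratio i j A hAi * transition (v + 1) j l A hAj hAl) * h3
    · change ratio j i _ _ • ratio i j _ _ • t.1 j = t.1 j
      rw [smul_smul, hu, one_smul]

/-- If X_i f_j = X_j f_i, then u = f_j / X_j is independent of j. Its coordinate with respect to X_j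
^ v is that of f_j with respect to X_j ^ (v + 1), so the diagonal coordinates of the f_j glue to u.
-/
theorem koszulExact_H0star : KoszulExact (H0star F) := by
  intro v w y hw hy f₀ f₁ f₂ f₃ h₀₁ h₀₂ h₀₃ h₁₂ h₁₃ h₂₃
  set f : Fin 4 → (twMod F ⊤).obj w := ![f₀, f₁, f₂, f₃] with hf
  have hf' : ∀ i j, (twMod F ⊤).X i w y hy (f j) = (twMod F ⊤).X j w y hy (f i) := by
    intro i j
    fin_cases i <;> fin_cases j
    exacts [rfl, h₀₁, h₀₂, h₀₃, h₀₁.symm, rfl, h₁₂, h₁₃, h₀₂.symm, h₁₂.symm, rfl, h₂₃, h₀₃.symm,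
      h₁₃.symm, h₂₃.symm, rfl]
  subst hw
  have hcoord : ∀ i j, twCoord (f i) j =
      ratio j i ((⊤ : (space k).Opens) ⊓ chart k j) inf_le_right • twCoord (f j) j := fun i j => by
    have h1 : twCoord _ j = twCoord _ j := congrArg (twCoord · j) (hf' i j)
    rw [twCoord_X, twCoord_X, ratio_self, one_smul] at h1
    exact h1.symm
  let u : (twMod F ⊤).obj v := ⟨fun j => twCoord (f j) j, fun i j => by
    set A := ((⊤ : (space k).Opens) ⊓ chart k i) ⊓ (⊤ ⊓ chart k j) with hA
    have hAi : A ≤ chart k i := inf_le_left.trans inf_le_right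
    have hAj : A ≤ chart k j := inf_le_right.trans inf_le_right
    have h1 := (f j).2 i j
    change res F _ (twCoord (f j) i) = _ at h1
    rw [hcoord j i, res_smul, ratio_res] at h1
    have h2 := congrArg (fun s => ratio j i A hAj • s) h1
    simp only [smul_smul] at h2
    have h3 : ratio j i A hAj * ratio i j A hAi = 1 := by rw [ratio_mul_ratio, ratio_self]
    have h4 : ratio j i A hAj * transition (v + 1) i j A hAi hAj = transition v i j A hAi hAj := by
      rw [mul_comm, ← ratio_mul_transition, ratio_self, one_mul]
    rw [h3, one_smul, h4] at h2
    exact h2⟩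
  have hu : ∀ i, f i = (twMod F ⊤).X i v _ rfl u := fun i => tw_ext fun j => hcoord i j
  exact ⟨u, hu 0, hu 1, hu 2, hu 3⟩

/-- Open sets whose intersections with the charts are affine. -/
def Good (U : (space k).Opens) : Prop := ∀ j, IsAffineOpen (U ⊓ chart k j)

theorem good_top : Good (⊤ : (space k).Opens) := fun j => by
  rw [top_inf_eq]; exact isAffineOpen_chart j

theorem Good.isAffineOpen_inf (hU : Good U) (i j : Fin 4) :
    IsAffineOpen ((U ⊓ chart k j) ⊓ chart k i) := by
  rw [← basicOpen_ratio j i (U ⊓ chart k j) inf_le_right]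
  exact (hU j).basicOpen _

theorem Good.inf (hU : Good U) (i : Fin 4) : Good (U ⊓ chart k i) := fun j => by
  rw [inf_right_comm]; exact hU.isAffineOpen_inf i j

/-- The classical extension argument for sections of twists, applied to coordinates on the finitely
many affine pieces U ∩ D₊(X_j). -/
theorem isLoc_twRes_inf (hF : F.IsQuasicoherent) (hU : Good U) {i : Fin 4}
    {V : (space k).Opens} (hV : V = U ⊓ chart k i) (hVU : V ≤ U) : IsLoc {i} (twRes F hVU) where
  inv := by
    rintro _ rfl
    exact bijective_X (hV.le.trans inf_le_right)
  ker v s hs := by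
    have h : ∀ j, ∃ n : ℕ, ratio j i (U ⊓ chart k j) inf_le_right ^ n • twCoord s j = 0 := fun j => by
      refine exists_ratio_pow_smul_eq_zero F hF (hU j) (inf_le_inf_right (chart k j) hVU)
        inf_le_right (by rw [hV, inf_right_comm]) _ ?_
      exact congrArg (twCoord · j) hs
    choose n hn using h
    refine ⟨_, _, MonIn.X_pow (Set.mem_singleton i) (∑ j, n j), _, rfl, tw_ext fun j => ?_⟩
    rw [twCoord_pmul i _ _ _ rfl]
    have : n j ≤ ∑ j, n j := Finset.single_le_sum (fun _ _ => Nat.zero_le _) (Finset.mem_univ j)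
    rw [← Nat.sub_add_cancel this, pow_add, mul_smul, hn, smul_zero, twCoord_zero]
  surj v t := by
    have h : ∀ j, ∃ (n : ℕ) (s : Γ(F, U ⊓ chart k j)), res F (inf_le_inf_right (chart k j) hVU) s =
        ratio j i (V ⊓ chart k j) inf_le_right ^ n • twCoord t j := fun j =>
      exists_res_eq_ratio_pow_smul F hF (hU j) _ inf_le_right (by rw [hV, inf_right_comm]) _
    choose n s hs using h
    -- One exponent N serves all coordinates; the extended coordinates then agree on overlaps only
    -- after restriction to V.
    set N := ∑ j, n j with hN
    have hnN : ∀ j, n j ≤ N := fun j =>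
      Finset.single_le_sum (fun _ _ => Nat.zero_le _) (Finset.mem_univ j)
    obtain ⟨s', hs'⟩ : ∃ s' : ∀ j, Γ(F, U ⊓ chart k j), ∀ j,
        res F (inf_le_inf_right (chart k j) hVU) (s' j) =
          ratio j i (V ⊓ chart k j) inf_le_right ^ N • twCoord t j :=
      ⟨fun j => ratio j i (U ⊓ chart k j) inf_le_right ^ (N - n j) • s j, fun j => by
        rw [res_ratio_pow_smul, hs, smul_smul, ← pow_add, Nat.sub_add_cancel (hnN j)]⟩
    have hδ : ∀ j l, ∃ m : ℕ, ratio j i ((U ⊓ chart k j) ⊓ (U ⊓ chart k l))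
        (inf_le_left.trans inf_le_right) ^ m •
        (res F (inf_le_left : (U ⊓ chart k j) ⊓ (U ⊓ chart k l) ≤ _) (s' j) -
          transition (v + N) j l ((U ⊓ chart k j) ⊓ (U ⊓ chart k l)) (inf_le_left.trans inf_le_right)
            (inf_le_right.trans inf_le_right) • res F inf_le_right (s' l)) = 0 := fun j l => by
      have hA : (U ⊓ chart k j) ⊓ (U ⊓ chart k l) = (U ⊓ chart k j) ⊓ chart k l := by
        rw [inf_inf_inf_comm, inf_idem, inf_assoc]
      refine exists_ratio_pow_smul_eq_zero F hF (hA ▸ hU.isAffineOpen_inf l j)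
        (V := (V ⊓ chart k j) ⊓ (V ⊓ chart k l))
        (inf_le_inf (inf_le_inf_right _ hVU) (inf_le_inf_right _ hVU)) _ ?_ _ ?_
      · ext x
        simp only [hV, Opens.coe_inf, Set.mem_inter_iff]
        tauto
      · rw [map_sub, res_res, res_smul, transition_res, res_res,
          ← res_res F (inf_le_left : (V ⊓ chart k j) ⊓ (V ⊓ chart k l) ≤ _)
            (inf_le_inf_right (chart k j) hVU),
          ← res_res F (inf_le_right : (V ⊓ chart k j) ⊓ (V ⊓ chart k l) ≤ _)
            (inf_le_inf_right (chart k l) hVU), hs', hs', res_ratio_pow_smul, res_ratio_pow_smul,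
          smul_smul, ← ratio_pow_mul_transition, mul_smul, sub_eq_zero]
        exact congrArg (_ • ·) (t.2 j l)
    choose m hm using hδ
    -- A further power M of X_i kills all the differences on overlaps, so that the coordinates glue
    -- to a section of the twist by v + N + M.
    set M := ∑ j, ∑ l, m j l with hM
    have hmM : ∀ j l, m j l ≤ M := fun j l =>
      (Finset.single_le_sum (f := fun l => m j l) (fun _ _ => Nat.zero_le _) (Finset.mem_univ l)).trans
        (Finset.single_le_sum (f := fun j => ∑ l, m j l) (fun _ _ => Nat.zero_le _) (Finset.mem_univ j))
    refine ⟨_, _, MonIn.X_pow (Set.mem_singleton i) (M + N), v + N + M, by push_cast; ring,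
      ⟨fun j => ratio j i (U ⊓ chart k j) inf_le_right ^ M • s' j, fun j l => ?_⟩,
      tw_ext fun j => ?_⟩
    · rw [res_ratio_pow_smul, res_ratio_pow_smul, smul_smul, ← ratio_pow_mul_transition, mul_smul,
        ← sub_eq_zero, ← smul_sub, ← Nat.sub_add_cancel (hmM j l), pow_add, mul_smul, hm, smul_zero]
    · rw [twCoord_pmul i _ _ _ (by push_cast; ring)]
      change res F (inf_le_inf_right (chart k j) hVU) (_ • s' j) = _
      rw [res_ratio_pow_smul, hs', smul_smul, pow_add]

theorem isLoc_twRes_iInf (hF : F.IsQuasicoherent) (s : Finset (Fin 4)) :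
    Good (⨅ i ∈ s, chart k i) ∧
      IsLoc (s : Set (Fin 4)) (twRes F (le_top : ⨅ i ∈ s, chart k i ≤ ⊤)) := by
  classical
  -- The open set is generalized so that equalities of opens can be substituted in the dependent
  -- statement.
  suffices h : ∀ W : (space k).Opens, W = ⨅ i ∈ s, chart k i → Good W ∧
      IsLoc (s : Set (Fin 4)) (twRes F (le_top : W ≤ ⊤)) from h _ rfl
  induction s using Finset.induction_on with
  | empty =>
    intro W hW
    obtain rfl : W = ⊤ := by simpa using hW
    refine ⟨good_top, ?_, ?_, ?_⟩
    · intro i hi; simp at hi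
    · intro v t
      refine ⟨0, 1, .one, v, by simp, t, ?_⟩
      rw [pmul_one]
      refine tw_ext fun j => ?_
      rw [twCoord_res]
      exact resOf_self F _
    · intro v s hs
      refine ⟨0, 1, .one, v, by simp, ?_⟩
      rw [pmul_one, ← hs]
      refine tw_ext fun j => ?_
      rw [twCoord_res]
      exact (resOf_self F _).symm
  | insert i s hi ih =>
    intro W hW
    obtain ⟨h1, h2⟩ := ih _ rfl
    obtain rfl : W = (⨅ i ∈ s, chart k i) ⊓ chart k i := by
      rw [hW, Finset.iInf_insert, inf_comm]
    refine ⟨h1.inf i, ?_⟩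
    have h3 := h2.comp (isLoc_twRes_inf hF h1 (i := i) rfl inf_le_left) (by
      rintro j (hj | rfl)
      · exact bijective_X (inf_le_left.trans (iInf₂_le j hj))
      · exact bijective_X inf_le_right)
    rw [Finset.coe_insert, ← Set.union_singleton]
    rwa [comp_twRes] at h3

theorem isLoc_twRes_inter (hF : F.IsQuasicoherent) {p : ℕ} (I : Fin (p + 1) ↪o Fin 4) :
    IsLoc (Set.range I) (twRes F (le_top : inter k I ≤ ⊤)) := by
  classical
  have h : inter k I = ⨅ i ∈ Finset.univ.image I, chart k i := by
    simp only [Finset.mem_image, Finset.mem_univ, true_and, iInf_exists]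
    rw [iInf_comm, inter]
    simp
  have h1 := (isLoc_twRes_iInf hF (Finset.univ.image I)).2
  rw [Finset.coe_image, Finset.coe_univ, Set.image_univ] at h1
  revert h1
  generalize_proofs h2 h3
  revert h2 h3
  rw [← h]
  exact fun _ _ h => h

end P3

end

/-! ### The connecting homomorphism and cokernels, abstractly -/

noncomputable section
universe u
namespace P3
variable {k : Type u} [Field k]
open GrMod (poly hom homDeg free)

section snake
variable {C₁ C₂ C₃ C₁₀ C₂₀ C₃₀ C₂₁ C₃₁ C₃₂ B₀ B₁ B₂ : Type*}
  [AddCommGroup C₁] [Module k C₁] [AddCommGroup C₂] [Module k C₂] [AddCommGroup C₃] [Module k C₃]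
  [AddCommGroup C₁₀] [Module k C₁₀] [AddCommGroup C₂₀] [Module k C₂₀] [AddCommGroup C₃₀]
  [Module k C₃₀] [AddCommGroup C₂₁] [Module k C₂₁] [AddCommGroup C₃₁] [Module k C₃₁]
  [AddCommGroup C₃₂] [Module k C₃₂] [AddCommGroup B₀] [Module k B₀] [AddCommGroup B₁] [Module k B₁]
  [AddCommGroup B₂] [Module k B₂]
  {δ₁ : C₁ →ₗ[k] C₂} {δ₂ : C₂ →ₗ[k] C₃} {d₁ : C₁₀ →ₗ[k] C₂₀} {d₂ : C₂₀ →ₗ[k] C₃₀}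
  {e₂ : C₂₁ →ₗ[k] C₃₁} {D₂ : C₂₁ →ₗ[k] C₂₀} {D₃ : C₃₁ →ₗ[k] C₃₀} {G₃ : C₃₂ →ₗ[k] C₃₁}
  {θ₁ : C₁₀ →ₗ[k] C₁} {θ₂ : C₂₀ →ₗ[k] C₂} {θ₃ : C₃₀ →ₗ[k] C₃}
  {ρ₀ : C₃₀ →ₗ[k] B₀} {ρ₁ : C₃₁ →ₗ[k] B₁} {ρ₂ : C₃₂ →ₗ[k] B₂} {T₀ : B₁ →ₗ[k] B₀} {T₁ : B₂ →ₗ[k] B₁}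

theorem exists_lift_cocycle (hθ₂ : Function.Surjective θ₂) (hδ₂ : ∀ y, δ₂ (θ₂ y) = θ₃ (d₂ y))
    (hD₃ : Function.Exact D₃ θ₃) {z : C₂} (hz : δ₂ z = 0) : ∃ y f, d₂ y = D₃ f ∧ θ₂ y = z := by
  obtain ⟨y, rfl⟩ := hθ₂ z
  obtain ⟨f, hf⟩ := (hD₃ (d₂ y)).1 (by rw [← hδ₂, hz])
  exact ⟨y, f, hf.symm, rfl⟩

/-- The connecting homomorphism of the Čech complexes of a presentation. -/
theorem exists_connecting (hθ₁ : Function.Surjective θ₁) (hθ₂ : Function.Surjective θ₂)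
    (hδ₁ : ∀ y, δ₁ (θ₁ y) = θ₂ (d₁ y)) (hδ₂ : ∀ y, δ₂ (θ₂ y) = θ₃ (d₂ y))
    (hD₂ : Function.Exact D₂ θ₂) (hD₃ : Function.Exact D₃ θ₃) (hG₃ : Function.Exact G₃ D₃)
    (hdD : ∀ y, d₂ (D₂ y) = D₃ (e₂ y)) (hd : Function.Exact d₁ d₂)
    (hρ₀ : Function.Exact d₂ ρ₀) (hρ₁ : Function.Exact e₂ ρ₁) (hρ₁s : Function.Surjective ρ₁)
    (hρ₂s : Function.Surjective ρ₂) (hT₀ : ∀ f, ρ₀ (D₃ f) = T₀ (ρ₁ f))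
    (hT₁ : ∀ f, ρ₁ (G₃ f) = T₁ (ρ₂ f)) :
    ∃ i : (LinearMap.ker δ₂ ⧸ (LinearMap.range δ₁).submoduleOf (LinearMap.ker δ₂)) →ₗ[k]
        B₁ ⧸ LinearMap.range T₁, Function.Injective i ∧
      (∀ y f (hz : θ₂ y ∈ LinearMap.ker δ₂), d₂ y = D₃ f →
        i (Submodule.Quotient.mk ⟨θ₂ y, hz⟩) = Submodule.Quotient.mk (ρ₁ f)) ∧
      ∀ b, Submodule.Quotient.mk b ∈ LinearMap.range i ↔ T₀ b = 0 := by
  -- W is the correspondence behind the connecting map: y lifts a cocycle of F, and f lifts its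
  -- coboundary to P_1. The map sends the class of θ₂ y, read by α, to that of ρ₁ f, read by β.
  let W : Submodule k (C₂₀ × C₃₁) := LinearMap.ker (d₂.comp (LinearMap.fst k C₂₀ C₃₁) -
    D₃.comp (LinearMap.snd k C₂₀ C₃₁))
  have hW : ∀ x : W, d₂ x.1.1 = D₃ x.1.2 := fun x => sub_eq_zero.1 x.2
  have hker : ∀ x : W, θ₂ x.1.1 ∈ LinearMap.ker δ₂ := fun x => by
    rw [LinearMap.mem_ker, hδ₂, hW, hD₃.apply_apply_eq_zero]
  let α : W →ₗ[k] (LinearMap.ker δ₂ ⧸ (LinearMap.range δ₁).submoduleOf (LinearMap.ker δ₂)) :=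
    (Submodule.mkQ _).comp ((θ₂.comp ((LinearMap.fst k _ _).comp W.subtype)).codRestrict _ hker)
  let β : W →ₗ[k] B₁ ⧸ LinearMap.range T₁ :=
    (Submodule.mkQ _).comp (ρ₁.comp ((LinearMap.snd k _ _).comp W.subtype))
  have hα : ∀ x, α x = 0 ↔ ∃ t, δ₁ t = θ₂ x.1.1 := fun x => Submodule.Quotient.mk_eq_zero _
  have hβ : ∀ x, β x = 0 ↔ ∃ b, T₁ b = ρ₁ x.1.2 := fun x => Submodule.Quotient.mk_eq_zero _
  have hαs : Function.Surjective α := fun z => by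
    obtain ⟨⟨z, hz⟩, rfl⟩ := Submodule.Quotient.mk_surjective _ z
    obtain ⟨y, f, h, rfl⟩ := exists_lift_cocycle hθ₂ hδ₂ hD₃ hz
    exact ⟨⟨(y, f), sub_eq_zero.2 h⟩, rfl⟩
  -- Equality of the kernels gives at once that the connecting map is well defined and that it is
  -- injective.
  have hαβ : ∀ x, α x = 0 ↔ β x = 0 := fun x => by
    rw [hα, hβ]
    constructor
    · rintro ⟨t, ht⟩
      obtain ⟨u, rfl⟩ := hθ₁ t
      obtain ⟨g, hg⟩ := (hD₂ (x.1.1 - d₁ u)).1 (by rw [map_sub, ← ht, hδ₁, sub_self])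
      obtain ⟨c, hc⟩ := (hG₃ (x.1.2 - e₂ g)).1 (by
        rw [map_sub, ← hW, ← hdD, hg, map_sub, hd.apply_apply_eq_zero, sub_zero, sub_self])
      refine ⟨ρ₂ c, ?_⟩
      rw [← hT₁, hc, map_sub, hρ₁.apply_apply_eq_zero, sub_zero]
    · rintro ⟨b, hb⟩
      obtain ⟨c, rfl⟩ := hρ₂s b
      obtain ⟨g, hg⟩ := (hρ₁ (x.1.2 - G₃ c)).1 (by rw [map_sub, hT₁, hb, sub_self])
      obtain ⟨u, hu⟩ := (hd (x.1.1 - D₂ g)).1 (by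
        rw [map_sub, hW, hdD, hg, map_sub, hG₃.apply_apply_eq_zero, sub_zero, sub_self])
      refine ⟨θ₁ u, ?_⟩
      rw [hδ₁, hu, map_sub, hD₂.apply_apply_eq_zero, sub_zero]
  obtain ⟨i, hi⟩ := exists_comp_eq_of_ker_le α β fun x hx => (hαβ x).1 hx
  have hi' : ∀ x, i (α x) = β x := LinearMap.congr_fun hi
  refine ⟨i, ?_, fun y f hz h => hi' ⟨(y, f), sub_eq_zero.2 h⟩, fun b => ⟨?_, fun hb => ?_⟩⟩
  · rw [injective_iff_map_eq_zero]
    intro z hz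
    obtain ⟨x, rfl⟩ := hαs z
    rw [hi'] at hz
    exact (hαβ x).2 hz
  · rintro ⟨z, hz⟩
    obtain ⟨x, rfl⟩ := hαs z
    rw [hi'] at hz
    obtain ⟨c, hc⟩ : b - ρ₁ x.1.2 ∈ LinearMap.range T₁ := (Submodule.Quotient.eq _).1 hz.symm
    obtain ⟨c, rfl⟩ := hρ₂s c
    rw [← sub_add_cancel b (ρ₁ x.1.2), ← hc, map_add, ← hT₁, ← hT₀, ← hT₀, hG₃.apply_apply_eq_zero,
      ← hW, hρ₀.apply_apply_eq_zero, map_zero, add_zero]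
  · obtain ⟨f, rfl⟩ := hρ₁s b
    rw [← hT₀] at hb
    obtain ⟨y, hy⟩ := (hρ₀ _).1 hb
    exact ⟨α ⟨(y, f), sub_eq_zero.2 hy⟩, hi' _⟩

theorem finrank_eq_of_ker_eq {V A B : Type*} [AddCommGroup V] [Module k V] [AddCommGroup A] [Module k A]
    [AddCommGroup B] [Module k B] (f : V →ₗ[k] A) (g : V →ₗ[k] B) (hf : Function.Surjective f)
    (hg : Function.Surjective g) (h : ∀ x, f x = 0 ↔ g x = 0) :
    Module.finrank k A = Module.finrank k B := by
  have hk : LinearMap.ker f = LinearMap.ker g := Submodule.ext h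
  rw [← (f.quotKerEquivOfSurjective hf).finrank_eq, hk, (g.quotKerEquivOfSurjective hg).finrank_eq]

/-- Right exactness of the top cohomology: both quotients are quotients of C₃₀ by the same kernel,
namely the sum of the images of d₂ and D₃. -/
theorem finrank_top_cohomology (hθ₂ : Function.Surjective θ₂) (hθ₃ : Function.Surjective θ₃)
    (hδ₂ : ∀ y, δ₂ (θ₂ y) = θ₃ (d₂ y)) (hD₃ : Function.Exact D₃ θ₃)
    (hρ₀ : Function.Exact d₂ ρ₀) (hρ₀s : Function.Surjective ρ₀) (hρ₁s : Function.Surjective ρ₁)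
    (hT₀ : ∀ f, ρ₀ (D₃ f) = T₀ (ρ₁ f)) {K : Submodule k C₃} (hK : K = ⊤) :
    Module.finrank k (K ⧸ (LinearMap.range δ₂).submoduleOf K) =
      Module.finrank k (B₀ ⧸ LinearMap.range T₀) := by
  subst hK
  refine finrank_eq_of_ker_eq
    ((Submodule.mkQ _).comp (θ₃.codRestrict ⊤ fun _ => Submodule.mem_top))
    ((Submodule.mkQ (LinearMap.range T₀)).comp ρ₀) ?_ ((Submodule.mkQ_surjective _).comp hρ₀s) fun x => ?_
  · refine (Submodule.mkQ_surjective _).comp fun c => ?_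
    obtain ⟨x, hx⟩ := hθ₃ c.1
    exact ⟨x, Subtype.ext hx⟩
  · refine (Submodule.Quotient.mk_eq_zero _).trans (Iff.trans ?_ (Submodule.Quotient.mk_eq_zero _).symm)
    change (∃ t, δ₂ t = θ₃ x) ↔ ∃ b, T₀ b = ρ₀ x
    constructor
    · rintro ⟨t, ht⟩
      obtain ⟨y, rfl⟩ := hθ₂ t
      obtain ⟨f, hf⟩ := (hD₃ (x - d₂ y)).1 (by rw [map_sub, ← ht, hδ₂, sub_self])
      refine ⟨ρ₁ f, ?_⟩
      rw [← hT₀, hf, map_sub, hρ₀.apply_apply_eq_zero, sub_zero]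
    · rintro ⟨b, hb⟩
      obtain ⟨f, rfl⟩ := hρ₁s b
      obtain ⟨y, hy⟩ := (hρ₀ (x - D₃ f)).1 (by rw [map_sub, hT₀, hb, sub_self])
      refine ⟨θ₂ y, ?_⟩
      rw [hδ₂, hy, map_sub, hD₃.apply_apply_eq_zero, sub_zero]
end snake

/-- The cokernel of a homomorphism of graded modules. -/
def coker {N N' : GrMod k} (φ : hom N N') : GrMod k where
  obj v := N'.obj v ⧸ LinearMap.range (φ.1 v)
  X l v w hw := Submodule.mapQ _ _ (N'.X l v w hw) (by
    rintro _ ⟨x, rfl⟩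
    exact ⟨N.X l v w hw x, φ.2 l v w hw x⟩)
  X_comm l m v w y hw hy s := by
    obtain ⟨c, rfl⟩ := Submodule.Quotient.mk_surjective _ s
    exact congrArg Submodule.Quotient.mk (N'.X_comm l m v w y hw hy c)

/-- The projection onto the cokernel. -/
def cokerMk {N N' : GrMod k} (φ : hom N N') : hom N' (coker φ) :=
  ⟨fun _ => Submodule.mkQ _, fun _ _ _ _ _ => rfl⟩

theorem cokerMk_surjective {N N' : GrMod k} (φ : hom N N') (v : ℤ) :
    Function.Surjective ((cokerMk φ).1 v) := Submodule.mkQ_surjective _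

theorem cokerMk_exact {N N' : GrMod k} (φ : hom N N') (v : ℤ) :
    Function.Exact (φ.1 v) ((cokerMk φ).1 v) := fun _ => Submodule.Quotient.mk_eq_zero _

theorem pi_surjective {ι : Type*} {A B : ι → Type*} [∀ i, AddCommGroup (A i)] [∀ i, Module k (A i)]
    [∀ i, AddCommGroup (B i)] [∀ i, Module k (B i)] (f : ∀ i, A i →ₗ[k] B i)
    (hf : ∀ i, Function.Surjective (f i)) :
    Function.Surjective (LinearMap.pi fun i => (f i).comp (LinearMap.proj i)) := fun y => by
  choose x hx using fun i => hf i (y i)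
  exact ⟨x, funext hx⟩

theorem pi_exact {ι : Type*} {A B C : ι → Type*} [∀ i, AddCommGroup (A i)] [∀ i, Module k (A i)]
    [∀ i, AddCommGroup (B i)] [∀ i, Module k (B i)] [∀ i, AddCommGroup (C i)] [∀ i, Module k (C i)]
    (f : ∀ i, A i →ₗ[k] B i) (g : ∀ i, B i →ₗ[k] C i) (hfg : ∀ i, Function.Exact (f i) (g i)) :
    Function.Exact (LinearMap.pi fun i => (f i).comp (LinearMap.proj i))
      (LinearMap.pi fun i => (g i).comp (LinearMap.proj i)) := fun y => by
  constructor
  · intro h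
    choose x hx using fun i => (hfg i (y i)).1 (congrFun h i)
    exact ⟨x, funext hx⟩
  · rintro ⟨x, rfl⟩
    exact funext fun i => (hfg i).apply_apply_eq_zero _

section lcochainMap
variable {r₀ r₁ r₂ : ℕ} {d₀ : Fin r₀ → ℤ} {d₁ : Fin r₁ → ℤ} {d₂ : Fin r₂ → ℤ}

/-- The map of Čech cochains induced by a map of free modules. -/
def lcochainMap (D : hom (free (k := k) d₁) (free d₀)) (v : ℤ) (p : ℕ) :
    lcochain (k := k) d₁ v p →ₗ[k] lcochain (k := k) d₀ v p :=
  LinearMap.pi fun I => ((laurMat (Set.range I) D).1 v).comp (LinearMap.proj I)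

theorem lcechD_lcochainMap (D : hom (free (k := k) d₁) (free d₀)) (v : ℤ) (p : ℕ)
    (y : lcochain (k := k) d₁ v p) :
    lcechD d₀ v p (lcochainMap D v p y) = lcochainMap D v (p + 1) (lcechD d₁ v p y) := by
  funext I
  simp only [lcechD, lcochainMap, LinearMap.pi_apply, LinearMap.sum_apply, LinearMap.smul_apply,
    LinearMap.comp_apply, LinearMap.proj_apply, map_sum, map_smul, laurMat_laurMap]

theorem lcochainMap_exact (G : hom (free (k := k) d₂) (free d₁)) (D : hom (free (k := k) d₁) (free d₀))
    (h : ∀ v, Function.Exact (G.1 v) (D.1 v)) (v : ℤ) (p : ℕ) :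
    Function.Exact (lcochainMap G v p) (lcochainMap D v p) :=
  pi_exact _ _ fun I => isLoc_toLaur.exact isLoc_toLaur isLoc_toLaur D G (laurMat _ D)
    (laurMat (Set.range I) G) (laurMat_toLaur D) (laurMat_toLaur G) h v

theorem lresidue_lcochainMap (D : hom (free (k := k) d₁) (free d₀)) (v : ℤ)
    (f : lcochain (k := k) d₁ v 3) :
    lresidue d₀ v (lcochainMap D v 3 f) = (dualMat D).1 v (lresidue d₁ v f) :=
  residue_laurMat D v _

theorem lcechD_one_two_exact (v : ℤ) : Function.Exact (lcechD (k := k) d₀ v 1) (lcechD d₀ v 2) :=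
  fun y => ⟨lcechD_exact v y, by rintro ⟨b, rfl⟩; exact lcechD_two_one v b⟩

/-- Every element of the dual is a residue, and residues commute with maps of free modules, so the
claim follows from the vanishing of the composition on Čech cochains. -/
theorem dualMat_comp_eq_zero (G : hom (free (k := k) d₂) (free d₁))
    (D : hom (free (k := k) d₁) (free d₀)) (h : ∀ v, Function.Exact (G.1 v) (D.1 v)) (v : ℤ)
    (ξ : (dualFree (k := k) d₂).obj v) : (dualMat D).1 v ((dualMat G).1 v ξ) = 0 := by
  obtain ⟨f, rfl⟩ := lresidue_surjective v ξ
  rw [← lresidue_lcochainMap, ← lresidue_lcochainMap,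
    (lcochainMap_exact G D h v 3).apply_apply_eq_zero, map_zero]
end lcochainMap

end P3

end

/-! ### The Čech complex of F, presented by its free resolution -/

noncomputable section
universe u
open AlgebraicGeometry CategoryTheory TopologicalSpace
namespace P3
attribute [local instance] MvPolynomial.gradedAlgebra
variable {k : Type u} [Field k]
open GrMod (poly hom homDeg free)

variable {F : (space k).Modules} (P : GrMod.MinimalFreeResolution (H0star F))

theorem invOn_twMod_inter (F : (space k).Modules) {p : ℕ} (I : Fin (p + 1) ↪o Fin 4) :
    InvOn (Set.range I) (twMod F (inter k I)) := by
  rintro _ ⟨a, rfl⟩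
  exact bijective_X (iInf_le _ a)

/-- The augmentation of the resolution, with values in global sections. -/
def globalAug : hom (free (k := k) (P.deg 0)) (twMod F ⊤) := P.ε

theorem exists_augmentation {p : ℕ} (I : Fin (p + 1) ↪o Fin 4) :
    ∃ θ : hom (laur (P.deg 0) (Set.range I)) (twMod F (inter k I)), ∀ v s,
      θ.1 v ((toLaur (P.deg 0) (Set.range I)).1 v s) = (twRes F le_top).1 v ((globalAug P).1 v s) :=
  isLoc_toLaur.exists_extension (invOn_twMod_inter F I) (comp (twRes F le_top) (globalAug P))

/-- The map `⨁_a 𝒪(-d_a) → F` given by the resolution, on sections over intersections of charts. -/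
def augmentation {p : ℕ} (I : Fin (p + 1) ↪o Fin 4) :
    hom (laur (P.deg 0) (Set.range I)) (twMod F (inter k I)) := (exists_augmentation P I).choose

theorem augmentation_toLaur {p : ℕ} (I : Fin (p + 1) ↪o Fin 4) (v : ℤ)
    (s : (free (P.deg 0)).obj v) : (augmentation P I).1 v ((toLaur (P.deg 0) (Set.range I)).1 v s) =
      (twRes F le_top).1 v ((globalAug P).1 v s) := (exists_augmentation P I).choose_spec v s

/-- Both sides are maps out of a localization into a module on which the inverted variables are
already invertible, so it suffices to compare them on the free module itself. -/
theorem twRes_augmentation {p : ℕ} (a : Fin (p + 2)) (I : Fin (p + 2) ↪o Fin 4) (v : ℤ)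
    (x : (laur (P.deg 0) (Set.range (face a I))).obj v) :
    (twRes F (inter_le I a)).1 v ((augmentation P (face a I)).1 v x) =
      (augmentation P I).1 v ((laurMap (P.deg 0) (range_face a I)).1 v x) := by
  refine (isLoc_toLaur (d := P.deg 0) (S := Set.range (face a I))).hom_ext
    (ψ := comp (twRes F (inter_le I a)) (augmentation P (face a I)))
    (ψ' := comp (augmentation P I) (laurMap (P.deg 0) (range_face a I)))
    (fun i hi => invOn_twMod_inter F I i (range_face a I hi)) (fun v s => ?_) v x
  rw [comp_apply, comp_apply, augmentation_toLaur, twRes_twRes]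
  exact (augmentation_toLaur P I v s).symm

theorem augmentation_surjective (hF : F.IsQuasicoherent) {p : ℕ} (I : Fin (p + 1) ↪o Fin 4) (v : ℤ) :
    Function.Surjective ((augmentation P I).1 v) :=
  (isLoc_twRes_inter hF I).surjective isLoc_toLaur (globalAug P) _ (augmentation_toLaur P I) P.surjective v

theorem augmentation_exact (hF : F.IsQuasicoherent) {p : ℕ} (I : Fin (p + 1) ↪o Fin 4) (v : ℤ) :
    Function.Exact ((laurMat (Set.range I) (P.d 0)).1 v) ((augmentation P I).1 v) :=
  (isLoc_twRes_inter hF I).exact isLoc_toLaur isLoc_toLaur (globalAug P) (P.d 0) _ _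
    (augmentation_toLaur P I) (laurMat_toLaur (P.d 0)) P.exact_zero v

/-- The augmentation on Čech cochains. -/
def cochainAug (v : ℤ) (p : ℕ) : lcochain (k := k) (P.deg 0) v p →ₗ[k] cochain F v p :=
  LinearMap.pi fun I => ((augmentation P I).1 v).comp (LinearMap.proj I)

theorem cechD_apply (v : ℤ) (p : ℕ) (c : cochain F v p) (I : Fin (p + 2) ↪o Fin 4) :
    cechD F v p c I = ∑ a : Fin (p + 2), ((-1 : k) ^ (a : ℕ)) •
      twistRes F v (inter_le I a) (c (face a I)) := by
  simp only [cechD, LinearMap.pi_apply, LinearMap.sum_apply, LinearMap.smul_apply,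
    LinearMap.comp_apply, LinearMap.proj_apply]

theorem lcechD_apply {r : ℕ} {d : Fin r → ℤ} (v : ℤ) (p : ℕ) (y : lcochain (k := k) d v p)
    (I : Fin (p + 2) ↪o Fin 4) :
    lcechD d v p y I = ∑ a : Fin (p + 2), ((-1 : k) ^ (a : ℕ)) •
      (laurMap d (range_face a I)).1 v (y (face a I)) := by
  simp only [lcechD, LinearMap.pi_apply, LinearMap.sum_apply, LinearMap.smul_apply,
    LinearMap.comp_apply, LinearMap.proj_apply]

theorem cechD_cochainAug (v : ℤ) (p : ℕ) (y : lcochain (k := k) (P.deg 0) v p) :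
    cechD F v p (cochainAug P v p y) = cochainAug P v (p + 1) (lcechD (P.deg 0) v p y) := by
  funext I
  refine (cechD_apply v p _ I).trans ?_
  refine Eq.trans ?_ (congrArg ((augmentation P I).1 v) (lcechD_apply v p y I)).symm
  rw [map_sum]
  refine Finset.sum_congr rfl fun a _ => ?_
  rw [map_smul, ← twRes_augmentation]
  rfl

theorem cochainAug_surjective (hF : F.IsQuasicoherent) (v : ℤ) (p : ℕ) :
    Function.Surjective (cochainAug P v p) :=
  pi_surjective _ fun I => augmentation_surjective P hF I v

theorem cochainAug_exact (hF : F.IsQuasicoherent) (v : ℤ) (p : ℕ) :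
    Function.Exact (lcochainMap (P.d 0) v p) (cochainAug P v p) :=
  pi_exact _ _ fun I => augmentation_exact P hF I v

/-- Multiplication by `X_l` on the Čech cochains of a free module. -/
def lcochainX {r : ℕ} (d : Fin r → ℤ) (p : ℕ) (l : Fin 4) (v w : ℤ) (hw : v + 1 = w) :
    lcochain (k := k) d v p →ₗ[k] lcochain (k := k) d w p :=
  LinearMap.pi fun I => ((laur d (Set.range I)).X l v w hw).comp (LinearMap.proj I)

theorem lcechD_lcochainX {r : ℕ} {d : Fin r → ℤ} (p : ℕ) (l : Fin 4) (v w : ℤ) (hw : v + 1 = w)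
    (y : lcochain (k := k) d v p) :
    lcechD d w p (lcochainX d p l v w hw y) = lcochainX d (p + 1) l v w hw (lcechD d v p y) := by
  funext I
  refine (lcechD_apply w p _ I).trans ?_
  refine Eq.trans ?_ (congrArg ((laur d (Set.range I)).X l v w hw) (lcechD_apply v p y I)).symm
  rw [map_sum]
  refine Finset.sum_congr rfl fun a _ => ?_
  rw [map_smul, ← (laurMap d (range_face a I)).2]
  rfl

theorem lcochainMap_lcochainX {r₀ r₁ : ℕ} {d₀ : Fin r₀ → ℤ} {d₁ : Fin r₁ → ℤ}
    (D : hom (free (k := k) d₁) (free d₀)) (p : ℕ) (l : Fin 4) (v w : ℤ) (hw : v + 1 = w)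
    (y : lcochain (k := k) d₁ v p) :
    lcochainMap D w p (lcochainX d₁ p l v w hw y) = lcochainX d₀ p l v w hw (lcochainMap D v p y) :=
  funext fun I => (laurMat (Set.range I) D).2 l v w hw (y I)

theorem cochainAug_lcochainX (p : ℕ) (l : Fin 4) (v w : ℤ) (hw : v + 1 = w)
    (y : lcochain (k := k) (P.deg 0) v p) :
    cochainAug P w p (lcochainX (P.deg 0) p l v w hw y) = cochainX F p l v w hw (cochainAug P v p y) :=
  funext fun I => (augmentation P I).2 l v w hw (y I)

theorem lresidue_lcochainX {r : ℕ} (d : Fin r → ℤ) (l : Fin 4) (v w : ℤ) (hw : v + 1 = w)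
    (f : lcochain (k := k) d v 3) :
    lresidue d w (lcochainX d 3 l v w hw f) = (dualFree d).X l v w hw (lresidue d v f) :=
  (residue d _).2 l v w hw _

/-- The connecting homomorphism from `H²_*(F)` to the third cohomology of the first syzygy sheaf. -/
theorem exists_connecting_hom (hF : F.IsQuasicoherent) :
    ∃ i : hom (Hstar F 2) (coker (dualMat (P.d 1))), (∀ v, Function.Injective (i.1 v)) ∧
      ∀ v b, (cokerMk (dualMat (P.d 1))).1 v b ∈ LinearMap.range (i.1 v) ↔
        (dualMat (P.d 0)).1 v b = 0 := by
  have key := fun v => exists_connecting (δ₁ := cechD F v 1) (δ₂ := cechD F v 2)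
    (d₁ := lcechD (P.deg 0) v 1) (d₂ := lcechD (P.deg 0) v 2) (e₂ := lcechD (P.deg 1) v 2)
    (D₂ := lcochainMap (P.d 0) v 2) (D₃ := lcochainMap (P.d 0) v 3) (G₃ := lcochainMap (P.d 1) v 3)
    (θ₁ := cochainAug P v 1) (θ₂ := cochainAug P v 2) (θ₃ := cochainAug P v 3)
    (ρ₀ := lresidue (P.deg 0) v) (ρ₁ := lresidue (P.deg 1) v) (ρ₂ := lresidue (P.deg 2) v)
    (T₀ := (dualMat (P.d 0)).1 v) (T₁ := (dualMat (P.d 1)).1 v)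
    (cochainAug_surjective P hF v 1) (cochainAug_surjective P hF v 2)
    (cechD_cochainAug P v 1) (cechD_cochainAug P v 2) (cochainAug_exact P hF v 2)
    (cochainAug_exact P hF v 3) (lcochainMap_exact (P.d 1) (P.d 0) (P.exact_succ 0) v 3)
    (lcechD_lcochainMap (P.d 0) v 2) (lcechD_one_two_exact v) (lresidue_exact v) (lresidue_exact v)
    (lresidue_surjective v) (lresidue_surjective v) (lresidue_lcochainMap (P.d 0) v)
    (lresidue_lcochainMap (P.d 1) v)
  choose i hinj hi hrange using key
  -- For linearity over the polynomial ring: multiplying a pair (y, f) that computes i on a class by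
  -- X_l yields a pair that computes i on the multiplied class.
  refine ⟨⟨i, fun l v w hw z => ?_⟩, hinj, hrange⟩
  obtain ⟨⟨z, hz⟩, rfl⟩ := Submodule.Quotient.mk_surjective _ z
  obtain ⟨y, f, hyf, rfl⟩ := exists_lift_cocycle (cochainAug_surjective P hF v 2)
    (cechD_cochainAug P v 2) (cochainAug_exact P hF v 3) hz
  refine Eq.trans ?_ (congrArg ((coker (dualMat (P.d 1))).X l v w hw) (hi v y f hz hyf).symm)
  have hyf' : lcechD (P.deg 0) w 2 (lcochainX _ 2 l v w hw y) =
      lcochainMap (P.d 0) w 3 (lcochainX _ 3 l v w hw f) := by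
    rw [lcechD_lcochainX, hyf, lcochainMap_lcochainX]
  have hz' : cochainAug P w 2 (lcochainX _ 2 l v w hw y) ∈ LinearMap.ker (cechD F w 2) := by
    rw [cochainAug_lcochainX]
    exact cochainX_mem_ker F 2 l v w hw _ hz
  refine Eq.trans (congrArg (i w) ?_) ((hi w _ _ hz' hyf').trans ?_)
  · exact congrArg (Submodule.Quotient.mk (p := (coboundaries F w 2).submoduleOf _))
      (Subtype.ext (cochainAug_lcochainX P 2 l v w hw y).symm)
  · exact congrArg Submodule.Quotient.mk (lresidue_lcochainX _ l v w hw f)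

theorem h_three (hF : F.IsQuasicoherent) (v : ℤ) : h F 3 v = Module.finrank k
    ((dualFree (k := k) (P.deg 0)).obj v ⧸ LinearMap.range ((dualMat (P.d 0)).1 v)) :=
  finrank_top_cohomology (δ₂ := cechD F v 2) (d₂ := lcechD (P.deg 0) v 2)
    (D₃ := lcochainMap (P.d 0) v 3) (θ₂ := cochainAug P v 2) (θ₃ := cochainAug P v 3)
    (ρ₀ := lresidue (P.deg 0) v) (ρ₁ := lresidue (P.deg 1) v) (T₀ := (dualMat (P.d 0)).1 v)
    (cochainAug_surjective P hF v 2) (cochainAug_surjective P hF v 3) (cechD_cochainAug P v 2)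
    (cochainAug_exact P hF v 3) (lresidue_exact v) (lresidue_surjective v) (lresidue_surjective v)
    (lresidue_lcochainMap (P.d 0) v) (by
      -- There are only four charts, so there are no Čech cochains in degree four and every
      -- 3-cochain is a cocycle.
      refine eq_top_iff.2 fun c _ => funext fun I => ?_
      have := Fintype.card_le_of_injective I I.injective
      simp at this)

end P3

end

/-! ### Betti numbers and the conclusion -/

noncomputable section
universe u
namespace P3
variable {k : Type u} [Field k]
open GrMod (poly hom homDeg free)

theorem sum_fiber {r : ℕ} (d : Fin r → ℤ) (f : ℤ → ℤ) {s : Finset ℤ} (hs : ∀ a, d a ∈ s) :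
    ∑ a, f (d a) = ∑ i ∈ s, (Fintype.card {a // d a = i} : ℤ) * f i := by
  rw [← Finset.sum_fiberwise_of_maps_to (fun a _ => hs a)]
  refine Finset.sum_congr rfl fun i _ => ?_
  rw [Finset.sum_congr rfl fun a ha => by rw [(Finset.mem_filter.1 ha).2], Finset.sum_const,
    Fintype.card_subtype, nsmul_eq_mul]

theorem altSum_eq_finsum {N : GrMod k} (P : GrMod.MinimalFreeResolution N) (f : ℤ → ℤ) :
    altSum P f = ∑ᶠ i : ℤ, ((P.betti 0 i : ℤ) - P.betti 1 i + P.betti 2 i) * f i := by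
  let s : Finset ℤ := (Finset.univ.image (P.deg 0) ∪ Finset.univ.image (P.deg 1)) ∪
    Finset.univ.image (P.deg 2)
  have h0 : ∀ a, P.deg 0 a ∈ s := fun a => by simp [s]
  have h1 : ∀ a, P.deg 1 a ∈ s := fun a => by simp [s]
  have h2 : ∀ a, P.deg 2 a ∈ s := fun a => by simp [s]
  have hb : ∀ j, (∀ a, P.deg j a ∈ s) → ∀ i ∉ s, P.betti j i = 0 := fun j hj i hi =>
    Fintype.card_eq_zero_iff.2 ⟨fun a => hi (a.2 ▸ hj a.1)⟩
  rw [finsum_eq_sum_of_support_subset (s := s), altSum, sum_fiber _ f h0, sum_fiber _ f h1,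
    sum_fiber _ f h2, ← Finset.sum_sub_distrib, ← Finset.sum_add_distrib]
  · refine Finset.sum_congr rfl fun i _ => ?_
    rw [GrMod.MinimalFreeResolution.betti, GrMod.MinimalFreeResolution.betti,
      GrMod.MinimalFreeResolution.betti]
    ring
  · intro i hi
    by_contra h
    have h' : i ∉ s := h
    exact hi (by simp [hb 0 h0 i h', hb 1 h1 i h', hb 2 h2 i h'])

theorem finrank_hom_H2 {F : (space k).Modules} (hF : F.IsQuasicoherent)
    (h4 : homDeg (-4) (H0star F) (H0star F) = ⊥) (P : GrMod.MinimalFreeResolution (H0star F)) :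
    Module.Finite k (hom (H0star F) (Hstar F 2)) ∧
      (Module.finrank k (hom (H0star F) (Hstar F 2)) : ℤ) =
        altSum P fun v => (h F 2 v : ℤ) - h F 3 v := by
  -- Assembly of 0 → H²_*(F) → Q → B_0: the map δ is induced by B_1 → B_0, which kills the image of
  -- B_2.
  obtain ⟨i, hi, hrange⟩ := exists_connecting_hom P hF
  obtain ⟨δ, hδ⟩ := exists_desc (cokerMk (dualMat (P.d 1))) (cokerMk_surjective _)
    (dualMat (P.d 0)) fun v x hx => by
      obtain ⟨y, rfl⟩ := (cokerMk_exact _ v x).1 hx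
      exact dualMat_comp_eq_zero (P.d 1) (P.d 0) (P.exact_succ 0) v y
  have hδ' : ∀ v x, δ.1 v ((cokerMk (dualMat (P.d 1))).1 v x) = (dualMat (P.d 0)).1 v x :=
    fun v x => LinearMap.congr_fun (congrFun (congrArg Subtype.val hδ) v) x
  have key := finrank_hom_eq P (d_one_injective P (koszulExact_H0star)) h4
    (coker (dualMat (P.d 1))) (Hstar F 2) (cokerMk _) δ i (cokerMk_surjective _) (cokerMk_exact _)
    hδ' hi fun v q => by
      obtain ⟨b, rfl⟩ := cokerMk_surjective _ v q
      rw [hδ']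
      exact (hrange v b).symm
  refine ⟨key.1, key.2.trans ?_⟩
  congr 1
  funext v
  rw [h_three P hF v]
  rfl

end P3

end

theorem lemma3p4 {k : Type*} [Field k] [IsAlgClosed k] (F : (P3.space k).Modules)
    (hcoh : P3.IsCoherent F) (hrefl : P3.IsReflexive F) (hrank : P3.HasRank F 2)
    (hF : P3.GrMod.homDeg (-4) (P3.H0star F) (P3.H0star F) = ⊥)
    (P : P3.GrMod.MinimalFreeResolution (P3.H0star F)) :
    Module.Finite k (P3.GrMod.hom (P3.H0star F) (P3.Hstar F 2)) ∧
    (Module.finrank k (P3.GrMod.hom (P3.H0star F) (P3.Hstar F 2)) : ℤ) =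
      ∑ᶠ i : ℤ, ((P.betti 0 i : ℤ) - P.betti 1 i + P.betti 2 i) *
        ((P3.h F 2 i : ℤ) - P3.h F 3 i) := by
  have h := P3.finrank_hom_H2 hcoh.isQuasicoherent hF P
  exact ⟨h.1, h.2.trans (P3.altSum_eq_finsum P _)⟩
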